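/- For a group $G$, a $G$-complex is a finite simplicial complex $X$ that is aspherical (non-empty, connected, $\pi_n(X)=0$ for all $n\ge 2$) with $\pi_1(X)\cong G$. The group $G$ is of finite type if a $G$-complex exists; its geometric dimension $\mathrm{gd}(G)$ is then the minimal dimension of a $G$-complex. A piecewise Riemannian metric $g$ on a finite simplicial complex $X$ is a smooth Riemannian metric on each closed simplex, such that the metric of a simplex restricts to the metric of each of its faces. For $X$ connected of dimension $m$, let $\mathrm{vol}$ denote the $m$-dimensional Riemannian volume, let $\tilde g$ be the pull-back of $g$ to the universal cover $\widetilde X$, and put $$\mathrm{ent}(X,g)=\lim_{t\to\infty}\frac1t\log \mathrm{vol}(B_{x_0}(t),\tilde g),$$ $$\omega(X,g)=\mathrm{ent}(X,g)\,\mathrm{vol}(X,g)^{1/\dim X},\qquad \omega(X)=\inf_g\omega(X,g),$$ where $B_{x_0}(t)$ is the ball of radius $t$ centered at a point $x_0\in\widetilde X$ (the limit exists and does not depend on $x_0$) and the infimum is over all piecewise Riemannian metrics $g$ on $X$. (If $X$ is a point, $\omega(X)=0$.) **Proposition.** Let $G$ be a group of finite type. Then the following are equivalent: 1. $\omega(X)=0$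 for some $G$-complex $X$ with $\dim(X)=\mathrm{gd}(G)$. 2. $\omega(X)=0$ for every $G$-complex $X$ (of any dimension). -/

import Mathlib

open MeasureTheory Filter
open scoped ENNReal ContDiff Topology

noncomputable section

namespace MinVolEntropy

variable {V : Type*} [Fintype V]

/-! ### Finite simplicial complexes and their realizations

A finite simplicial complex is an `AbstractSimplicialComplex V` on a finite vertex type `V`. -/

/-- The carrier of a point in barycentric coordinates: the vertices with non-zero coordinate. -/
def carrier (x : V → ℝ) : Finset V := (Set.toFinite (Function.support x)).toFinset

/-- The closed simplex spanned by the vertices in `s`, in barycentric coordinates. -/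
def closedSimplex (s : Finset V) : Set (V → ℝ) :=
  {x | x ∈ stdSimplex ℝ V ∧ ∀ v, v ∉ s → x v = 0}

/-- The tangent space (direction) of the simplex spanned by `s`. -/
def tangentSpace (s : Finset V) : Set (V → ℝ) :=
  {w | (∀ v, v ∉ s → w v = 0) ∧ ∑ v, w v = 0}

/-- The geometric realization of `K`, as a subset of `V → ℝ`: the union of its closed simplices. -/
def realization (K : AbstractSimplicialComplex V) : Set (V → ℝ) :=
  {x | ∃ s ∈ K.faces, x ∈ closedSimplex s}

/-- The geometric realization of `K` as a topological space, with the topology induced from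
`V → ℝ`. -/
abbrev Space (K : AbstractSimplicialComplex V) : Type _ := ↥(realization K)

open Classical in
/-- The dimension of a finite simplicial complex. A `d`-dimensional face has `d + 1` vertices. -/
def dim (K : AbstractSimplicialComplex V) : ℕ :=
  (Finset.univ.filter (fun s : Finset V => s ∈ K.faces)).sup (fun s => s.card - 1)

/-! ### `G`-complexes -/

/-- A topological space is aspherical if it is (non-empty and) path connected and its homotopy
groups of degree at least two vanish. -/
def IsAspherical (X : Type*) [TopologicalSpace X] : Prop :=
  PathConnectedSpace X ∧ ∀ n : ℕ, 2 ≤ n → ∀ x : X, Subsingleton (HomotopyGroup.Pi n X x)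

/-- A finite simplicial complex `K` is a `G`-complex if it is aspherical with fundamental group
isomorphic to `G`. -/
def IsGComplex (G : Type*) [Group G] (K : AbstractSimplicialComplex V) : Prop :=
  IsAspherical (Space K) ∧ ∃ x : Space K, Nonempty (FundamentalGroup (Space K) x ≃* G)

/-- `G` is of finite type if there is a `G`-complex. (A finite vertex set can always be taken
in `Type`.) -/
def IsOfFiniteType (G : Type*) [Group G] : Prop :=
  ∃ (V : Type) (_ : Fintype V) (K : AbstractSimplicialComplex V), IsGComplex G K

/-- The geometric dimension of `G`: the minimal dimension of a `G`-complex. -/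
def geometricDimension (G : Type*) [Group G] : ℕ :=
  sInf {d | ∃ (V : Type) (_ : Fintype V) (K : AbstractSimplicialComplex V),
    IsGComplex G K ∧ dim K = d}

/-! ### Piecewise Riemannian metrics -/

/-- A piecewise Riemannian metric on `K`: a smooth Riemannian metric on every closed simplex, such
that the metric of a simplex restricts to the metric of each of its faces.

`form s x` is the inner product on the tangent space of the simplex `s` at its point `x`; only
the values at faces `s`, points `x` of `s` and vectors tangent to `s` carry information. -/
structure PiecewiseRiemannianMetric (K : AbstractSimplicialComplex V) where
  form : Finset V → (V → ℝ) → (V → ℝ) →ₗ[ℝ] (V → ℝ) →ₗ[ℝ] ℝ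
  symm : ∀ s ∈ K.faces, ∀ x ∈ closedSimplex s, ∀ v ∈ tangentSpace s, ∀ w ∈ tangentSpace s,
    form s x v w = form s x w v
  pos : ∀ s ∈ K.faces, ∀ x ∈ closedSimplex s, ∀ v ∈ tangentSpace s, v ≠ 0 → 0 < form s x v v
  smooth : ∀ s ∈ K.faces, ∀ v ∈ tangentSpace s, ∀ w ∈ tangentSpace s,
    ContDiffOn ℝ ∞ (fun x => form s x v w) (closedSimplex s)
  compat : ∀ s ∈ K.faces, ∀ t ∈ K.faces, t ⊆ s → ∀ x ∈ closedSimplex t,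
    ∀ v ∈ tangentSpace t, ∀ w ∈ tangentSpace t, form s x v w = form t x v w

/-! ### Riemannian volume -/

open Classical in
/-- The edge vector pointing from the vertex `b` to the vertex `v`. -/
def edgeVector (b v : V) : V → ℝ := Pi.single v 1 - Pi.single b 1

/-- The vertices of `s` other than `b`, which index the coordinates of the affine chart at `b`. -/
def ChartIndex (s : Finset V) (b : V) : Type _ := {v : V // v ∈ s ∧ v ≠ b}

instance chartIndexFintype (s : Finset V) (b : V) : Fintype (ChartIndex s b) :=
  Fintype.ofInjective (Subtype.val : {v : V // v ∈ s ∧ v ≠ b} → V) Subtype.val_injective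

open Classical in
/-- The affine chart of the simplex `s` based at its vertex `b`; its coordinates are indexed by the
other vertices of `s`. -/
def chart (s : Finset V) (b : V) (y : ChartIndex s b → ℝ) : V → ℝ :=
  Pi.single b 1 + ∑ v, y v • edgeVector b v.1

/-- The domain of the affine chart of the simplex `s` based at its vertex `b`. -/
def chartDomain (s : Finset V) (b : V) : Set (ChartIndex s b → ℝ) :=
  {y | (∀ v, 0 ≤ y v) ∧ ∑ v, y v ≤ 1}

variable {K : AbstractSimplicialComplex V}

open Classical in
/-- The Riemannian volume measure of the simplex `s`, computed in the affine chart at the vertex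
`b` as `√(det g) dy`. It does not depend on `b ∈ s`. -/
def simplexMeasure (g : PiecewiseRiemannianMetric K) (s : Finset V) (b : V) : Measure (V → ℝ) :=
  Measure.map (chart s b)
    ((volume.restrict (chartDomain s b)).withDensity fun y =>
      ENNReal.ofReal (Real.sqrt (Matrix.det
        (Matrix.of fun v w : ChartIndex s b =>
          g.form s (chart s b y) (edgeVector b v.1) (edgeVector b w.1)))))

open Classical in
/-- The volume measure of `(K, g)`, in the dimension of `K`: the sum of the Riemannian volume
measures of the simplices of top dimension. -/
def volumeMeasure (g : PiecewiseRiemannianMetric K) : Measure (Space K) :=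
  Measure.comap Subtype.val
    (∑ s ∈ Finset.univ.filter (fun s : Finset V => s ∈ K.faces ∧ s.card = dim K + 1),
      if h : s.Nonempty then simplexMeasure g s h.choose else 0)

/-- The total volume `vol(K, g)`. -/
def totalVolume (g : PiecewiseRiemannianMetric K) : ℝ≥0∞ := volumeMeasure g Set.univ

/-! ### Length of paths -/

/-- A path in the realization of `K`, as a curve `ℝ → (V → ℝ)` (constant outside `[0, 1]`). -/
def curve {x y : Space K} (γ : Path x y) (t : ℝ) : V → ℝ := (γ.extend t : V → ℝ)

/-- A path is piecewise `C¹` if `[0, 1]` can be subdivided into finitely many intervals, each of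
which is mapped into a closed simplex in a `C¹` way. -/
def IsPiecewiseC1 {x y : Space K} (γ : Path x y) : Prop :=
  ∃ (n : ℕ) (τ : Fin (n + 1) → ℝ), Monotone τ ∧ τ 0 = 0 ∧ τ (Fin.last n) = 1 ∧
    ∀ i : Fin n,
      (∃ s ∈ K.faces, ∀ t ∈ Set.Icc (τ i.castSucc) (τ i.succ), curve γ t ∈ closedSimplex s) ∧
      ContDiffOn ℝ 1 (curve γ) (Set.Icc (τ i.castSucc) (τ i.succ))

/-- The length of a piecewise `C¹` path with respect to `g`: the integral of its speed. Where the
path is differentiable at an interior time, its velocity is tangent to the carrier of the point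
(the coordinates that vanish there are at a minimum). -/
def pathLength (g : PiecewiseRiemannianMetric K) {x y : Space K} (γ : Path x y) : ℝ≥0∞ :=
  ∫⁻ t in Set.Icc (0 : ℝ) 1, ENNReal.ofReal (Real.sqrt
    (g.form (carrier (curve γ t)) (curve γ t) (deriv (curve γ) t) (deriv (curve γ) t)))

/-! ### The universal cover -/

/-- The universal cover of the realization of `K` (assumed connected): pairs of a point `y` and a
homotopy class, with fixed end points, of paths from the base point `x₀` to `y`. The covering
projection is `Sigma.fst`. -/
abbrev UniversalCover (x₀ : Space K) : Type _ := Σ y : Space K, Path.Homotopic.Quotient x₀ y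

/-- The distance, for the pulled-back metric on the universal cover, from the class of the
constant path at `x₀` to the point `p`: the paths between these two points are the lifts of the
paths of the homotopy class `p.2`, and have the same length. -/
def liftedDist (g : PiecewiseRiemannianMetric K) (x₀ : Space K) (p : UniversalCover x₀) : ℝ≥0∞ :=
  ⨅ (γ : Path x₀ p.1) (_ : IsPiecewiseC1 γ) (_ : Path.Homotopic.Quotient.mk γ = p.2), pathLength g γ

/-- The ball of radius `t` in the universal cover, centered at the class of the constant path. -/
def liftedBall (g : PiecewiseRiemannianMetric K) (x₀ : Space K) (t : ℝ) :
    Set (UniversalCover x₀) :=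
  {p | liftedDist g x₀ p < ENNReal.ofReal t}

/-- The volume of a subset `A` of the universal cover for the pulled-back metric. As the covering
projection is a local isometry, it is the integral over the base of the number of points of `A`
in the fibers. -/
def liftedVolume (g : PiecewiseRiemannianMetric K) (x₀ : Space K)
    (A : Set (UniversalCover x₀)) : ℝ≥0∞ :=
  ∫⁻ y, ((Set.encard {c : Path.Homotopic.Quotient x₀ y | (⟨y, c⟩ : UniversalCover x₀) ∈ A} : ℕ∞) :
    ℝ≥0∞) ∂(volumeMeasure g)

/-! ### Volume entropy -/

/-- The volume entropy, computed with balls centered above `x₀`: the exponential growth rate of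
the volume of balls in the universal cover. The limit exists for a connected complex, so the
upper limit is the limit. -/
def entropyAt (g : PiecewiseRiemannianMetric K) (x₀ : Space K) : EReal :=
  limsup (fun t : ℝ => ENNReal.log (liftedVolume g x₀ (liftedBall g x₀ t)) / (t : EReal)) atTop

/-- The volume entropy `ent(K, g)`. For a connected complex `entropyAt g x₀` does not depend on
`x₀`, so the supremum is the common value. -/
def entropy (g : PiecewiseRiemannianMetric K) : EReal := ⨆ x₀ : Space K, entropyAt g x₀

/-- `ω(K, g) = ent(K, g) · vol(K, g)^(1 / dim K)`. In dimension `0` the exponent is read as `0`; for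
a connected complex, which is then a point, the entropy and the product are `0`. -/
def normalizedEntropy (g : PiecewiseRiemannianMetric K) : EReal :=
  entropy g * ((totalVolume g ^ (1 / (dim K : ℝ)) : ℝ≥0∞) : EReal)

/-- The minimal volume entropy `ω(K)`: the infimum of `ω(K, g)` over all piecewise Riemannian
metrics `g` on `K`. -/
def minimalVolumeEntropy (K : AbstractSimplicialComplex V) : EReal :=
  ⨅ g : PiecewiseRiemannianMetric K, normalizedEntropy g

end MinVolEntropy

end

/-! From 2 to 1 it suffices to take a `G`-complex of minimal dimension. For the converse let `L` be
a `G`-complex of dimension `gd(G)` with `ω(L) = 0` and let `K` be any `G`-complex, so that `dim L ≤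
dim K`. Since the higher homotopy groups of `L` vanish, an isomorphism of fundamental groups is
induced by a map from `K` to `L`, built skeleton by skeleton from its values on edges. A piecewise
affine approximation `F` of this map is still injective on homotopy classes of paths
(`exists_plMap_injective`).

A metric `g` on `L` with small `ω(L, g)` is pulled back by `F`. The pull-back may degenerate, and it
jumps along the walls between the affine pieces of `F`. Near the walls it is therefore blended into
a large multiple of the standard inner product, and a small multiple is added everywhere
(`PLMap.blendMetric`). The resulting metric `h` dominates the pull-back, so `F` does not lengthen
segments. Since the blends converge to the pull-back almost everywhere, the volume of `h` can be
brought as close as desired to that of the pull-back. The latter is at most `C · vol(g)`, with `C`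
depending only on `F`, if the dimensions agree. It is zero if `dim L < dim K`, because the
derivative of `F` then has a kernel on every top simplex (`PLMap.exists_metric`).

Entropies are compared by counting points in fibers of the universal covers. Through `F`, the points
over `y` of the `h`-ball of radius `t` inject into the points over `F y` of the `g`-ball of radius
`2t`. In a connected complex such a count is at most the volume of a slightly larger ball divided by
the total volume. Hence `ent(h) ≤ 2 ent(g)`, whatever the dimensions are
(`IsNonexpanding.entropyAt_le`).

If both dimensions equal `n`, this gives `ω(K, h) ≤ 2 (C + 1)^(1/n) ω(L, g)`. If `dim L < dim K`,
the entropy stays bounded for a fixed `g` while the volume of `h` tends to zero. In both cases `ω(K)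
= 0` (`minimalVolumeEntropy_eq_zero_of_plMap`). -/

noncomputable section

namespace MinVolEntropy

/-! ### Extending maps from spheres to balls -/

section Sphere

variable {E : Type*} [NormedAddCommGroup E] [NormedSpace ℝ E] {X : Type*} [TopologicalSpace X]

/-- If a map on the unit sphere is homotopic to a map which extends to the unit ball, then it
extends to the unit ball. -/
theorem exists_extension_of_homotopy {φ : E → X} {G : ℝ × E → X} {Ψ : E → X}
    (hG : ContinuousOn G (Set.Icc (0 : ℝ) 1 ×ˢ Metric.sphere (0 : E) 1))
    (hG0 : ∀ x ∈ Metric.sphere (0 : E) 1, G (0, x) = φ x)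
    (hG1 : ∀ x ∈ Metric.sphere (0 : E) 1, G (1, x) = Ψ x)
    (hΨ : ContinuousOn Ψ (Metric.closedBall (0 : E) 1)) :
    ∃ Φ : E → X, ContinuousOn Φ (Metric.closedBall (0 : E) 1) ∧
      ∀ x ∈ Metric.sphere (0 : E) 1, Φ x = φ x := by
  classical
  -- The collar of norms between `1/2` and `1` carries the homotopy, with time `0` on the unit
  -- sphere. The inner ball carries `Ψ`, rescaled.
  let Φ : E → X := fun x => if ‖x‖ ≤ 1 / 2 then Ψ ((2 : ℝ) • x) else
    G (2 * (1 - ‖x‖), ‖x‖⁻¹ • x)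
  have hA : ContinuousOn Φ (Metric.closedBall (0 : E) (1 / 2)) := by
    have : ContinuousOn (fun x : E => Ψ ((2 : ℝ) • x)) (Metric.closedBall (0 : E) (1 / 2)) := by
      refine hΨ.comp (by fun_prop) fun x hx => ?_
      rw [mem_closedBall_zero_iff] at hx ⊢
      rw [norm_smul, Real.norm_ofNat]; linarith
    refine this.congr fun x hx => ?_
    rw [mem_closedBall_zero_iff] at hx
    simp only [Φ, if_pos hx]
  have hB : ContinuousOn Φ {x : E | 1 / 2 ≤ ‖x‖ ∧ ‖x‖ ≤ 1} := by
    have : ContinuousOn (fun x : E => G (2 * (1 - ‖x‖), ‖x‖⁻¹ • x))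
        {x : E | 1 / 2 ≤ ‖x‖ ∧ ‖x‖ ≤ 1} := by
      refine hG.comp ?_ fun x hx => ?_
      · refine ContinuousOn.prodMk (by fun_prop) (ContinuousOn.smul ?_ continuousOn_id)
        exact continuous_norm.continuousOn.inv₀ fun x hx => by
          have := hx.1; positivity
      · have h0 : ‖x‖ ≠ 0 := by have := hx.1; positivity
        refine ⟨⟨by linarith [hx.2], by linarith [hx.1]⟩, ?_⟩
        rw [mem_sphere_zero_iff_norm, norm_smul, norm_inv, norm_norm, inv_mul_cancel₀ h0]
    refine this.congr fun x hx => ?_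
    by_cases h : ‖x‖ ≤ 1 / 2
    · have h' : ‖x‖ = 1 / 2 := le_antisymm h hx.1
      have hs : (2 : ℝ) • x ∈ Metric.sphere (0 : E) 1 := by
        rw [mem_sphere_zero_iff_norm, norm_smul, Real.norm_ofNat, h']; norm_num
      simp only [Φ, if_pos h]
      rw [← hG1 _ hs, h']; norm_num
    · simp only [Φ, if_neg h]
  refine ⟨Φ, ?_, fun x hx => ?_⟩
  · have hu : Metric.closedBall (0 : E) 1 =
        Metric.closedBall (0 : E) (1 / 2) ∪ {x : E | 1 / 2 ≤ ‖x‖ ∧ ‖x‖ ≤ 1} := by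
      ext x
      simp only [mem_closedBall_zero_iff, Set.mem_union, Set.mem_ofPred_eq]
      constructor
      · intro h
        rcases le_total ‖x‖ (1 / 2) with h' | h'
        · exact Or.inl h'
        · exact Or.inr ⟨h', h⟩
      · rintro (h | h)
        · linarith
        · exact h.2
    rw [hu]
    refine hA.union_of_isClosed hB Metric.isClosed_closedBall ?_
    exact (isClosed_le continuous_const continuous_norm).inter
      (isClosed_le continuous_norm continuous_const)
  · have hx' : ‖x‖ = 1 := by simpa using hx
    have : ¬ ‖x‖ ≤ 1 / 2 := by rw [hx']; norm_num
    simp only [Φ, if_neg this]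
    rw [hx', ← hG0 x hx]; simp

/-- A map from the sphere of dimension `k` into a space with trivial `k`-th homotopy groups extends
to the ball. -/
theorem exists_extension_of_subsingleton_homotopyGroup {k : ℕ}
    (hX : ∀ x : X, Subsingleton (HomotopyGroup.Pi k X x)) {φ : ℝ × (Fin k → ℝ) → X}
    (hφ : ContinuousOn φ (Metric.sphere 0 1)) :
    ∃ Φ : ℝ × (Fin k → ℝ) → X, ContinuousOn Φ (Metric.closedBall 0 1) ∧
      ∀ x ∈ Metric.sphere (0 : ℝ × (Fin k → ℝ)) 1, Φ x = φ x := by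
  classical
  -- In the sup norm the unit sphere is the boundary of a cube. On it `β` equals `1` except in the
  -- interior of the face `x.1 = 1`.
  let β : ℝ × (Fin k → ℝ) → ℝ := fun x => max ‖x.2‖ (-x.1)
  have hβc : Continuous β := by fun_prop
  let e : ℝ × (Fin k → ℝ) := (1, 0)
  -- `u s x` moves from `x` straight to `-e`. Followed by normalization and run up to time `β x`, it
  -- pushes everything outside the open face `x.1 = 1` to the single point `-e`.
  let u : ℝ → ℝ × (Fin k → ℝ) → ℝ × (Fin k → ℝ) := fun s x => (1 - s) • x - s • e
  let nrm : ℝ × (Fin k → ℝ) → ℝ × (Fin k → ℝ) := fun x => ‖x‖⁻¹ • x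
  have hnrm : ∀ x, x ≠ 0 → nrm x ∈ Metric.sphere (0 : ℝ × (Fin k → ℝ)) 1 := by
    intro x hx
    have h0 : ‖x‖ ≠ 0 := norm_ne_zero_iff.mpr hx
    rw [mem_sphere_zero_iff_norm, norm_smul, norm_inv, norm_norm, inv_mul_cancel₀ h0]
  have hsph : ∀ x ∈ Metric.sphere (0 : ℝ × (Fin k → ℝ)) 1, |x.1| ≤ 1 ∧ ‖x.2‖ ≤ 1 := by
    intro x hx
    rw [mem_sphere_zero_iff_norm, Prod.norm_def] at hx
    exact ⟨hx ▸ le_max_left _ _, hx ▸ le_max_right _ _⟩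
  have hβ : ∀ x ∈ Metric.sphere (0 : ℝ × (Fin k → ℝ)) 1, β x ≤ 1 ∧ (x.1 = 1 ∨ β x = 1) := by
    intro x hx
    have h1 := hsph x hx
    have hβ1 : β x ≤ 1 := max_le h1.2 (by linarith [neg_abs_le x.1])
    refine ⟨hβ1, ?_⟩
    rw [mem_sphere_zero_iff_norm, Prod.norm_def] at hx
    rcases max_choice ‖x.1‖ ‖x.2‖ with h | h
    · rw [h, Real.norm_eq_abs] at hx
      rcases (abs_eq zero_le_one).mp hx with h' | h'
      · exact Or.inl h'
      · right; exact le_antisymm hβ1 (le_max_of_le_right (by rw [h']; norm_num))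
    · rw [h] at hx
      right; exact le_antisymm hβ1 (le_max_of_le_left hx.ge)
  -- The segment from `x` to `-e` contains the origin only for `x = e`, and there `β` vanishes, so
  -- that `e` does not move.
  have hu : ∀ x ∈ Metric.sphere (0 : ℝ × (Fin k → ℝ)) 1, ∀ t ∈ Set.Icc (0 : ℝ) 1,
      u (t * β x) x ≠ 0 := by
    intro x hx t ht h
    have h1 : (1 - t * β x) * x.1 - t * β x = 0 := by
      simpa [u, e] using congrArg Prod.fst h
    have h2 : (1 - t * β x) • x.2 = 0 := by
      simpa [u, e] using congrArg Prod.snd h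
    rcases smul_eq_zero.mp h2 with h3 | h3
    · rw [h3] at h1; linarith
    · rcases (hβ x hx).2 with h4 | h4
      · have : β x = 0 := by simp [β, h3, h4]
        rw [this, h4] at h1; norm_num at h1
      · have h5 : x.1 = -1 := by
          have : max ‖x.2‖ (-x.1) = 1 := h4
          rw [h3, norm_zero] at this
          rcases max_choice 0 (-x.1) with h | h
          · rw [h] at this; norm_num at this
          · rw [h] at this; linarith
        rw [h4, h5] at h1; linarith
  let p : X := φ (-e)
  have he : -e ∈ Metric.sphere (0 : ℝ × (Fin k → ℝ)) 1 := by
    simp [e, Prod.norm_def]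
  -- the collapsed map
  let ψ : ℝ × (Fin k → ℝ) → X := fun x => φ (nrm (u (β x) x))
  have huc : Continuous fun y : ℝ × (ℝ × (Fin k → ℝ)) => u (y.1 * β y.2) y.2 := by
    simp only [u]; fun_prop
  have hG : ContinuousOn (fun y : ℝ × (ℝ × (Fin k → ℝ)) => φ (nrm (u (y.1 * β y.2) y.2)))
      (Set.Icc (0 : ℝ) 1 ×ˢ Metric.sphere 0 1) := by
    refine hφ.comp ?_ fun y hy => hnrm _ (hu _ hy.2 _ hy.1)
    exact (huc.norm.continuousOn.inv₀ fun y hy => norm_ne_zero_iff.mpr (hu _ hy.2 _ hy.1)).smul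
      huc.continuousOn
  have hψc : ContinuousOn ψ (Metric.sphere 0 1) := by
    have := hG.comp (f := fun x : ℝ × (Fin k → ℝ) => ((1 : ℝ), x)) (s := Metric.sphere 0 1)
      (by fun_prop) (fun x hx => ⟨by simp, hx⟩)
    refine this.congr fun x _ => ?_
    simp [ψ]
  have hψ1 : ∀ x, β x = 1 → ψ x = p := by
    intro x hx
    have : nrm (u (β x) x) = -e := by
      simp [nrm, u, hx, e, Prod.norm_def]
    simp only [ψ, p, this]
  let c : (Fin k → unitInterval) → ℝ × (Fin k → ℝ) := fun z => (1, fun i => 2 * (z i : ℝ) - 1)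
  have hc : Continuous c := by fun_prop
  have hcs : ∀ z, c z ∈ Metric.sphere (0 : ℝ × (Fin k → ℝ)) 1 := by
    intro z
    rw [mem_sphere_zero_iff_norm, Prod.norm_def]
    have : ‖(c z).2‖ ≤ 1 := by
      refine (pi_norm_le_iff_of_nonneg zero_le_one).mpr fun i => ?_
      rw [Real.norm_eq_abs, abs_le]
      constructor <;> simp only [c] <;> linarith [(z i).2.1, (z i).2.2]
    simpa [c] using this
  have hcb : ∀ z ∈ Cube.boundary (Fin k), β (c z) = 1 := by
    rintro z ⟨i, hi⟩
    refine le_antisymm (hβ _ (hcs z)).1 (le_max_of_le_left ?_)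
    have : ‖(c z).2 i‖ = 1 := by
      rcases hi with h | h <;> simp [c, h]
      norm_num
    rw [← this]; exact norm_le_pi_norm _ i
  -- The face `x.1 = 1` is a copy of the cube, and its boundary is collapsed to `p`: there `ψ` is a
  -- generalized loop, which is null-homotopic by hypothesis.
  let γ : GenLoop (Fin k) X p := ⟨⟨fun z => ψ (c z), hψc.comp_continuous hc hcs⟩,
    fun z hz => hψ1 _ (hcb z hz)⟩
  have hγ : GenLoop.Homotopic γ GenLoop.const :=
    Quotient.exact ((hX p).elim (Quotient.mk _ γ : HomotopyGroup.Pi k X p)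
      (Quotient.mk _ GenLoop.const))
  obtain ⟨H⟩ := hγ
  let κ : ℝ × (Fin k → ℝ) → (Fin k → unitInterval) := fun x i =>
    Set.projIcc 0 1 zero_le_one ((x.2 i + 1) / 2)
  have hκ : Continuous κ := by
    refine continuous_pi fun i => continuous_projIcc.comp (by fun_prop)
  have hcκ : ∀ x ∈ Metric.sphere (0 : ℝ × (Fin k → ℝ)) 1, x.1 = 1 → c (κ x) = x := by
    intro x hx h1
    refine Prod.ext h1.symm (funext fun i => ?_)
    have := (norm_le_pi_norm x.2 i).trans (hsph x hx).2
    rw [Real.norm_eq_abs, abs_le] at this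
    have hm : (x.2 i + 1) / 2 ∈ Set.Icc (0 : ℝ) 1 := ⟨by linarith, by linarith⟩
    simp only [c, κ, Set.projIcc_of_mem zero_le_one hm]
    ring
  -- The null-homotopy on the face extends by the constant `p` over the rest of the sphere, as it is
  -- `p` on the boundary of the face.
  let G2 : ℝ × (ℝ × (Fin k → ℝ)) → X := fun y =>
    if y.2.1 = 1 then H (Set.projIcc 0 1 zero_le_one y.1, κ y.2) else p
  have hbd : ∀ x ∈ Metric.sphere (0 : ℝ × (Fin k → ℝ)) 1, x.1 = 1 → β x = 1 →
      κ x ∈ Cube.boundary (Fin k) := by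
    intro x hx h1 h2
    have h3 : ‖x.2‖ = 1 := by
      have : max ‖x.2‖ (-x.1) = 1 := h2
      rcases max_choice ‖x.2‖ (-x.1) with h | h
      · rwa [h] at this
      · rw [h, h1] at this; norm_num at this
    by_contra hcon
    have hlt : ∀ i, ‖x.2 i‖ < 1 := by
      intro i
      have hle := (norm_le_pi_norm x.2 i).trans h3.le
      refine lt_of_le_of_ne hle fun heq => hcon ⟨i, ?_⟩
      rw [Real.norm_eq_abs] at heq
      rcases (abs_eq zero_le_one).mp heq with h | h
      · right; simp [κ, h]
      · left; simp [κ, h]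
    have := (pi_norm_lt_iff zero_lt_one).mpr hlt
    linarith
  have hG2 : ContinuousOn G2 (Set.Icc (0 : ℝ) 1 ×ˢ Metric.sphere 0 1) := by
    have hun : (Set.Icc (0 : ℝ) 1 ×ˢ Metric.sphere (0 : ℝ × (Fin k → ℝ)) 1) =
        (Set.Icc (0 : ℝ) 1 ×ˢ (Metric.sphere 0 1 ∩ {x | x.1 = 1})) ∪
        (Set.Icc (0 : ℝ) 1 ×ˢ (Metric.sphere 0 1 ∩ {x | β x = 1})) := by
      rw [← Set.prod_union, ← Set.inter_union_distrib_left]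
      congr 1
      exact (Set.inter_eq_left.mpr fun x hx => (hβ x hx).2).symm
    have hG2a : ContinuousOn G2 (Set.Icc (0 : ℝ) 1 ×ˢ (Metric.sphere 0 1 ∩ {x | x.1 = 1})) := by
      have : Continuous fun y : ℝ × (ℝ × (Fin k → ℝ)) =>
          H (Set.projIcc 0 1 zero_le_one y.1, κ y.2) :=
        H.continuous.comp ((continuous_projIcc.comp continuous_fst).prodMk
          (hκ.comp continuous_snd))
      refine this.continuousOn.congr fun y hy => ?_
      have h1 : y.2.1 = 1 := hy.2.2
      simp only [G2, if_pos h1]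
    have hG2b : ContinuousOn G2 (Set.Icc (0 : ℝ) 1 ×ˢ (Metric.sphere 0 1 ∩ {x | β x = 1})) := by
      refine (continuousOn_const (c := p)).congr fun y hy => ?_
      by_cases h1 : y.2.1 = 1
      · simp only [G2, if_pos h1]
        have hb := hbd _ hy.2.1 h1 hy.2.2
        rw [H.eq_fst _ hb]
        exact γ.2 _ hb
      · simp only [G2, if_neg h1]
    rw [hun]
    refine hG2a.union_of_isClosed hG2b (isClosed_Icc.prod (Metric.isClosed_sphere.inter ?_))
      (isClosed_Icc.prod (Metric.isClosed_sphere.inter ?_))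
    · exact isClosed_eq continuous_fst continuous_const
    · exact isClosed_eq hβc continuous_const
  -- The extension principle is used twice: `ψ` is homotopic to a constant map, and `φ` is homotopic
  -- to `ψ`.
  obtain ⟨Ψ, hΨc, hΨ⟩ := exists_extension_of_homotopy (φ := ψ) (Ψ := fun _ => p) hG2
    (by
      intro x hx
      by_cases h1 : x.1 = 1
      · simp only [G2, if_pos h1, Set.projIcc_left]
        have := H.apply_zero (κ x)
        refine this.trans ?_
        change ψ (c (κ x)) = ψ x
        rw [hcκ x hx h1]
      · simp only [G2, if_neg h1]
        exact (hψ1 x ((hβ x hx).2.resolve_left h1)).symm)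
    (by
      intro x hx
      by_cases h1 : x.1 = 1
      · simp only [G2, if_pos h1, Set.projIcc_right]
        exact H.apply_one (κ x)
      · simp only [G2, if_neg h1])
    continuousOn_const
  refine exists_extension_of_homotopy hG ?_ ?_ hΨc
  · intro x hx
    have hx' : ‖x‖ = 1 := by simpa using hx
    simp [u, nrm, hx']
  · intro x hx
    rw [hΨ x hx]; simp [ψ]

end Sphere

/-! ### Elementary facts on simplices and realizations -/

section Simplices

theorem face_subset {V : Type*} {K : AbstractSimplicialComplex V} {s t : Finset V} (hs : s ∈ K.faces) (hts : t ⊆ s) (ht : t.Nonempty) :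
    t ∈ K.faces :=
  (K.isRelLowerSet_faces hs).2 hts ht

theorem face_nonempty {V : Type*} {K : AbstractSimplicialComplex V} {s : Finset V} (hs : s ∈ K.faces) : s.Nonempty :=
  (K.isRelLowerSet_faces hs).1

variable {V : Type*} [Fintype V] {K : AbstractSimplicialComplex V}

theorem mem_carrier {x : V → ℝ} {v : V} : v ∈ carrier x ↔ x v ≠ 0 := by
  simp [carrier]

theorem carrier_subset {x : V → ℝ} {s : Finset V} (hx : x ∈ closedSimplex s) : carrier x ⊆ s := by
  intro v hv
  by_contra h
  exact mem_carrier.mp hv (hx.2 v h)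

theorem mem_closedSimplex_carrier {x : V → ℝ} (hx : x ∈ stdSimplex ℝ V) :
    x ∈ closedSimplex (carrier x) :=
  ⟨hx, fun v hv => by by_contra h; exact hv (mem_carrier.mpr h)⟩

theorem carrier_nonempty {x : V → ℝ} (hx : x ∈ stdSimplex ℝ V) : (carrier x).Nonempty := by
  by_contra h
  rw [Finset.not_nonempty_iff_eq_empty] at h
  have : ∀ v, x v = 0 := fun v => by
    by_contra hv
    have := mem_carrier.mpr hv
    simp [h] at this
  have h1 := hx.2
  simp [this] at h1

theorem mem_realization_iff {x : V → ℝ} :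
    x ∈ realization K ↔ x ∈ stdSimplex ℝ V ∧ carrier x ∈ K.faces := by
  constructor
  · rintro ⟨s, hs, hx⟩
    exact ⟨hx.1, face_subset hs (carrier_subset hx) (carrier_nonempty hx.1)⟩
  · rintro ⟨h1, h2⟩
    exact ⟨_, h2, mem_closedSimplex_carrier h1⟩

theorem closedSimplex_subset_realization {s : Finset V} (hs : s ∈ K.faces) :
    closedSimplex s ⊆ realization K := fun _ hx => ⟨s, hs, hx⟩

theorem isClosed_closedSimplex (s : Finset V) : IsClosed (closedSimplex s) := by
  have : closedSimplex s = stdSimplex ℝ V ∩ ⋂ v, {x | v ∉ s → x v = 0} := by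
    ext x; simp [closedSimplex]
  rw [this]
  refine (isClosed_stdSimplex ℝ V).inter (isClosed_iInter fun v => ?_)
  by_cases h : v ∈ s
  · simp [h]
  · simp only [h, not_false_eq_true, true_imp_iff]
    exact isClosed_eq (continuous_apply v) continuous_const

theorem isCompact_closedSimplex (s : Finset V) : IsCompact (closedSimplex s) :=
  (isCompact_stdSimplex ℝ V).of_isClosed_subset (isClosed_closedSimplex s) fun _ h => h.1

theorem convex_closedSimplex (s : Finset V) : Convex ℝ (closedSimplex s) := by
  intro x hx y hy a b ha hb hab
  refine ⟨convex_stdSimplex ℝ V hx.1 hy.1 ha hb hab, fun v hv => ?_⟩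
  simp [hx.2 v hv, hy.2 v hv]

theorem realization_eq_biUnion : realization K = ⋃ s ∈ K.faces, closedSimplex s := by
  ext x
  simp only [Set.mem_iUnion, exists_prop]
  rfl

theorem isCompact_realization (K : AbstractSimplicialComplex V) : IsCompact (realization K) := by
  rw [realization_eq_biUnion]
  exact (Set.toFinite _).isCompact_biUnion fun s _ => isCompact_closedSimplex s

theorem single_mem_closedSimplex [DecidableEq V] {v : V} {s : Finset V} (h : v ∈ s) :
    (Pi.single v 1 : V → ℝ) ∈ closedSimplex s := by
  refine ⟨single_mem_stdSimplex ℝ v, fun w hw => ?_⟩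
  rw [Pi.single_eq_of_ne]
  rintro rfl
  exact hw h

instance (K : AbstractSimplicialComplex V) : CompactSpace (Space K) :=
  isCompact_iff_compactSpace.mp (isCompact_realization K)

open Classical in
/-- A vertex of a simplicial complex, as a point of the realization. -/
def vertexPoint (K : AbstractSimplicialComplex V) (v : V) : Space K :=
  ⟨Pi.single v 1, {v}, K.singleton_mem v, single_mem_closedSimplex (Finset.mem_singleton_self v)⟩

theorem lineMap_mem_closedSimplex {s : Finset V} {x y : V → ℝ} (hx : x ∈ closedSimplex s)
    (hy : y ∈ closedSimplex s) {t : ℝ} (ht : t ∈ Set.Icc (0 : ℝ) 1) :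
    AffineMap.lineMap x y t ∈ closedSimplex s :=
  (convex_closedSimplex s).segment_subset hx hy (lineMap_mem_segment ℝ x y ht)

/-- The straight path between two points of a closed simplex. -/
def segPath {s : Finset V} (hs : s ∈ K.faces) (x y : Space K) (hx : (x : V → ℝ) ∈ closedSimplex s)
    (hy : (y : V → ℝ) ∈ closedSimplex s) : Path x y where
  toFun t := ⟨AffineMap.lineMap (x : V → ℝ) (y : V → ℝ) (t : ℝ), s, hs,
    lineMap_mem_closedSimplex hx hy t.2⟩
  continuous_toFun := by
    refine Continuous.subtype_mk ?_ _
    simp only [AffineMap.lineMap_apply, vsub_eq_sub, vadd_eq_add]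
    fun_prop
  source' := by ext1; simp
  target' := by ext1; simp

@[simp] theorem coe_segPath {s : Finset V} (hs : s ∈ K.faces) (x y : Space K)
    (hx : (x : V → ℝ) ∈ closedSimplex s) (hy : (y : V → ℝ) ∈ closedSimplex s) (t : unitInterval) :
    (segPath hs x y hx hy t : V → ℝ) = AffineMap.lineMap (x : V → ℝ) (y : V → ℝ) (t : ℝ) := rfl

end Simplices

/-! ### Straight-line homotopies -/

/-- Two paths in a subset of a vector space with the same end points are homotopic if the segments
between corresponding points are contained in the subset. -/
theorem homotopic_of_segment_subset {E : Type*} [AddCommGroup E] [Module ℝ E] [TopologicalSpace E]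
    [IsTopologicalAddGroup E] [ContinuousSMul ℝ E] {A : Set E} {x y : A} (p q : Path x y)
    (h : ∀ t, segment ℝ (p t : E) (q t) ⊆ A) : Path.Homotopic p q := by
  refine ⟨{ toFun := fun z => ⟨AffineMap.lineMap (p z.2 : E) (q z.2 : E) (z.1 : ℝ),
              h z.2 (lineMap_mem_segment ℝ _ _ z.1.2)⟩
            continuous_toFun := ?_
            map_zero_left := ?_
            map_one_left := ?_
            prop' := ?_ }⟩
  · refine Continuous.subtype_mk ?_ _
    simp only [AffineMap.lineMap_apply, vsub_eq_sub, vadd_eq_add]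
    fun_prop
  · intro t; ext1; simp
  · intro t; ext1; simp
  · rintro t s (rfl | rfl) <;> ext1 <;> simp

/-- Paths in a common closed simplex with the same end points are homotopic. -/
theorem homotopic_of_mem_closedSimplex {V : Type*} [Fintype V] {K : AbstractSimplicialComplex V}
    {s : Finset V} (hs : s ∈ K.faces) {x y : Space K} (p q : Path x y)
    (hp : ∀ t, (p t : V → ℝ) ∈ closedSimplex s) (hq : ∀ t, (q t : V → ℝ) ∈ closedSimplex s) :
    Path.Homotopic p q :=
  homotopic_of_segment_subset p q fun t =>
    ((convex_closedSimplex s).segment_subset (hp t) (hq t)).trans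
      (closedSimplex_subset_realization hs)

/-! ### Extending maps over a simplex -/

section Extension

variable {V : Type*} [Fintype V] {X : Type*} [TopologicalSpace X]

/-- The boundary of a closed simplex. -/
def simplexBoundary (s : Finset V) : Set (V → ℝ) := {x | x ∈ closedSimplex s ∧ carrier x ≠ s}

open Classical in
/-- A closed simplex with `k + 2` vertices and its boundary are a ball of dimension `k + 1` and its
boundary sphere. -/
theorem exists_ball_parametrization {s : Finset V} {k : ℕ} (hs : s.card = k + 2) :
    ∃ (a : (V → ℝ) → ℝ × (Fin k → ℝ)) (b : ℝ × (Fin k → ℝ) → (V → ℝ)),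
      Continuous a ∧ Continuous b ∧ (∀ x ∈ closedSimplex s, b (a x) = x) ∧
      (∀ x ∈ closedSimplex s, a x ∈ Metric.closedBall (0 : ℝ × (Fin k → ℝ)) 1) ∧
      (∀ x ∈ simplexBoundary s, a x ∈ Metric.sphere (0 : ℝ × (Fin k → ℝ)) 1) ∧
      (∀ y ∈ Metric.sphere (0 : ℝ × (Fin k → ℝ)) 1, b y ∈ simplexBoundary s) := by
  obtain ⟨v₀, hv₀⟩ : s.Nonempty := Finset.card_pos.mp (by omega)
  have hcard : Fintype.card ↥(s.erase v₀) = k + 1 := by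
    rw [Fintype.card_coe, Finset.card_erase_of_mem hv₀, hs]; rfl
  let ι := ↥(s.erase v₀)
  -- linear coordinates
  have hfr : Module.finrank ℝ (ι → ℝ) = Module.finrank ℝ (ℝ × (Fin k → ℝ)) := by
    simp only [Module.finrank_fintype_fun_eq_card, Module.finrank_prod, Module.finrank_self,
      Fintype.card_fin]
    rw [hcard]; omega
  let L : (ι → ℝ) ≃L[ℝ] (ℝ × (Fin k → ℝ)) := ContinuousLinearEquiv.ofFinrankEq hfr
  let D : Set (ι → ℝ) := {z | (∀ i, 0 ≤ z i) ∧ ∑ i, z i ≤ 1}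
  let D' : Set (ι → ℝ) := {z | (∀ i, 0 < z i) ∧ ∑ i, z i < 1}
  have hDclosed : IsClosed D := by
    have : D = (⋂ i, {z | 0 ≤ z i}) ∩ {z | ∑ i, z i ≤ 1} := by ext z; simp [D]
    rw [this]
    exact (isClosed_iInter fun i => isClosed_le continuous_const (continuous_apply i)).inter
      (isClosed_le (by fun_prop) continuous_const)
  have hDconv : Convex ℝ D := by
    intro x hx y hy p q hp hq hpq
    refine ⟨fun i => ?_, ?_⟩
    · have := hx.1 i; have := hy.1 i
      simp only [Pi.add_apply, Pi.smul_apply, smul_eq_mul]; positivity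
    · simp only [Pi.add_apply, Pi.smul_apply, smul_eq_mul, Finset.sum_add_distrib,
        ← Finset.mul_sum]
      nlinarith [hx.2, hy.2]
  have hD'open : IsOpen D' := by
    have : D' = (⋂ i, {z | 0 < z i}) ∩ {z | ∑ i, z i < 1} := by ext z; simp [D']
    rw [this]
    exact (isOpen_iInter_of_finite fun i => isOpen_lt continuous_const (continuous_apply i)).inter
      (isOpen_lt (by fun_prop) continuous_const)
  have hD'D : D' ⊆ D := fun z hz => ⟨fun i => (hz.1 i).le, hz.2.le⟩
  have hDint : interior D = D' := by
    refine Set.Subset.antisymm (fun z hz => ?_) (interior_maximal hD'D hD'open)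
    have hzD : z ∈ D := interior_subset hz
    rw [mem_interior_iff_mem_nhds] at hz
    constructor
    · intro i
      have hc : Continuous fun r : ℝ => z - r • (Pi.single i 1 : ι → ℝ) := by fun_prop
      have h0 : ∀ᶠ r in 𝓝 (0 : ℝ), z - r • (Pi.single i 1 : ι → ℝ) ∈ D :=
        hc.continuousAt.eventually (by simpa using hz)
      obtain ⟨r, hr, hrpos⟩ := ((h0.filter_mono nhdsWithin_le_nhds).and
        (self_mem_nhdsWithin (s := Set.Ioi (0 : ℝ)))).exists
      have hrp : (0 : ℝ) < r := hrpos
      have h1 := hr.1 i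
      simp only [Pi.sub_apply, Pi.smul_apply, Pi.single_eq_same, smul_eq_mul, mul_one] at h1
      linarith
    · obtain ⟨i⟩ : Nonempty ι := Fintype.card_pos_iff.mp (by rw [hcard]; omega)
      have hc : Continuous fun r : ℝ => z + r • (Pi.single i 1 : ι → ℝ) := by fun_prop
      have h0 : ∀ᶠ r in 𝓝 (0 : ℝ), z + r • (Pi.single i 1 : ι → ℝ) ∈ D :=
        hc.continuousAt.eventually (by simpa using hz)
      obtain ⟨r, hr, hrpos⟩ := ((h0.filter_mono nhdsWithin_le_nhds).and
        (self_mem_nhdsWithin (s := Set.Ioi (0 : ℝ)))).exists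
      have hrp : (0 : ℝ) < r := hrpos
      have h1 := hr.2
      simp only [Pi.add_apply, Pi.smul_apply, smul_eq_mul, Finset.sum_add_distrib,
        ← Finset.mul_sum, Finset.sum_pi_single', Finset.mem_univ, if_true, mul_one] at h1
      linarith
  have hD'ne : D'.Nonempty := by
    refine ⟨fun _ => 1 / ((k : ℝ) + 2), fun i => by positivity, ?_⟩
    rw [Finset.sum_const, Finset.card_univ, hcard, nsmul_eq_mul]
    push_cast
    rw [mul_one_div, div_lt_one (by positivity)]; linarith
  have hDb : Bornology.IsBounded D := by
    refine (Metric.isBounded_closedBall (x := (0 : ι → ℝ)) (r := 1)).subset fun z hz => ?_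
    rw [mem_closedBall_zero_iff, pi_norm_le_iff_of_nonneg zero_le_one]
    intro i
    rw [Real.norm_of_nonneg (hz.1 i)]
    exact (Finset.single_le_sum (fun j _ => hz.1 j) (Finset.mem_univ i)).trans hz.2
  -- A bounded convex set with non-empty interior is carried to the unit ball by a homeomorphism of
  -- the whole space, which respects interior, closure and frontier.
  obtain ⟨h, h1, h2, h3⟩ := exists_homeomorph_image_interior_closure_frontier_eq_unitBall
    (s := L '' D) (hDconv.linear_image L.toLinearEquiv.toLinearMap)
    (by
      rw [← L.coe_toHomeomorph, ← Homeomorph.image_interior, hDint]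
      exact hD'ne.image _)
    (L.lipschitz.isBounded_image hDb)
  have hcl : closure (L '' D) = L '' D := by
    rw [← L.coe_toHomeomorph, ← Homeomorph.image_closure, hDclosed.closure_eq]
  have hfr : frontier (L '' D) = L '' (D \ D') := by
    rw [← L.coe_toHomeomorph, ← Homeomorph.image_frontier, hDclosed.frontier_eq, hDint]
  rw [hcl] at h2
  rw [hfr] at h3
  -- Forgetting the coordinate at `v₀` identifies the simplex with `D`. The inverse `b₀` recovers
  -- that coordinate from the condition that the sum is `1`, and it is continuous on the whole
  -- space.
  let a₀ : (V → ℝ) → (ι → ℝ) := fun x i => x i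
  let b₀ : (ι → ℝ) → (V → ℝ) := fun z v =>
    if hv : v ∈ s.erase v₀ then z ⟨v, hv⟩ else if v = v₀ then 1 - ∑ i, z i else 0
  have ha₀ : Continuous a₀ := by fun_prop
  have hb₀ : Continuous b₀ := by
    refine continuous_pi fun v => ?_
    by_cases hv : v ∈ s.erase v₀
    · simp only [b₀, dif_pos hv]; fun_prop
    · by_cases hv' : v = v₀
      · subst hv'
        simp only [b₀, dif_neg hv, if_true]; fun_prop
      · simp only [b₀, dif_neg hv, if_neg hv']; fun_prop
  have hsum : ∀ x : V → ℝ, (∀ v, v ∉ s → x v = 0) → ∑ v, x v = ∑ i : ι, x i + x v₀ := by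
    intro x hx
    rw [← Finset.sum_subset (Finset.subset_univ s) fun v _ hv => hx v hv,
      ← Finset.sum_erase_add s _ hv₀, ← Finset.sum_coe_sort (s.erase v₀)]
  have hba : ∀ x ∈ closedSimplex s, b₀ (a₀ x) = x := by
    intro x hx
    funext v
    by_cases hv : v ∈ s.erase v₀
    · simp only [b₀, dif_pos hv, a₀]
    · by_cases hv' : v = v₀
      · subst hv'
        simp only [b₀, dif_neg hv, if_true, a₀]
        have := hsum x hx.2
        rw [hx.1.2] at this
        linarith
      · simp only [b₀, dif_neg hv, if_neg hv']
        exact (hx.2 v fun hvs => hv (Finset.mem_erase.mpr ⟨hv', hvs⟩)).symm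
  have haD : ∀ x ∈ closedSimplex s, a₀ x ∈ D := by
    intro x hx
    refine ⟨fun i => hx.1.1 i, ?_⟩
    have := hsum x hx.2
    rw [hx.1.2] at this
    have := hx.1.1 v₀
    simp only [a₀]; linarith
  have haB : ∀ x ∈ simplexBoundary s, a₀ x ∈ D \ D' := by
    intro x hx
    refine ⟨haD x hx.1, fun hD => hx.2 ?_⟩
    refine Finset.Subset.antisymm (carrier_subset hx.1) fun v hv => mem_carrier.mpr ?_
    by_cases hv' : v = v₀
    · subst hv'
      have := hsum x hx.1.2
      rw [hx.1.1.2] at this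
      have h5 : ∑ i : ι, x i < 1 := hD.2
      intro h0; rw [h0] at this; linarith
    · exact (hD.1 ⟨v, Finset.mem_erase.mpr ⟨hv', hv⟩⟩).ne'
  have hbv₀ : ∀ z, b₀ z v₀ = 1 - ∑ i, z i := fun z => by simp [b₀]
  have hbi : ∀ z (i : ι), b₀ z i = z i := fun z i => by
    simp only [b₀, dif_pos i.2]; rfl
  have hbn : ∀ z v, v ∉ s → b₀ z v = 0 := fun z v hv => by
    have h1 : v ∉ s.erase v₀ := fun h => hv (Finset.mem_of_mem_erase h)
    have h2 : v ≠ v₀ := fun h => hv (h ▸ hv₀)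
    simp only [b₀, dif_neg h1, if_neg h2]
  have hbD : ∀ z ∈ D, b₀ z ∈ closedSimplex s := by
    intro z hz
    refine ⟨⟨fun v => ?_, ?_⟩, hbn z⟩
    · by_cases hv : v ∈ s.erase v₀
      · simp only [b₀, dif_pos hv]; exact hz.1 _
      · by_cases hv' : v = v₀
        · rw [hv', hbv₀]; linarith [hz.2]
        · rw [hbn z v fun h => hv (Finset.mem_erase.mpr ⟨hv', h⟩)]
    · rw [hsum _ (hbn z), hbv₀]
      simp only [hbi]; ring
  have hbB : ∀ z ∈ D \ D', b₀ z ∈ simplexBoundary s := by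
    intro z hz
    refine ⟨hbD z hz.1, fun hc => hz.2 ⟨fun i => ?_, ?_⟩⟩
    · refine lt_of_le_of_ne (hz.1.1 i) fun h0 => ?_
      have : (i : V) ∈ carrier (b₀ z) := by rw [hc]; exact Finset.mem_of_mem_erase i.2
      exact mem_carrier.mp this (by rw [hbi, ← h0])
    · refine lt_of_le_of_ne hz.1.2 fun h0 => ?_
      have : v₀ ∈ carrier (b₀ z) := by rw [hc]; exact hv₀
      exact mem_carrier.mp this (by rw [hbv₀, h0, sub_self])
  refine ⟨fun x => h (L (a₀ x)), fun y => b₀ (L.symm (h.symm y)), by fun_prop, by fun_prop,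
    fun x hx => by simp [hba x hx], fun x hx => ?_, fun x hx => ?_, fun y hy => ?_⟩
  · rw [← h2]; exact ⟨_, ⟨_, haD x hx, rfl⟩, rfl⟩
  · rw [← h3]; exact ⟨_, ⟨_, haB x hx, rfl⟩, rfl⟩
  · rw [← h3] at hy
    obtain ⟨_, ⟨z, hz, rfl⟩, rfl⟩ := hy
    simpa using hbB z hz

/-- A map on the boundary of a simplex with `k + 2` vertices, into a space with trivial `k`-th
homotopy groups, extends to the simplex. -/
theorem exists_extension_closedSimplex {s : Finset V} {k : ℕ} (hs : s.card = k + 2)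
    (hX : ∀ x : X, Subsingleton (HomotopyGroup.Pi k X x)) {f : (V → ℝ) → X}
    (hf : ContinuousOn f (simplexBoundary s)) :
    ∃ g : (V → ℝ) → X, ContinuousOn g (closedSimplex s) ∧ ∀ x ∈ simplexBoundary s, g x = f x := by
  obtain ⟨a, b, ha, hb, hba, haD, haB, hbB⟩ := exists_ball_parametrization hs
  obtain ⟨Φ, hΦ, hΦf⟩ := exists_extension_of_subsingleton_homotopyGroup hX
    (φ := fun y => f (b y)) (hf.comp hb.continuousOn hbB)
  refine ⟨fun x => Φ (a x), hΦ.comp ha.continuousOn haD, fun x hx => ?_⟩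
  simp only [hΦf _ (haB x hx), hba x hx.1]

end Extension

/-! ### Constructing maps on a simplicial complex skeleton by skeleton -/

section Skeleton

variable {V : Type*} [Fintype V] {X : Type*} [TopologicalSpace X]

open Classical in
theorem sum_eq_of_mem_triangle {a b c : V} (hab : a ≠ b) (hac : a ≠ c) (hbc : b ≠ c) {x : V → ℝ}
    (hx : ∀ v, v ∉ ({a, b, c} : Finset V) → x v = 0) : ∑ v, x v = x a + x b + x c := by
  rw [← Finset.sum_subset (Finset.subset_univ {a, b, c}) fun v _ hv => hx v hv,
    Finset.sum_insert (by simp [hab, hac]), Finset.sum_insert (by simp [hbc]),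
    Finset.sum_singleton, add_assoc]

open Classical in
/-- A map on the boundary of a triangle, whose boundary loop is null-homotopic, extends to the
triangle. -/
theorem exists_extension_triangle {a b c : V} (hab : a ≠ b) (hac : a ≠ c) (hbc : b ≠ c)
    {f : (V → ℝ) → X} {x₀ : X} (p q r : Path x₀ x₀)
    (hp : ∀ t : unitInterval,
      p t = f (AffineMap.lineMap (Pi.single a 1 : V → ℝ) (Pi.single b 1) (t : ℝ)))
    (hq : ∀ t : unitInterval,
      q t = f (AffineMap.lineMap (Pi.single b 1 : V → ℝ) (Pi.single c 1) (t : ℝ)))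
    (hr : ∀ t : unitInterval,
      r t = f (AffineMap.lineMap (Pi.single a 1 : V → ℝ) (Pi.single c 1) (t : ℝ)))
    (h : Path.Homotopic (p.trans q) r) :
    ∃ g : (V → ℝ) → X, ContinuousOn g (closedSimplex {a, b, c}) ∧
      ∀ x ∈ simplexBoundary ({a, b, c} : Finset V), g x = f x := by
  obtain ⟨H⟩ := h
  -- The square is mapped onto the triangle by `P`: the side of time `0` runs from `a` through `b`
  -- to `c`, the side of time `1` runs straight from `a` to `c`, and the other two sides are
  -- collapsed to `a` and `c`. The pair of `σ` and `τ` is a section of `P`. At `a` and `c`, where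
  -- `σ` divides by zero, its value is irrelevant because `H` is constant on the collapsed sides.
  let σ : (V → ℝ) → unitInterval := fun x =>
    Set.projIcc 0 1 zero_le_one (1 - x b / (1 - |x c - x a|))
  let τ : (V → ℝ) → unitInterval := fun x => Set.projIcc 0 1 zero_le_one ((1 + (x c - x a)) / 2)
  let g : (V → ℝ) → X := fun x => H (σ x, τ x)
  let A : unitInterval × unitInterval → ℝ := fun z =>
    (1 - (1 - (z.1 : ℝ)) * (1 - |2 * (z.2 : ℝ) - 1|) - (2 * (z.2 : ℝ) - 1)) / 2
  let B : unitInterval × unitInterval → ℝ := fun z => (1 - (z.1 : ℝ)) * (1 - |2 * (z.2 : ℝ) - 1|)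
  let C : unitInterval × unitInterval → ℝ := fun z =>
    (1 - (1 - (z.1 : ℝ)) * (1 - |2 * (z.2 : ℝ) - 1|) + (2 * (z.2 : ℝ) - 1)) / 2
  let P : unitInterval × unitInterval → (V → ℝ) := fun z =>
    A z • Pi.single a 1 + B z • Pi.single b 1 + C z • Pi.single c 1
  have hPa : ∀ z, P z a = A z := fun z => by simp [P, hab, hac]
  have hPb : ∀ z, P z b = B z := fun z => by simp [P, hab.symm, hbc]
  have hPc : ∀ z, P z c = C z := fun z => by simp [P, hac.symm, hbc.symm]
  have hPn : ∀ z v, v ∉ ({a, b, c} : Finset V) → P z v = 0 := by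
    intro z v hv
    simp only [Finset.mem_insert, Finset.mem_singleton, not_or] at hv
    simp [P, hv.1, hv.2.1, hv.2.2]
  have habs : ∀ z : unitInterval × unitInterval, |2 * (z.2 : ℝ) - 1| ≤ 1 := fun z => by
    rw [abs_le]; constructor <;> linarith [z.2.2.1, z.2.2.2]
  have hB0 : ∀ z, 0 ≤ B z := fun z =>
    mul_nonneg (by linarith [z.1.2.2]) (by linarith [habs z])
  have hB1 : ∀ z, B z ≤ 1 - |2 * (z.2 : ℝ) - 1| := fun z => by
    have : (1 - (z.1 : ℝ)) * (1 - |2 * (z.2 : ℝ) - 1|) ≤ 1 * (1 - |2 * (z.2 : ℝ) - 1|) :=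
      mul_le_mul_of_nonneg_right (by linarith [z.1.2.1]) (by linarith [habs z])
    simpa [B] using this
  have hPmem : ∀ z, P z ∈ closedSimplex ({a, b, c} : Finset V) := by
    intro z
    have hA : A z = (1 - B z - (2 * (z.2 : ℝ) - 1)) / 2 := rfl
    have hC : C z = (1 - B z + (2 * (z.2 : ℝ) - 1)) / 2 := rfl
    refine ⟨⟨fun v => ?_, ?_⟩, hPn z⟩
    · by_cases hv : v ∈ ({a, b, c} : Finset V)
      · simp only [Finset.mem_insert, Finset.mem_singleton] at hv
        rcases hv with rfl | rfl | rfl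
        · rw [hPa, hA]; linarith [hB1 z, le_abs_self (2 * (z.2 : ℝ) - 1)]
        · rw [hPb]; exact hB0 z
        · rw [hPc, hC]; linarith [hB1 z, neg_abs_le (2 * (z.2 : ℝ) - 1)]
      · rw [hPn z v hv]
    · rw [sum_eq_of_mem_triangle hab hac hbc (hPn z), hPa, hPb, hPc, hA, hC]; ring
  have hτP : ∀ z, τ (P z) = z.2 := by
    intro z
    have : (1 + (P z c - P z a)) / 2 = z.2 := by rw [hPa, hPc]; simp only [A, C]; ring
    simp only [τ, this, Set.projIcc_val]
  have hgP : ∀ z, g (P z) = H z := by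
    intro z
    have hca : P z c - P z a = 2 * (z.2 : ℝ) - 1 := by rw [hPa, hPc]; simp only [A, C]; ring
    by_cases h0 : 1 - |2 * (z.2 : ℝ) - 1| = 0
    · have h1 : |2 * (z.2 : ℝ) - 1| = 1 := by linarith
      have h2 : z.2 = 0 ∨ z.2 = 1 := by
        rcases (abs_eq zero_le_one).mp h1 with h | h
        · right; exact Subtype.ext (show (z.2 : ℝ) = 1 by linarith)
        · left; exact Subtype.ext (show (z.2 : ℝ) = 0 by linarith)
      have h3 : ∀ s : unitInterval, H (s, z.2) = x₀ := by
        rcases h2 with h | h <;> intro s <;> rw [h] <;> simp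
      change H (_, τ (P z)) = _
      rw [hτP, h3]; exact (h3 z.1).symm
    · have : σ (P z) = z.1 := by
        simp only [σ]
        rw [hca, hPb]
        have : 1 - B z / (1 - |2 * (z.2 : ℝ) - 1|) = z.1 := by
          simp only [B]; rw [mul_div_cancel_right₀ _ h0]; ring
        rw [this, Set.projIcc_val]
      change H (σ (P z), τ (P z)) = _
      rw [this, hτP]
  have hsimp : ∀ x ∈ closedSimplex ({a, b, c} : Finset V),
      0 ≤ x a ∧ 0 ≤ x b ∧ 0 ≤ x c ∧ x a + x b + x c = 1 := fun x hx =>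
    ⟨hx.1.1 a, hx.1.1 b, hx.1.1 c, by rw [← sum_eq_of_mem_triangle hab hac hbc hx.2]; exact hx.1.2⟩
  have hext : ∀ x ∈ closedSimplex ({a, b, c} : Finset V),
      ∀ y : V → ℝ, (∀ v, v ∉ ({a, b, c} : Finset V) → y v = 0) → y a = x a → y b = x b →
        y c = x c → y = x := by
    intro x hx y hy ha hb hc
    funext v
    by_cases hv : v ∈ ({a, b, c} : Finset V)
    · simp only [Finset.mem_insert, Finset.mem_singleton] at hv
      rcases hv with rfl | rfl | rfl <;> assumption
    · rw [hy v hv, hx.2 v hv]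
  have hτv : ∀ x ∈ closedSimplex ({a, b, c} : Finset V), (τ x : ℝ) = (1 + (x c - x a)) / 2 := by
    intro x hx
    obtain ⟨h1, h2, h3, h4⟩ := hsimp x hx
    simp only [τ]
    rw [Set.projIcc_of_mem zero_le_one ⟨by linarith, by linarith⟩]
  have hbm : ∀ x ∈ closedSimplex ({a, b, c} : Finset V), x b ≤ 1 - |x c - x a| := by
    intro x hx
    obtain ⟨h1, h2, h3, h4⟩ := hsimp x hx
    have : |x c - x a| ≤ x a + x c := by rw [abs_le]; constructor <;> linarith
    linarith
  have hσv : ∀ x ∈ closedSimplex ({a, b, c} : Finset V),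
      (σ x : ℝ) = 1 - x b / (1 - |x c - x a|) := by
    intro x hx
    obtain ⟨h1, h2, h3, h4⟩ := hsimp x hx
    simp only [σ]
    rw [Set.projIcc_of_mem zero_le_one]
    have h5 := hbm x hx
    have h6 : x b / (1 - |x c - x a|) ≤ 1 := div_le_one_of_le₀ h5 (by linarith)
    have h7 : 0 ≤ x b / (1 - |x c - x a|) := div_nonneg h2 (by linarith)
    constructor <;> linarith
  have hPs : ∀ x ∈ closedSimplex ({a, b, c} : Finset V), P (σ x, τ x) = x := by
    intro x hx
    obtain ⟨h1, h2, h3, h4⟩ := hsimp x hx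
    have hBv : B (σ x, τ x) = x b := by
      simp only [B]
      rw [hσv x hx, hτv x hx]
      have : 2 * ((1 + (x c - x a)) / 2) - 1 = x c - x a := by ring
      rw [this]
      by_cases h0 : 1 - |x c - x a| = 0
      · have := hbm x hx
        rw [h0] at this ⊢
        linarith
      · field_simp; ring
    have hT : 2 * ((τ x : unitInterval) : ℝ) - 1 = x c - x a := by rw [hτv x hx]; ring
    refine hext x hx _ (hPn _) ?_ ?_ ?_
    · rw [hPa]
      change (1 - B (σ x, τ x) - (2 * ((τ x : unitInterval) : ℝ) - 1)) / 2 = x a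
      rw [hBv, hT]; linarith
    · rw [hPb, hBv]
    · rw [hPc]
      change (1 - B (σ x, τ x) + (2 * ((τ x : unitInterval) : ℝ) - 1)) / 2 = x c
      rw [hBv, hT]; linarith
  have hPc' : Continuous P := by
    simp only [P, A, B, C]; fun_prop
  refine ⟨g, ?_, ?_⟩
  -- `σ` need not be continuous at `a` and `c`. Continuity of `g` comes from that of `g ∘ P = H`,
  -- because `P` is a continuous surjection from a compact space to a Hausdorff space, hence a
  -- quotient map.
  · let P' : unitInterval × unitInterval → ↥(closedSimplex ({a, b, c} : Finset V)) :=
      fun z => ⟨P z, hPmem z⟩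
    have hq : Topology.IsQuotientMap P' := Topology.IsQuotientMap.of_surjective_continuous
      (fun x => ⟨(σ x, τ x), Subtype.ext (hPs x x.2)⟩) (hPc'.subtype_mk _)
    rw [continuousOn_iff_continuous_domRestrict, hq.continuous_iff]
    exact H.continuous.congr fun z => (hgP z).symm
  · rintro x ⟨hx, hxb⟩
    obtain ⟨h1, h2, h3, h4⟩ := hsimp x hx
    by_cases hb0 : x b = 0
    · have h5 : σ x = 1 := by ext; rw [hσv x hx, hb0]; simp
      have h6 : (τ x : ℝ) = x c := by rw [hτv x hx]; linarith
      change H (σ x, τ x) = f x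
      rw [h5, H.apply_one]
      change r (τ x) = _
      rw [hr, h6]
      congr 1
      refine hext x hx _ ?_ ?_ ?_ ?_
      · intro v hv
        simp only [Finset.mem_insert, Finset.mem_singleton, not_or] at hv
        simp [AffineMap.lineMap_apply, hv.1, hv.2.2]
      · simp [AffineMap.lineMap_apply, hac]; linarith
      · simp [AffineMap.lineMap_apply, hab.symm, hbc, hb0]
      · simp [AffineMap.lineMap_apply, hac.symm]
    · by_cases hc0 : x c = 0
      · have h5 : σ x = 0 := by
          ext; rw [hσv x hx, hc0]
          have : 1 - |0 - x a| = x b := by rw [zero_sub, abs_neg, abs_of_nonneg h1]; linarith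
          rw [this, div_self hb0]; simp
        have h6 : (τ x : ℝ) = x b / 2 := by rw [hτv x hx]; linarith
        change H (σ x, τ x) = f x
        rw [h5, H.apply_zero]
        change p.trans q (τ x) = _
        rw [Path.trans_apply, dif_pos (by rw [h6]; linarith), hp]
        congr 1
        have h7 : 2 * ((τ x : unitInterval) : ℝ) = x b := by rw [h6]; ring
        simp only [h7]
        refine hext x hx _ ?_ ?_ ?_ ?_
        · intro v hv
          simp only [Finset.mem_insert, Finset.mem_singleton, not_or] at hv
          simp [AffineMap.lineMap_apply, hv.1, hv.2.1]
        · simp [AffineMap.lineMap_apply, hab]; linarith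
        · simp [AffineMap.lineMap_apply, hab.symm]
        · simp [AffineMap.lineMap_apply, hac.symm, hbc.symm, hc0]
      · have ha0 : x a = 0 := by
          by_contra ha0
          apply hxb
          refine Finset.Subset.antisymm (carrier_subset hx) fun v hv => mem_carrier.mpr ?_
          simp only [Finset.mem_insert, Finset.mem_singleton] at hv
          rcases hv with rfl | rfl | rfl <;> assumption
        have h5 : σ x = 0 := by
          ext; rw [hσv x hx, ha0]
          have : 1 - |x c - 0| = x b := by rw [sub_zero, abs_of_nonneg h3]; linarith
          rw [this, div_self hb0]; simp
        have h6 : (τ x : ℝ) = (1 + x c) / 2 := by rw [hτv x hx, ha0, sub_zero]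
        have hcpos : 0 < x c := lt_of_le_of_ne h3 (Ne.symm hc0)
        change H (σ x, τ x) = f x
        rw [h5, H.apply_zero]
        change p.trans q (τ x) = _
        rw [Path.trans_apply, dif_neg (by rw [h6]; linarith), hq]
        congr 1
        have h7 : 2 * ((τ x : unitInterval) : ℝ) - 1 = x c := by rw [h6]; ring
        simp only [h7]
        refine hext x hx _ ?_ ?_ ?_ ?_
        · intro v hv
          simp only [Finset.mem_insert, Finset.mem_singleton, not_or] at hv
          simp [AffineMap.lineMap_apply, hv.2.1, hv.2.2]
        · simp [AffineMap.lineMap_apply, hab, hac, ha0]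
        · simp [AffineMap.lineMap_apply, hbc]; linarith
        · simp [AffineMap.lineMap_apply, hbc.symm]

/-- The union of the closed simplices with at most `n` vertices. -/
def skeleton (K : AbstractSimplicialComplex V) (n : ℕ) : Set (V → ℝ) :=
  ⋃ s : {s : Finset V // s ∈ K.faces ∧ s.card ≤ n}, closedSimplex s.1

variable {K : AbstractSimplicialComplex V}

theorem mem_skeleton {n : ℕ} {x : V → ℝ} :
    x ∈ skeleton K n ↔ ∃ s ∈ K.faces, s.card ≤ n ∧ x ∈ closedSimplex s := by
  simp [skeleton, and_assoc]

theorem continuousOn_skeleton {n : ℕ} {f : (V → ℝ) → X}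
    (h : ∀ s ∈ K.faces, s.card ≤ n → ContinuousOn f (closedSimplex s)) :
    ContinuousOn f (skeleton K n) :=
  (locallyFinite_of_finite _).continuousOn_iUnion (fun s => isClosed_closedSimplex s.1)
    fun s => h s.1 s.2.1 s.2.2

theorem simplexBoundary_subset_skeleton {s : Finset V} (hs : s ∈ K.faces) {n : ℕ}
    (hn : s.card ≤ n + 1) : simplexBoundary s ⊆ skeleton K n := by
  rintro x ⟨hx, hne⟩
  have hss := (carrier_subset hx).ssubset_of_ne hne
  refine mem_skeleton.mpr ⟨carrier x, face_subset hs hss.1 (carrier_nonempty hx.1), ?_,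
    mem_closedSimplex_carrier hx.1⟩
  have := Finset.card_lt_card hss
  omega

/-- Extending a map from one skeleton to the next. -/
theorem exists_extension_skeleton {n : ℕ} {f : (V → ℝ) → X} (hf : ContinuousOn f (skeleton K n))
    (g : Finset V → (V → ℝ) → X)
    (hg : ∀ s ∈ K.faces, s.card = n + 1 → ContinuousOn (g s) (closedSimplex s))
    (hgf : ∀ s ∈ K.faces, s.card = n + 1 → ∀ x ∈ simplexBoundary s, g s x = f x) :
    ∃ f' : (V → ℝ) → X, ContinuousOn f' (skeleton K (n + 1)) ∧ (∀ x ∈ skeleton K n, f' x = f x) ∧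
      ∀ s ∈ K.faces, s.card = n + 1 → ∀ x ∈ closedSimplex s, f' x = g s x := by
  classical
  -- The points whose carrier has `n + 1` vertices are exactly the new ones, and the carrier tells
  -- which `g s` applies.
  let f' : (V → ℝ) → X := fun x => if (carrier x).card = n + 1 then g (carrier x) x else f x
  have h1 : ∀ x ∈ skeleton K n, f' x = f x := by
    intro x hx
    obtain ⟨t, ht, htn, hxt⟩ := mem_skeleton.mp hx
    have := Finset.card_le_card (carrier_subset hxt)
    simp only [f']
    rw [if_neg (by omega)]
  have h2 : ∀ s ∈ K.faces, s.card = n + 1 → ∀ x ∈ closedSimplex s, f' x = g s x := by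
    intro s hs hsn x hx
    by_cases hc : carrier x = s
    · simp only [f']; rw [if_pos (by rw [hc, hsn]), hc]
    · rw [hgf s hs hsn x ⟨hx, hc⟩]
      exact h1 x (simplexBoundary_subset_skeleton hs hsn.le ⟨hx, hc⟩)
  refine ⟨f', continuousOn_skeleton fun s hs hsn => ?_, h1, h2⟩
  rcases Nat.lt_or_ge s.card (n + 1) with h | h
  · have hsub : closedSimplex s ⊆ skeleton K n := fun x hx =>
      mem_skeleton.mpr ⟨s, hs, by omega, hx⟩
    exact (hf.mono hsub).congr fun x hx => h1 x (hsub hx)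
  · have hsn' : s.card = n + 1 := by omega
    exact (hg s hs hsn').congr (h2 s hs hsn')

theorem skeleton_eq_realization {n : ℕ} (hn : Fintype.card V ≤ n) :
    skeleton K n = realization K := by
  ext x
  rw [mem_skeleton]
  constructor
  · rintro ⟨s, hs, _, hx⟩; exact ⟨s, hs, hx⟩
  · rintro ⟨s, hs, hx⟩; exact ⟨s, hs, (Finset.card_le_univ s).trans hn, hx⟩

open Classical in
/-- `f` realizes the edge labels `Ψ`. -/
def RealizesEdges (K : AbstractSimplicialComplex V) {x₀ : X}
    (Ψ : V → V → Path.Homotopic.Quotient x₀ x₀) (f : (V → ℝ) → X) : Prop :=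
  ∀ v w, {v, w} ∈ K.faces → ∃ p : Path x₀ x₀,
    (∀ t : unitInterval,
      p t = f (AffineMap.lineMap (Pi.single v 1 : V → ℝ) (Pi.single w 1) (t : ℝ))) ∧
    Path.Homotopic.Quotient.mk p = Ψ v w

open Classical in
theorem lineMap_single_mem_closedSimplex (v w : V) (t : unitInterval) :
    AffineMap.lineMap (Pi.single v 1 : V → ℝ) (Pi.single w 1) (t : ℝ) ∈ closedSimplex {v, w} :=
  lineMap_mem_closedSimplex (single_mem_closedSimplex (by simp))
    (single_mem_closedSimplex (by simp)) t.2

open Classical in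
theorem RealizesEdges.congr {x₀ : X} {Ψ : V → V → Path.Homotopic.Quotient x₀ x₀}
    {f f' : (V → ℝ) → X} {n : ℕ} (hn : 2 ≤ n) (h : RealizesEdges K Ψ f)
    (hff' : ∀ x ∈ skeleton K n, f' x = f x) : RealizesEdges K Ψ f' := by
  intro v w hvw
  obtain ⟨p, hp, hpΨ⟩ := h v w hvw
  refine ⟨p, fun t => ?_, hpΨ⟩
  rw [hp, hff']
  exact mem_skeleton.mpr ⟨_, hvw, Finset.card_le_two.trans hn, lineMap_single_mem_closedSimplex v w t⟩

open Classical in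
/-- A consistent labelling of the edges by homotopy classes of loops is realized on the
`1`-skeleton. -/
theorem exists_realizesEdges_skeleton_two {x₀ : X} (Ψ : V → V → Path.Homotopic.Quotient x₀ x₀)
    (hrefl : ∀ v, Ψ v v = Path.Homotopic.Quotient.refl x₀)
    (hsymm : ∀ v w, {v, w} ∈ K.faces → Ψ w v = (Ψ v w).symm) :
    ∃ f : (V → ℝ) → X, ContinuousOn f (skeleton K 2) ∧ RealizesEdges K Ψ f := by
  have key : ∀ s : Finset V, ∃ g : (V → ℝ) → X, (s ∈ K.faces → s.card = 1 + 1 →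
      Continuous g ∧ (∀ x ∈ simplexBoundary s, g x = x₀) ∧
      ∀ v w, v ≠ w → {v, w} = s → ∃ p : Path x₀ x₀,
        (∀ t : unitInterval,
          p t = g (AffineMap.lineMap (Pi.single v 1 : V → ℝ) (Pi.single w 1) (t : ℝ))) ∧
        Path.Homotopic.Quotient.mk p = Ψ v w) := by
    intro s
    by_cases hs : s ∈ K.faces ∧ s.card = 1 + 1
    swap
    · exact ⟨fun _ => x₀, fun h1 h2 => absurd ⟨h1, h2⟩ hs⟩
    -- This fixes an arbitrary orientation of the edge. The opposite orientation is served by the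
    -- reversed path, through `hsymm`.
    obtain ⟨a, b, hab, rfl⟩ := Finset.card_eq_two.mp hs.2
    obtain ⟨p, hp⟩ := Path.Homotopic.Quotient.mk_surjective (Ψ a b)
    refine ⟨fun x => p (Set.projIcc 0 1 zero_le_one (x b)), fun _ _ => ⟨?_, ?_, ?_⟩⟩
    · exact p.continuous.comp (continuous_projIcc.comp (continuous_apply b))
    · rintro x ⟨hx, hne⟩
      have hsum : x a + x b = 1 := by
        rw [← hx.1.2, ← Finset.sum_subset (Finset.subset_univ {a, b}) fun v _ hv => hx.2 v hv,
          Finset.sum_pair hab]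
      by_cases hb : x b = 0
      · simp [hb]
      · have ha : x a = 0 := by
          by_contra ha
          refine hne (Finset.Subset.antisymm (carrier_subset hx) fun v hv => mem_carrier.mpr ?_)
          simp only [Finset.mem_insert, Finset.mem_singleton] at hv
          rcases hv with rfl | rfl <;> assumption
        have : x b = 1 := by linarith
        simp [this]
    · intro v w hvw hvws
      have hv : v ∈ ({a, b} : Finset V) := by rw [← hvws]; simp
      have hw : w ∈ ({a, b} : Finset V) := by rw [← hvws]; simp
      simp only [Finset.mem_insert, Finset.mem_singleton] at hv hw
      rcases hv with rfl | rfl <;> rcases hw with rfl | rfl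
      · exact absurd rfl hvw
      · refine ⟨p, fun t => ?_, hp⟩
        simp [AffineMap.lineMap_apply, hvw.symm]
      · refine ⟨p.symm, fun t => ?_, ?_⟩
        · have : Set.projIcc (0 : ℝ) 1 zero_le_one (1 - (t : ℝ)) = unitInterval.symm t :=
            Set.projIcc_val zero_le_one (unitInterval.symm t)
          simp [AffineMap.lineMap_apply, hvw.symm]
          rw [← this]; congr 2; ring
        · rw [Path.Homotopic.Quotient.mk_symm, hp, hsymm _ _ hs.1]
      · exact absurd rfl hvw
  choose g hg using key
  obtain ⟨f, hf, hf0, hfg⟩ := exists_extension_skeleton (K := K) (n := 1) (f := fun _ => x₀)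
    continuousOn_const g (fun s hs hsn => (hg s hs hsn).1.continuousOn)
    (fun s hs hsn => (hg s hs hsn).2.1)
  refine ⟨f, hf, fun v w hvw => ?_⟩
  by_cases h : v = w
  · subst h
    refine ⟨Path.refl x₀, fun t => ?_, by rw [hrefl, Path.Homotopic.Quotient.mk_refl]⟩
    rw [AffineMap.lineMap_same_apply, hf0 _ (mem_skeleton.mpr ⟨{v}, K.singleton_mem v, by simp,
      single_mem_closedSimplex (by simp)⟩)]
    rfl
  · have hc : ({v, w} : Finset V).card = 1 + 1 := Finset.card_pair h
    obtain ⟨p, hp, hpΨ⟩ := (hg _ hvw hc).2.2 v w h rfl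
    refine ⟨p, fun t => ?_, hpΨ⟩
    rw [hp, hfg _ hvw hc _ (lineMap_single_mem_closedSimplex v w t)]

open Classical in
/-- A consistent labelling of the edges by homotopy classes of loops in a space with trivial higher
homotopy groups is realized by a map on the complex. -/
theorem exists_realizesEdges (hX : ∀ n : ℕ, 2 ≤ n → ∀ x : X, Subsingleton (HomotopyGroup.Pi n X x))
    {x₀ : X} (Ψ : V → V → Path.Homotopic.Quotient x₀ x₀)
    (hrefl : ∀ v, Ψ v v = Path.Homotopic.Quotient.refl x₀)
    (hsymm : ∀ v w, {v, w} ∈ K.faces → Ψ w v = (Ψ v w).symm)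
    (htrans : ∀ a b c, {a, b, c} ∈ K.faces → (Ψ a b).trans (Ψ b c) = Ψ a c) :
    ∃ f : (V → ℝ) → X, ContinuousOn f (realization K) ∧ RealizesEdges K Ψ f := by
  suffices h : ∀ n, 2 ≤ n →
      ∃ f : (V → ℝ) → X, ContinuousOn f (skeleton K n) ∧ RealizesEdges K Ψ f by
    obtain ⟨f, hf, hf'⟩ := h (max 2 (Fintype.card V)) (le_max_left _ _)
    rw [skeleton_eq_realization (le_max_right _ _)] at hf
    exact ⟨f, hf, hf'⟩
  intro n hn
  induction n, hn using Nat.le_induction with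
  | base => exact exists_realizesEdges_skeleton_two Ψ hrefl hsymm
  | succ n hn ih =>
    obtain ⟨f, hf, hfΨ⟩ := ih
    have key : ∀ s : Finset V, ∃ g : (V → ℝ) → X, s ∈ K.faces → s.card = n + 1 →
        ContinuousOn g (closedSimplex s) ∧ ∀ x ∈ simplexBoundary s, g x = f x := by
      intro s
      by_cases hs : s ∈ K.faces ∧ s.card = n + 1
      swap
      · exact ⟨f, fun h1 h2 => absurd ⟨h1, h2⟩ hs⟩
      suffices h : ∃ g : (V → ℝ) → X, ContinuousOn g (closedSimplex s) ∧
          ∀ x ∈ simplexBoundary s, g x = f x by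
        obtain ⟨g, hg⟩ := h
        exact ⟨g, fun _ _ => hg⟩
      -- Triangles are filled by the cocycle relation `htrans`, and simplices of higher dimension by
      -- the vanishing of homotopy groups.
      rcases Nat.eq_or_lt_of_le hn with h2 | h2
      · subst h2
        obtain ⟨a, b, c, hab, hac, hbc, rfl⟩ := Finset.card_eq_three.mp hs.2
        have hsub : ∀ v ∈ ({a, b, c} : Finset V), ∀ w ∈ ({a, b, c} : Finset V),
            {v, w} ∈ K.faces := fun v hv w hw => face_subset hs.1
          (by intro u hu; rw [Finset.mem_insert, Finset.mem_singleton] at hu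
              rcases hu with rfl | rfl <;> assumption) ⟨v, by simp⟩
        obtain ⟨p, hp, hpΨ⟩ := hfΨ a b (hsub a (by simp) b (by simp))
        obtain ⟨q, hq, hqΨ⟩ := hfΨ b c (hsub b (by simp) c (by simp))
        obtain ⟨r, hr, hrΨ⟩ := hfΨ a c (hsub a (by simp) c (by simp))
        refine exists_extension_triangle hab hac hbc p q r hp hq hr ?_
        rw [← Path.Homotopic.Quotient.eq, Path.Homotopic.Quotient.mk_trans, hpΨ, hqΨ, hrΨ]
        exact htrans a b c hs.1
      · obtain ⟨k, rfl⟩ : ∃ k, n = k + 1 := ⟨n - 1, by omega⟩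
        exact exists_extension_closedSimplex hs.2 (hX k (by omega))
          (hf.mono (simplexBoundary_subset_skeleton hs.1 hs.2.le))
    choose g hg using key
    obtain ⟨f', hf', hff', _⟩ := exists_extension_skeleton hf g
      (fun s hs hsn => (hg s hs hsn).1) (fun s hs hsn => (hg s hs hsn).2)
    exact ⟨f', hf', hfΨ.congr hn hff'⟩

end Skeleton

/-! ### Injectivity on homotopy classes of paths -/

section PathClasses

open Path.Homotopic (Quotient)
open Path.Homotopic.Quotient

variable {X : Type*} [TopologicalSpace X]

theorem trans_symm_cancel_left {a b c : X} (p : Quotient a b) (q : Quotient a c) :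
    p.trans (p.symm.trans q) = q := by
  rw [← trans_assoc, trans_symm, refl_trans]

theorem symm_trans_cancel_left {a b c : X} (p : Quotient a b) (q : Quotient b c) :
    p.symm.trans (p.trans q) = q := by
  rw [← trans_assoc, symm_trans, refl_trans]

theorem trans_left_cancel {a b c : X} {p : Quotient a b} {q q' : Quotient b c}
    (h : p.trans q = p.trans q') : q = q' := by
  rw [← symm_trans_cancel_left p q, h, symm_trans_cancel_left]

theorem trans_right_cancel {a b c : X} {q q' : Quotient a b} {p : Quotient b c}
    (h : q.trans p = q'.trans p) : q = q' := by
  have := congrArg (fun z => z.trans p.symm) h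
  simpa [trans_assoc, trans_symm, trans_refl] using this

theorem symm_eq_of_trans {a b : X} {p : Quotient a b} {q : Quotient b a}
    (h : p.trans q = Path.Homotopic.Quotient.refl a) : q = p.symm := by
  refine trans_left_cancel (p := p) ?_
  rw [h, trans_symm]

theorem symm_trans_class {a b c : X} (p : Quotient a b) (q : Quotient b c) :
    (p.trans q).symm = q.symm.trans p.symm := by
  refine (symm_eq_of_trans ?_).symm
  rw [trans_assoc, trans_symm_cancel_left, trans_symm]

theorem map_trans_class {Y : Type*} [TopologicalSpace Y] (f : C(X, Y)) {a b c : X}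
    (p : Quotient a b) (q : Quotient b c) : (p.trans q).map f = (p.map f).trans (q.map f) := by
  induction p using Path.Homotopic.Quotient.ind with
  | mk p =>
    induction q using Path.Homotopic.Quotient.ind with
    | mk q => rw [← mk_trans, ← mk_map, ← mk_map, ← mk_map, ← mk_trans, Path.map_trans]

theorem map_symm_class {Y : Type*} [TopologicalSpace Y] (f : C(X, Y)) {a b : X}
    (p : Quotient a b) : p.symm.map f = (p.map f).symm := by
  induction p using Path.Homotopic.Quotient.ind with
  | mk p => rfl

/-- A property of homotopy classes of paths which is stable under concatenation and holds for
the paths contained in a member of an open cover holds for all classes. -/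
theorem class_induction {ι : Type*} {U : ι → Set X} (hU : ∀ i, IsOpen (U i)) (hcov : ∀ x, ∃ i, x ∈ U i)
    {P : ∀ x y : X, Quotient x y → Prop}
    (htrans : ∀ x y z (p : Quotient x y) (q : Quotient y z), P x y p → P y z q →
      P x z (p.trans q))
    (hlocal : ∀ i x y (p : Path x y), (∀ t, p t ∈ U i) → P x y (mk p))
    {x y : X} (p : Quotient x y) : P x y p := by
  induction p using Path.Homotopic.Quotient.ind with
  | mk γ =>
  obtain ⟨t, ht0, htm, ⟨n, hn⟩, htU⟩ := exists_monotone_Icc_subset_open_cover_unitInterval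
    (c := fun i => γ ⁻¹' U i) (fun i => (hU i).preimage γ.continuous)
    (fun s _ => Set.mem_iUnion.mpr (hcov (γ s)))
  have hsub : ∀ m, P _ _ (mk (γ.subpath (t 0) (t m))) := by
    intro m
    induction m with
    | zero =>
      obtain ⟨i, hi⟩ := htU 0
      refine hlocal i _ _ _ fun s => ?_
      rw [Path.subpath_self]
      exact hi ⟨le_refl _, htm (Nat.zero_le 1)⟩
    | succ m ih =>
      obtain ⟨i, hi⟩ := htU m
      have h1 : P _ _ (mk (γ.subpath (t m) (t (m + 1)))) := by
        refine hlocal i _ _ _ fun s => ?_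
        have hr : γ.subpath (t m) (t (m + 1)) s ∈ Set.range (γ.subpath (t m) (t (m + 1))) := ⟨s, rfl⟩
        rw [Path.range_subpath_of_le _ _ _ (htm (Nat.le_succ m))] at hr
        obtain ⟨r, hr, hrs⟩ := hr
        rw [← hrs]
        exact hi hr
      have h2 := htrans _ _ _ _ _ ih h1
      rw [← mk_trans] at h2
      rwa [Path.Homotopic.Quotient.eq.mpr ⟨Path.Homotopy.subpathTransSubpath γ _ _ _⟩] at h2
  have h1 := hsub n
  rw [ht0, hn n le_rfl, Path.subpath_zero_one, mk_cast] at h1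
  have : ∀ (x' y' : X) (hx : x' = x) (hy : y' = y), P x' y' ((mk γ).cast hx hy) →
      P x y (mk γ) := by
    rintro x' y' rfl rfl h
    simpa using h
  exact this _ _ _ _ h1

end PathClasses

/-! ### Maps with prescribed labels on edges, and their action on path classes. -/

section Injectivity

open Path.Homotopic (Quotient)
open Path.Homotopic.Quotient

variable {V : Type*} [Fintype V] {K : AbstractSimplicialComplex V}
variable {X : Type*} [TopologicalSpace X]

open Classical in
/-- The class of the straight path from the vertex `v` to a point `y` of a simplex containing `v`. -/
def spoke (v : V) (y : Space K) (hv : v ∈ carrier (y : V → ℝ)) :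
    Quotient (vertexPoint K v) y :=
  mk (segPath (mem_realization_iff.mp y.2).2 _ _ (single_mem_closedSimplex hv)
    (mem_closedSimplex_carrier (mem_realization_iff.mp y.2).1))

open Classical in
/-- The class of an oriented edge. -/
def edgeClass {v w : V} (h : {v, w} ∈ K.faces) : Quotient (vertexPoint K v) (vertexPoint K w) :=
  mk (segPath h _ _ (single_mem_closedSimplex (by simp)) (single_mem_closedSimplex (by simp)))

theorem forall_trans_mem {Y : Type*} [TopologicalSpace Y] {A : Set Y} {a b c : Y} {p : Path a b}
    {q : Path b c} (hp : ∀ t, p t ∈ A) (hq : ∀ t, q t ∈ A) (t : unitInterval) :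
    p.trans q t ∈ A := by
  rw [Path.trans_apply]
  split_ifs
  · exact hp _
  · exact hq _

open Classical in
theorem spoke_eq_edgeClass_trans {v w : V} {y : Space K} (hv : v ∈ carrier (y : V → ℝ))
    (hw : w ∈ carrier (y : V → ℝ)) (h : {v, w} ∈ K.faces) :
    spoke v y hv = (edgeClass h).trans (spoke w y hw) := by
  unfold spoke edgeClass
  rw [← mk_trans, Path.Homotopic.Quotient.eq]
  have hy := mem_realization_iff.mp y.2
  refine homotopic_of_mem_closedSimplex hy.2 _ _ (fun t => ?_)
    (forall_trans_mem (A := {z : Space K | (z : V → ℝ) ∈ closedSimplex (carrier (y : V → ℝ))})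
      (fun t => ?_) (fun t => ?_))
  · exact lineMap_mem_closedSimplex (single_mem_closedSimplex hv) (mem_closedSimplex_carrier hy.1) t.2
  · exact lineMap_mem_closedSimplex (single_mem_closedSimplex hv) (single_mem_closedSimplex hw) t.2
  · exact lineMap_mem_closedSimplex (single_mem_closedSimplex hw) (mem_closedSimplex_carrier hy.1) t.2

open Classical in
theorem edgeClass_trans {a b c : V} (h : {a, b, c} ∈ K.faces) (hab : {a, b} ∈ K.faces)
    (hbc : {b, c} ∈ K.faces) (hac : {a, c} ∈ K.faces) :
    (edgeClass hab).trans (edgeClass hbc) = edgeClass hac := by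
  unfold edgeClass
  rw [← mk_trans, Path.Homotopic.Quotient.eq]
  have hm : ∀ v ∈ ({a, b, c} : Finset V), (Pi.single v 1 : V → ℝ) ∈ closedSimplex {a, b, c} :=
    fun v hv => single_mem_closedSimplex hv
  refine homotopic_of_mem_closedSimplex h _ _
    (forall_trans_mem (A := {z : Space K | (z : V → ℝ) ∈ closedSimplex {a, b, c}})
      (fun t => ?_) (fun t => ?_)) (fun t => ?_)
  · exact lineMap_mem_closedSimplex (hm a (by simp)) (hm b (by simp)) t.2
  · exact lineMap_mem_closedSimplex (hm b (by simp)) (hm c (by simp)) t.2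
  · exact lineMap_mem_closedSimplex (hm a (by simp)) (hm c (by simp)) t.2

/-- A path in the open star of a vertex `w` is homotopic to the path through `w`. -/
theorem spoke_trans_of_mem_star {w : V} {y y' : Space K} (p : Path y y')
    (hp : ∀ t, w ∈ carrier (p t : V → ℝ)) (hy : w ∈ carrier (y : V → ℝ))
    (hy' : w ∈ carrier (y' : V → ℝ)) : (spoke w y hy).trans (mk p) = spoke w y' hy' := by
  classical
  have hs : ∀ z : Space K, w ∈ carrier (z : V → ℝ) →
      segment ℝ (z : V → ℝ) (Pi.single w 1) ⊆ realization K := by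
    intro z hz
    have hz' := mem_realization_iff.mp z.2
    exact ((convex_closedSimplex _).segment_subset (mem_closedSimplex_carrier hz'.1)
      (single_mem_closedSimplex hz)).trans (closedSimplex_subset_realization hz'.2)
  have hspoke : ∀ (z : Space K) (hz : w ∈ carrier (z : V → ℝ)) (t : unitInterval),
      w ∈ carrier (AffineMap.lineMap (Pi.single w 1 : V → ℝ) (z : V → ℝ) (t : ℝ)) := by
    intro z hz t
    rw [mem_carrier] at hz ⊢
    have h0 : 0 < (z : V → ℝ) w := lt_of_le_of_ne ((mem_realization_iff.mp z.2).1.1 w) (Ne.symm hz)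
    simp only [AffineMap.lineMap_apply, vsub_eq_sub, vadd_eq_add, Pi.add_apply, Pi.smul_apply,
      Pi.sub_apply, Pi.single_eq_same, smul_eq_mul]
    have h1 := t.2.1
    have h2 := t.2.2
    rcases eq_or_lt_of_le h1 with h3 | h3
    · rw [← h3]; norm_num
    · have := mul_pos h3 h0
      nlinarith
  refine trans_right_cancel (p := (spoke w y' hy').symm) ?_
  rw [trans_symm]
  unfold spoke
  rw [← mk_symm, ← mk_trans, ← mk_trans, ← mk_refl, Path.Homotopic.Quotient.eq]
  -- The loop stays in the open star of `w`, so it contracts to `w` along segments, each contained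
  -- in the closed carrier of its starting point.
  refine homotopic_of_segment_subset _ _ fun t => ?_
  rw [Path.refl_apply]
  refine hs _ ?_
  refine forall_trans_mem (A := {z : Space K | w ∈ carrier (z : V → ℝ)})
    (forall_trans_mem (A := {z : Space K | w ∈ carrier (z : V → ℝ)}) (fun t => ?_) hp)
    (fun t => ?_) t
  · exact hspoke y hy t
  · exact hspoke y' hy' (unitInterval.symm t)

open Classical in
/-- A map which realizes an injective homomorphism of fundamental groups on the edges is injective
on homotopy classes of paths. -/
theorem injective_map_of_edges {y₀ : Space K} {x₀ : X} (F : C(Space K, X))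
    (c : ∀ v, Quotient y₀ (vertexPoint K v)) (d : ∀ v, Quotient x₀ (F (vertexPoint K v)))
    (ψ : Quotient y₀ y₀ → Quotient x₀ x₀) (hψ : ∀ p q, ψ (p.trans q) = (ψ p).trans (ψ q))
    (hinj : Function.Injective ψ)
    (hedge : ∀ v w (h : {v, w} ∈ K.faces),
      (d v).trans (((edgeClass h).map F).trans (d w).symm) =
        ψ ((c v).trans ((edgeClass h).trans (c w).symm))) (y y' : Space K) :
    Function.Injective fun p : Quotient y y' => p.map F := by
  choose b hb using fun y : Space K => carrier_nonempty (mem_realization_iff.mp y.2).1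
  -- Every point is joined to the base point through a chosen vertex of its carrier. With these
  -- connecting classes paths become loops, and `main` says that `F` then acts as `ψ`; injectivity
  -- of `ψ` and cancellation finish the proof.
  let β : ∀ y : Space K, Quotient y₀ y := fun y => (c (b y)).trans (spoke (b y) y (hb y))
  let α : ∀ y : Space K, Quotient x₀ (F y) := fun y =>
    (d (b y)).trans ((spoke (b y) y (hb y)).map F)
  have main : ∀ {y y' : Space K} (p : Quotient y y'),
      (α y).trans ((p.map F).trans (α y').symm) = ψ ((β y).trans (p.trans (β y').symm)) := by
    intro y y' p
    refine class_induction (U := fun w : V => {z : Space K | w ∈ carrier (z : V → ℝ)}) ?_ ?_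
      (P := fun y y' p => (α y).trans ((p.map F).trans (α y').symm) =
        ψ ((β y).trans (p.trans (β y').symm))) ?_ ?_ p
    · intro w
      have : {z : Space K | w ∈ carrier (z : V → ℝ)} = {z : Space K | (z : V → ℝ) w ≠ 0} := by
        ext z; exact mem_carrier
      rw [this]
      exact isOpen_ne_fun ((continuous_apply w).comp continuous_subtype_val) continuous_const
    · intro z
      exact carrier_nonempty (mem_realization_iff.mp z.2).1
    · intro x y z p q hp hq
      have h1 : (α x).trans (((p.trans q).map F).trans (α z).symm) =
          ((α x).trans ((p.map F).trans (α y).symm)).trans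
            ((α y).trans ((q.map F).trans (α z).symm)) := by
        simp only [map_trans_class, trans_assoc, symm_trans_cancel_left]
      have h2 : (β x).trans ((p.trans q).trans (β z).symm) =
          ((β x).trans (p.trans (β y).symm)).trans ((β y).trans (q.trans (β z).symm)) := by
        simp only [trans_assoc, symm_trans_cancel_left]
      rw [h1, h2, hψ, hp, hq]
    · intro w y y' p hp
      have hy : w ∈ carrier (y : V → ℝ) := by have := hp 0; rwa [p.source] at this
      have hy' : w ∈ carrier (y' : V → ℝ) := by have := hp 1; rwa [p.target] at this
      have hf : ∀ (z : Space K) (u v : V), u ∈ carrier (z : V → ℝ) → v ∈ carrier (z : V → ℝ) →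
          {u, v} ∈ K.faces := by
        intro z u v hu hv
        refine face_subset (mem_realization_iff.mp z.2).2 (fun a ha => ?_) ⟨u, by simp⟩
        rw [Finset.mem_insert, Finset.mem_singleton] at ha
        rcases ha with rfl | rfl <;> assumption
      have e1 := hf y (b y) w (hb y) hy
      have e2 := hf y' w (b y') hy' (hb y')
      -- A path in the star of `w` can be routed through `w`, so its class is a product of two
      -- spokes and two edges, on which `F` is known.
      have h1 : mk p = (spoke (b y) y (hb y)).symm.trans ((edgeClass e1).trans
          ((edgeClass e2).trans (spoke (b y') y' (hb y')))) := by
        refine trans_left_cancel (p := spoke (b y) y (hb y)) ?_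
        rw [trans_symm_cancel_left, ← spoke_eq_edgeClass_trans hy' (hb y') e2,
          spoke_eq_edgeClass_trans (hb y) hy e1, trans_assoc, spoke_trans_of_mem_star p hp hy hy']
      have h2 : (β y).trans ((mk p).trans (β y').symm) =
          ((c (b y)).trans ((edgeClass e1).trans (c w).symm)).trans
            ((c w).trans ((edgeClass e2).trans (c (b y')).symm)) := by
        simp only [h1, β, symm_trans_class, trans_assoc, symm_trans_cancel_left, trans_symm_cancel_left]
      have h3 : (α y).trans (((mk p).map F).trans (α y').symm) =
          ((d (b y)).trans (((edgeClass e1).map F).trans (d w).symm)).trans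
            ((d w).trans (((edgeClass e2).map F).trans (d (b y')).symm)) := by
        simp only [h1, α, map_trans_class, map_symm_class, symm_trans_class, trans_assoc,
          symm_trans_cancel_left, trans_symm_cancel_left]
      rw [h2, h3, hψ, hedge, hedge]
  intro p q hpq
  have hpq' : p.map F = q.map F := hpq
  have h1 := main p
  rw [hpq', main q] at h1
  exact (trans_right_cancel (trans_left_cancel (hinj h1))).symm

/-- Connecting classes from `y₀` turn every edge into a loop, which `e` sends to a loop class in
`X`. These labels satisfy the triangle relation, so they are realized by a map that induces `e`. Its
injectivity is recorded on path classes between arbitrary points, the form in which fibers of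
universal covers are compared. -/
theorem exists_continuousMap_injective
    (hX : ∀ n : ℕ, 2 ≤ n → ∀ x : X, Subsingleton (HomotopyGroup.Pi n X x))
    [PathConnectedSpace (Space K)] {y₀ : Space K} {x₀ : X}
    (e : FundamentalGroup (Space K) y₀ ≃* FundamentalGroup X x₀) :
    ∃ F : C(Space K, X), ∀ y y' : Space K,
      Function.Injective fun p : Quotient y y' => p.map F := by
  classical
  let c : ∀ v, Quotient y₀ (vertexPoint K v) := fun v => mk (PathConnectedSpace.somePath _ _)
  let ψ : Quotient y₀ y₀ → Quotient x₀ x₀ := fun p => e p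
  -- The product `q * p` in `FundamentalGroup` is the concatenation of `p` followed by `q`, hence
  -- the exchanged arguments.
  have hψ : ∀ p q, ψ (p.trans q) = (ψ p).trans (ψ q) := fun p q =>
    e.map_mul (show FundamentalGroup (Space K) y₀ from q) (show FundamentalGroup (Space K) y₀ from p)
  let Ψ : V → V → Quotient x₀ x₀ := fun v w =>
    if h : {v, w} ∈ K.faces then ψ ((c v).trans ((edgeClass h).trans (c w).symm))
    else Path.Homotopic.Quotient.refl x₀
  have htrans : ∀ u v w, {u, v, w} ∈ K.faces → (Ψ u v).trans (Ψ v w) = Ψ u w := by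
    intro u v w h
    have h1 : {u, v} ∈ K.faces := face_subset h (by intro x; simp; tauto) ⟨u, by simp⟩
    have h2 : {v, w} ∈ K.faces := face_subset h (by intro x; simp; tauto) ⟨v, by simp⟩
    have h3 : {u, w} ∈ K.faces := face_subset h (by intro x; simp; tauto) ⟨u, by simp⟩
    simp only [Ψ, dif_pos h1, dif_pos h2, dif_pos h3]
    rw [← hψ, ← edgeClass_trans h h1 h2 h3]
    simp only [trans_assoc, symm_trans_cancel_left]
  have hrefl : ∀ v, Ψ v v = Path.Homotopic.Quotient.refl x₀ := by
    intro v
    have h := htrans v v v (by simpa using K.singleton_mem v)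
    refine trans_left_cancel (p := Ψ v v) ?_
    rw [h, trans_refl]
  have hsymm : ∀ v w, {v, w} ∈ K.faces → Ψ w v = (Ψ v w).symm := by
    intro v w h
    refine symm_eq_of_trans ?_
    rw [htrans v w v ?_, hrefl]
    have : ({v, w, v} : Finset V) = {v, w} := by ext; simp; tauto
    rwa [this]
  obtain ⟨f, hf, hfΨ⟩ := exists_realizesEdges (K := K) hX Ψ hrefl hsymm htrans
  let F : C(Space K, X) := ⟨fun y => f y, continuousOn_iff_continuous_domRestrict.mp hf⟩
  have hFv : ∀ v, x₀ = F (vertexPoint K v) := by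
    intro v
    obtain ⟨p, hp, _⟩ := hfΨ v v (by simpa using K.singleton_mem v)
    have := hp 0
    simp only [p.source, AffineMap.lineMap_same_apply] at this
    exact this
  have hcast : ∀ {a b : X} (ha : x₀ = a) (hb : x₀ = b) (q : Path a b),
      ((Path.Homotopic.Quotient.refl x₀).cast rfl ha.symm).trans ((mk q).trans
        ((Path.Homotopic.Quotient.refl x₀).cast rfl hb.symm).symm) = mk (q.cast ha hb) := by
    rintro a b rfl rfl q
    simp only [cast_rfl_rfl, refl_trans]
    rw [← symm_eq_of_trans (refl_trans (Path.Homotopic.Quotient.refl x₀)), trans_refl]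
    rfl
  refine ⟨F, fun y y' => injective_map_of_edges F c
    (fun v => (Path.Homotopic.Quotient.refl x₀).cast rfl (hFv v).symm) ψ hψ e.injective ?_ y y'⟩
  intro v w h
  obtain ⟨p, hp, hpΨ⟩ := hfΨ v w h
  have h1 : ψ ((c v).trans ((edgeClass h).trans (c w).symm)) = mk p := by
    rw [hpΨ]; simp only [Ψ, dif_pos h]
  rw [h1]
  unfold edgeClass
  rw [← mk_map, hcast (hFv v) (hFv w)]
  congr 1
  ext t
  exact (hp t).symm

end Injectivity

/-! ### Piecewise affine approximation -/

section PiecewiseAffine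

variable {V : Type*}

/-- Affine functions on `V → ℝ`, as pairs of a linear part and a constant. -/
abbrev AffineFn (V : Type*) : Type _ := ((V → ℝ) →ₗ[ℝ] ℝ) × ℝ

/-- The value of an affine function. -/
def AffineFn.eval (A : AffineFn V) (y : V → ℝ) : ℝ := A.1 y + A.2

theorem AffineFn.eval_def (A : AffineFn V) (y : V → ℝ) : A.eval y = A.1 y + A.2 := rfl

theorem AffineFn.continuous [Fintype V] (A : AffineFn V) : Continuous A.eval :=
  (A.1.continuous_of_finiteDimensional).add continuous_const

/-- A function is piecewise affine if it is continuous and its values are selected among finitely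
many affine functions. -/
def IsPiecewiseAffine (F : (V → ℝ) → ℝ) : Prop :=
  Continuous F ∧ ∃ S : Set (AffineFn V), S.Finite ∧ ∀ y, ∃ A ∈ S, F y = A.eval y

theorem isPiecewiseAffine_eval [Fintype V] (A : AffineFn V) : IsPiecewiseAffine A.eval :=
  ⟨A.continuous, {A}, Set.finite_singleton A, fun _ => ⟨A, rfl, rfl⟩⟩

theorem isPiecewiseAffine_const [Fintype V] (c : ℝ) : IsPiecewiseAffine (fun _ : V → ℝ => c) := by
  have : (fun _ : V → ℝ => c) = AffineFn.eval (0, c) := by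
    funext y; simp [AffineFn.eval]
  rw [this]; exact isPiecewiseAffine_eval _

namespace IsPiecewiseAffine

variable {F G : (V → ℝ) → ℝ}

theorem add (hF : IsPiecewiseAffine F) (hG : IsPiecewiseAffine G) :
    IsPiecewiseAffine fun y => F y + G y := by
  obtain ⟨hFc, S, hS, hFS⟩ := hF
  obtain ⟨hGc, T, hT, hGT⟩ := hG
  refine ⟨hFc.add hGc, Set.image2 (· + ·) S T, hS.image2 _ hT, fun y => ?_⟩
  obtain ⟨A, hA, hAy⟩ := hFS y
  obtain ⟨B, hB, hBy⟩ := hGT y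
  refine ⟨A + B, ⟨A, hA, B, hB, rfl⟩, ?_⟩
  simp only [hAy, hBy, AffineFn.eval_def, Prod.fst_add, Prod.snd_add, LinearMap.add_apply]
  ring

theorem sub (hF : IsPiecewiseAffine F) (hG : IsPiecewiseAffine G) :
    IsPiecewiseAffine fun y => F y - G y := by
  obtain ⟨hFc, S, hS, hFS⟩ := hF
  obtain ⟨hGc, T, hT, hGT⟩ := hG
  refine ⟨hFc.sub hGc, Set.image2 (· - ·) S T, hS.image2 _ hT, fun y => ?_⟩
  obtain ⟨A, hA, hAy⟩ := hFS y
  obtain ⟨B, hB, hBy⟩ := hGT y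
  refine ⟨A - B, ⟨A, hA, B, hB, rfl⟩, ?_⟩
  simp only [hAy, hBy, AffineFn.eval_def, Prod.fst_sub, Prod.snd_sub, LinearMap.sub_apply]
  ring

theorem max (hF : IsPiecewiseAffine F) (hG : IsPiecewiseAffine G) :
    IsPiecewiseAffine fun y => max (F y) (G y) := by
  obtain ⟨hFc, S, hS, hFS⟩ := hF
  obtain ⟨hGc, T, hT, hGT⟩ := hG
  refine ⟨hFc.max hGc, S ∪ T, hS.union hT, fun y => ?_⟩
  obtain ⟨A, hA, hAy⟩ := hFS y
  obtain ⟨B, hB, hBy⟩ := hGT y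
  rcases max_choice (F y) (G y) with h | h
  · exact ⟨A, Or.inl hA, h.trans hAy⟩
  · exact ⟨B, Or.inr hB, h.trans hBy⟩

theorem min (hF : IsPiecewiseAffine F) (hG : IsPiecewiseAffine G) :
    IsPiecewiseAffine fun y => min (F y) (G y) := by
  obtain ⟨hFc, S, hS, hFS⟩ := hF
  obtain ⟨hGc, T, hT, hGT⟩ := hG
  refine ⟨hFc.min hGc, S ∪ T, hS.union hT, fun y => ?_⟩
  obtain ⟨A, hA, hAy⟩ := hFS y
  obtain ⟨B, hB, hBy⟩ := hGT y
  rcases min_choice (F y) (G y) with h | h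
  · exact ⟨A, Or.inl hA, h.trans hAy⟩
  · exact ⟨B, Or.inr hB, h.trans hBy⟩

variable [Fintype V]

theorem sum {ι : Type*} (s : Finset ι) {F : ι → (V → ℝ) → ℝ}
    (hF : ∀ i ∈ s, IsPiecewiseAffine (F i)) : IsPiecewiseAffine fun y => ∑ i ∈ s, F i y := by
  classical
  induction s using Finset.induction_on with
  | empty => simpa using isPiecewiseAffine_const 0
  | insert i s hi ih =>
    simp only [Finset.sum_insert hi]
    exact (hF i (Finset.mem_insert_self i s)).add
      (ih fun j hj => hF j (Finset.mem_insert_of_mem hj))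

theorem foldMin {ι : Type*} (s : Finset ι) (c : ℝ) {F : ι → (V → ℝ) → ℝ}
    (hF : ∀ i, IsPiecewiseAffine (F i)) :
    IsPiecewiseAffine fun y => s.fold Min.min c fun i => F i y := by
  classical
  induction s using Finset.induction_on with
  | empty => simpa using isPiecewiseAffine_const c
  | insert i s hi ih =>
    simp only [Finset.fold_insert hi]
    exact (hF i).min ih

theorem foldMax {ι : Type*} (s : Finset ι) (c : ℝ) {F : ι → (V → ℝ) → ℝ}
    (hF : ∀ i, IsPiecewiseAffine (F i)) :
    IsPiecewiseAffine fun y => s.fold Max.max c fun i => F i y := by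
  classical
  induction s using Finset.induction_on with
  | empty => simpa using isPiecewiseAffine_const c
  | insert i s hi ih =>
    simp only [Finset.fold_insert hi]
    exact (hF i).max ih

end IsPiecewiseAffine

variable [Fintype V]

/-- The supremum of the `θ ∈ [0, 1)` for which all the coordinates of `N y + θ` have
integer parts given by `k`. -/
def cellUpper (N : ℕ) (k : V → Fin (N + 1)) (y : V → ℝ) : ℝ :=
  Finset.univ.fold Min.min 1 fun v => ((k v : ℕ) : ℝ) + 1 - N * y v

/-- The infimum of the `θ ∈ [0, 1)` for which all the coordinates of `N y + θ` have
integer parts given by `k`. -/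
def cellLower (N : ℕ) (k : V → Fin (N + 1)) (y : V → ℝ) : ℝ :=
  Finset.univ.fold Max.max 0 fun v => ((k v : ℕ) : ℝ) - N * y v

/-- The measure of the set of `θ ∈ [0, 1)` for which all the coordinates of `N y + θ` have
integer parts given by `k`. As functions of `y`, these form a piecewise affine partition of unity. -/
def hat (N : ℕ) (k : V → Fin (N + 1)) (y : V → ℝ) : ℝ :=
  max (cellUpper N k y - cellLower N k y) 0

/-- The admissible `θ` form an interval whose ends are a minimum and a maximum of affine functions
of `y`. This is why its length `hat` is piecewise affine. -/
theorem mem_Ico_cell {N : ℕ} {k : V → Fin (N + 1)} {y : V → ℝ} {θ : ℝ} :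
    θ ∈ Set.Ico (cellLower N k y) (cellUpper N k y) ↔
      θ ∈ Set.Ico (0 : ℝ) 1 ∧ ∀ v, ((k v : ℕ) : ℝ) ≤ N * y v + θ ∧ N * y v + θ < (k v : ℕ) + 1 := by
  simp only [Set.mem_Ico, cellLower, cellUpper, Finset.fold_max_le, Finset.lt_fold_min,
    Finset.mem_univ, true_imp_iff]
  constructor
  · rintro ⟨⟨h1, h2⟩, h3, h4⟩
    exact ⟨⟨h1, h3⟩, fun v => ⟨by linarith [h2 v], by linarith [h4 v]⟩⟩
  · rintro ⟨⟨h1, h3⟩, h⟩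
    exact ⟨⟨h1, fun v => by linarith [(h v).1]⟩, h3, fun v => by linarith [(h v).2]⟩

theorem isPiecewiseAffine_hat (N : ℕ) (k : V → Fin (N + 1)) :
    IsPiecewiseAffine (hat N k) := by
  have hc : ∀ v, IsPiecewiseAffine fun y : V → ℝ => (N : ℝ) * y v := fun v => by
    have : (fun y : V → ℝ => (N : ℝ) * y v) =
        AffineFn.eval ((N : ℝ) • LinearMap.proj v, 0) := by
      funext y; simp [AffineFn.eval]
    rw [this]; exact isPiecewiseAffine_eval _
  refine (IsPiecewiseAffine.sub ?_ ?_).max (isPiecewiseAffine_const 0)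
  · exact IsPiecewiseAffine.foldMin _ _ fun v => (isPiecewiseAffine_const _).sub (hc v)
  · exact IsPiecewiseAffine.foldMax _ _ fun v => (isPiecewiseAffine_const _).sub (hc v)

theorem hat_nonneg (N : ℕ) (k : V → Fin (N + 1)) (y : V → ℝ) : 0 ≤ hat N k y := le_max_right _ _

-- For fixed `y` the cells partition `[0, 1)`: each `θ` belongs to the cell given by the integer
-- parts of `N * y v + θ`. These are at most `N`, so `Fin (N + 1)` suffices.
open Classical in
theorem sum_hat {N : ℕ} {y : V → ℝ} (hy : ∀ v, y v ∈ Set.Icc (0 : ℝ) 1) :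
    ∑ k : V → Fin (N + 1), hat N k y = 1 := by
  have h1 : ∀ k : V → Fin (N + 1), hat N k y =
      volume.real (Set.Ico (cellLower N k y) (cellUpper N k y)) := fun k => by
    rw [Real.volume_real_Ico]; rfl
  simp_rw [h1]
  rw [← measureReal_biUnion_finset (s := Finset.univ) ?_ (fun _ _ => measurableSet_Ico) ?_]
  · have : (⋃ k ∈ (Finset.univ : Finset (V → Fin (N + 1))),
        Set.Ico (cellLower N k y) (cellUpper N k y)) = Set.Ico (0 : ℝ) 1 := by
      ext θ
      simp only [Set.mem_iUnion, Finset.mem_univ, exists_prop, true_and]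
      constructor
      · rintro ⟨k, hk⟩; exact (mem_Ico_cell.mp hk).1
      · intro hθ
        have hnn : ∀ v, 0 ≤ (N : ℝ) * y v + θ := fun v => by
          have := (hy v).1; have := hθ.1; positivity
        have hlt : ∀ v, ⌊(N : ℝ) * y v + θ⌋₊ < N + 1 := fun v => by
          rw [Nat.floor_lt (hnn v)]
          have : (N : ℝ) * y v ≤ N * 1 := mul_le_mul_of_nonneg_left (hy v).2 (Nat.cast_nonneg N)
          push_cast
          linarith [hθ.2]
        exact ⟨fun v => ⟨_, hlt v⟩, mem_Ico_cell.mpr ⟨hθ, fun v =>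
          ⟨Nat.floor_le (hnn v), Nat.lt_floor_add_one _⟩⟩⟩
    rw [this, Real.volume_real_Ico]; simp
  · intro k _ k' _ hkk'
    refine Set.disjoint_left.mpr fun θ h h' => hkk' (funext fun v => Fin.ext ?_)
    have h2 := (mem_Ico_cell.mp h).2 v
    have h3 := (mem_Ico_cell.mp h').2 v
    have h4 : ((k v : ℕ) : ℝ) < (k' v : ℕ) + 1 := by linarith
    have h5 : ((k' v : ℕ) : ℝ) < (k v : ℕ) + 1 := by linarith
    have h6 : (k v : ℕ) < (k' v : ℕ) + 1 := by exact_mod_cast h4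
    have h7 : (k' v : ℕ) < (k v : ℕ) + 1 := by exact_mod_cast h5
    omega
  · exact fun _ _ => by simp

/-- If the cell is non-empty then every `N * y v` is within `1` of `k v`. Thus the supports of the
hats shrink as `N` grows. -/
theorem abs_sub_lt_of_hat_pos {N : ℕ} {k : V → Fin (N + 1)} {y y' : V → ℝ} (hy : 0 < hat N k y)
    (hy' : 0 < hat N k y') (v : V) : N * |y v - y' v| < 2 := by
  have key : ∀ z : V → ℝ, 0 < hat N k z → -1 < (k v : ℕ) - N * z v ∧ (k v : ℕ) - N * z v < 1 := by
    intro z hz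
    have h : cellLower N k z < cellUpper N k z := by
      rcases lt_max_iff.mp hz with h | h
      · linarith
      · exact absurd h (lt_irrefl _)
    have := mem_Ico_cell.mp (Set.left_mem_Ico.mpr h)
    have h1 := this.1
    have h2 := this.2 v
    constructor <;> linarith [h1.1, h1.2, h2.1, h2.2]
  have h1 := key y hy
  have h2 := key y' hy'
  have h3 : (N : ℝ) * |y v - y' v| = |N * (y v - y' v)| := by rw [abs_mul, Nat.abs_cast]
  rw [h3, abs_lt, mul_sub]
  constructor <;> linarith [h1.1, h1.2, h2.1, h2.2]

end PiecewiseAffine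

/-! ### Piecewise affine approximation of continuous maps. -/

section Approximation

open Path.Homotopic (Quotient)
open Path.Homotopic.Quotient

variable {V W : Type*} [Fintype V] [Fintype W]
  {K : AbstractSimplicialComplex V} {L : AbstractSimplicialComplex W}

/-- A continuous map between simplicial complexes can be approximated by a piecewise affine map,
which sends each point to the carrier of its image. -/
theorem exists_piecewiseAffine_approximation (f : C(Space K, Space L)) (y₀ : Space K) :
    ∃ F : (V → ℝ) → (W → ℝ), (∀ w, IsPiecewiseAffine fun y => F y w) ∧
      ∀ y : Space K, F y ∈ closedSimplex (carrier (f y : W → ℝ)) := by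
  classical
  obtain ⟨w₀, -⟩ := carrier_nonempty (mem_realization_iff.mp (f y₀).2).1
  -- A Lebesgue number for the cover of `K` by the preimages of the open stars of the vertices of
  -- `L`. The choice of `N` below makes the support of each hat fit into a ball of radius `δ`, hence
  -- into one such preimage.
  obtain ⟨δ, hδ, hball⟩ := lebesgue_number_lemma_of_metric (s := (Set.univ : Set (Space K)))
    (c := fun w : W => {y : Space K | (f y : W → ℝ) w ≠ 0}) isCompact_univ
    (fun w => isOpen_ne_fun ((continuous_apply w).comp (continuous_subtype_val.comp f.continuous))
      continuous_const)
    (fun y _ => by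
      obtain ⟨w, hw⟩ := carrier_nonempty (mem_realization_iff.mp (f y).2).1
      exact Set.mem_iUnion.mpr ⟨w, mem_carrier.mp hw⟩)
  obtain ⟨N, hN⟩ := exists_nat_gt (2 / δ)
  have hNpos : (0 : ℝ) < N := lt_trans (by positivity) hN
  have hφ : ∀ k : V → Fin (N + 1), ∃ w : W, ∀ y : Space K, 0 < hat N k (y : V → ℝ) →
      (f y : W → ℝ) w ≠ 0 := by
    intro k
    by_cases h : ∃ y : Space K, 0 < hat N k (y : V → ℝ)
    · obtain ⟨y, hy⟩ := h
      obtain ⟨w, hw⟩ := hball y (Set.mem_univ y)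
      refine ⟨w, fun y' hy' => hw ?_⟩
      rw [Metric.mem_ball, Subtype.dist_eq, dist_pi_lt_iff hδ]
      intro v
      have h1 := abs_sub_lt_of_hat_pos hy' hy v
      rw [Real.dist_eq]
      rw [div_lt_iff₀ hδ] at hN
      by_contra h2
      have := mul_le_mul_of_nonneg_left (not_lt.mp h2) hNpos.le
      linarith
    · exact ⟨w₀, fun y hy => absurd ⟨y, hy⟩ h⟩
  choose φ hφ using hφ
  -- The hat of index `k` is the weight put on the vertex `φ k`. A positive weight forces this
  -- vertex into the carrier of `f y`, so `F y` and `f y` lie in a common closed simplex.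
  refine ⟨fun y w => ∑ k ∈ Finset.univ.filter (fun k => φ k = w), hat N k y,
    fun w => IsPiecewiseAffine.sum _ fun k _ => isPiecewiseAffine_hat N k, fun y => ⟨⟨?_, ?_⟩, ?_⟩⟩
  · exact fun w => Finset.sum_nonneg fun k _ => hat_nonneg N k y
  · have hy := (mem_realization_iff.mp y.2).1
    have h1 := Finset.sum_fiberwise Finset.univ φ fun k => hat N k (y : V → ℝ)
    refine h1.trans (sum_hat ?_)
    intro v
    exact ⟨hy.1 v, hy.2 ▸ Finset.single_le_sum (fun u _ => hy.1 u) (Finset.mem_univ v)⟩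
  · intro w hw
    refine Finset.sum_eq_zero fun k hk => ?_
    rw [Finset.mem_filter] at hk
    by_contra h
    have h1 := hφ k y (lt_of_le_of_ne (hat_nonneg N k y) (Ne.symm h))
    rw [hk.2] at h1
    exact hw (mem_carrier.mpr h1)

/-- A homotopic map is also injective on homotopy classes of paths. -/
theorem injective_map_of_homotopy {X Y : Type*} [TopologicalSpace X] [TopologicalSpace Y]
    {f g : C(X, Y)} (H : f.Homotopy g) {y y' : X}
    (hf : Function.Injective fun p : Quotient y y' => p.map f) :
    Function.Injective fun p : Quotient y y' => p.map g := by
  -- The tracks of the end points under the homotopy intertwine the two actions on path classes.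
  have key : ∀ p : Quotient y y', (p.map f).trans (mk (H.evalAt y')) =
      (mk (H.evalAt y)).trans (p.map g) := by
    intro p
    induction p using Path.Homotopic.Quotient.ind with
    | mk p =>
      rw [← mk_map, ← mk_map, ← mk_trans, ← mk_trans, Path.Homotopic.Quotient.eq]
      exact Path.Homotopic.map_trans_evalAt H p
  intro p q hpq
  have hpq' : p.map g = q.map g := hpq
  refine hf (trans_right_cancel (p := mk (H.evalAt y')) ?_)
  change (p.map f).trans _ = (q.map f).trans _
  rw [key, key, hpq']

/-- A piecewise affine map between the realizations of two complexes. -/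
structure PLMap (K : AbstractSimplicialComplex V) (L : AbstractSimplicialComplex W) where
  toFun : (V → ℝ) → (W → ℝ)
  piecewiseAffine : ∀ w, IsPiecewiseAffine fun y => toFun y w
  mem : ∀ y ∈ realization K, toFun y ∈ realization L

theorem PLMap.continuous (F : PLMap K L) : Continuous F.toFun :=
  continuous_pi fun w => (F.piecewiseAffine w).1

/-- The continuous map between realizations defined by a piecewise affine map. -/
def PLMap.toContinuousMap (F : PLMap K L) : C(Space K, Space L) :=
  ⟨fun y => ⟨F.toFun y, F.mem y y.2⟩,
    (F.continuous.comp continuous_subtype_val).subtype_mk _⟩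

/-- If the higher homotopy groups of `L` are trivial, an isomorphism of fundamental groups gives
a piecewise affine map which is injective on homotopy classes of paths. -/
theorem exists_plMap_injective [PathConnectedSpace (Space K)]
    (hL : ∀ n : ℕ, 2 ≤ n → ∀ x : Space L, Subsingleton (HomotopyGroup.Pi n (Space L) x))
    {y₀ : Space K} {x₀ : Space L}
    (e : FundamentalGroup (Space K) y₀ ≃* FundamentalGroup (Space L) x₀) :
    ∃ F : PLMap K L, ∀ y y' : Space K,
      Function.Injective fun p : Quotient y y' => p.map F.toContinuousMap := by
  obtain ⟨f, hf⟩ := exists_continuousMap_injective hL e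
  obtain ⟨F, hF, hFf⟩ := exists_piecewiseAffine_approximation f y₀
  have hfm : ∀ y : Space K, (f y : W → ℝ) ∈ closedSimplex (carrier (f y : W → ℝ)) := fun y =>
    mem_closedSimplex_carrier (mem_realization_iff.mp (f y).2).1
  let F' : PLMap K L := ⟨F, hF, fun y hy =>
    closedSimplex_subset_realization (mem_realization_iff.mp (f ⟨y, hy⟩).2).2 (hFf ⟨y, hy⟩)⟩
  let H : f.Homotopy F'.toContinuousMap :=
    { toFun := fun z => ⟨AffineMap.lineMap (f z.2 : W → ℝ) (F'.toContinuousMap z.2 : W → ℝ) (z.1 : ℝ),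
        closedSimplex_subset_realization (mem_realization_iff.mp (f z.2).2).2
          (lineMap_mem_closedSimplex (hfm z.2) (hFf z.2) z.1.2)⟩
      continuous_toFun := by
        refine Continuous.subtype_mk ?_ _
        have h1 : Continuous fun z : unitInterval × Space K =>
            ((F'.toContinuousMap z.2 : Space L) : W → ℝ) :=
          continuous_subtype_val.comp (F'.toContinuousMap.continuous.comp continuous_snd)
        simp only [AffineMap.lineMap_apply, vsub_eq_sub, vadd_eq_add]
        exact ((by fun_prop : Continuous fun z : unitInterval × Space K => ((z.1 : unitInterval) : ℝ)).smul
          (h1.sub (by fun_prop))).add (by fun_prop)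
      map_zero_left := fun y => by ext1; simp
      map_one_left := fun y => by ext1; simp }
  exact ⟨F', fun y y' => injective_map_of_homotopy H (hf y y')⟩

end Approximation

/-! ### Piecewise `C¹` paths and their lengths -/

section PiecewiseC1

variable {V : Type*} [Fintype V] {K : AbstractSimplicialComplex V}

/-- A curve is regular on `[a, b]` if it is `C¹` there with values in a closed simplex. -/
def IsRegularOn (K : AbstractSimplicialComplex V) (c : ℝ → (V → ℝ)) (a b : ℝ) : Prop :=
  (∃ s ∈ K.faces, ∀ t ∈ Set.Icc a b, c t ∈ closedSimplex s) ∧ ContDiffOn ℝ 1 c (Set.Icc a b)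

theorem IsRegularOn.mono {c : ℝ → (V → ℝ)} {a b a' b' : ℝ} (h : IsRegularOn K c a b)
    (ha : a ≤ a') (hb : b' ≤ b) : IsRegularOn K c a' b' := by
  obtain ⟨⟨s, hs, hc⟩, hd⟩ := h
  have hsub : Set.Icc a' b' ⊆ Set.Icc a b := Set.Icc_subset_Icc ha hb
  exact ⟨⟨s, hs, fun t ht => hc t (hsub ht)⟩, hd.mono hsub⟩

theorem IsRegularOn.comp_affine {c c' : ℝ → (V → ℝ)} {a b α β : ℝ} (hα : 0 < α)
    (h : IsRegularOn K c (α * a + β) (α * b + β))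
    (hc : ∀ t ∈ Set.Icc a b, c' t = c (α * t + β)) : IsRegularOn K c' a b := by
  obtain ⟨⟨s, hs, hcs⟩, hd⟩ := h
  have hm : ∀ t ∈ Set.Icc a b, α * t + β ∈ Set.Icc (α * a + β) (α * b + β) := fun t ht =>
    ⟨by nlinarith [ht.1], by nlinarith [ht.2]⟩
  refine ⟨⟨s, hs, fun t ht => hc t ht ▸ hcs _ (hm t ht)⟩, ?_⟩
  exact (hd.comp (g := c) (f := fun t => α * t + β) (by fun_prop) hm).congr hc

/-- A path is piecewise `C¹` if it is regular outside of finitely many break points. -/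
theorem isPiecewiseC1_iff {x y : Space K} (γ : Path x y) :
    IsPiecewiseC1 γ ↔ ∃ B : Set ℝ, B.Finite ∧ ∀ a b, 0 ≤ a → a < b → b ≤ 1 →
      (∀ t ∈ Set.Ioo a b, t ∉ B) → IsRegularOn K (curve γ) a b := by
  constructor
  · rintro ⟨n, τ, hτ, h0, h1, h⟩
    refine ⟨Set.range τ, Set.finite_range τ, fun a b ha hab hb hB => ?_⟩
    let T : Finset (Fin (n + 1)) := Finset.univ.filter fun i => τ i ≤ a
    have hT : T.Nonempty := ⟨0, by simp [T, h0, ha]⟩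
    obtain ⟨i, hi, hmax⟩ := T.exists_max_image id hT
    have hia : τ i ≤ a := by simpa [T] using hi
    have hil : i ≠ Fin.last n := by
      rintro rfl
      rw [h1] at hia; linarith
    obtain ⟨j, rfl⟩ := Fin.exists_castSucc_eq.mpr hil
    have hj : a < τ j.succ := by
      by_contra hcon
      have := hmax j.succ (by simpa [T] using hcon)
      exact absurd this (not_le.mpr (Fin.castSucc_lt_succ))
    have hbj : b ≤ τ j.succ := by
      by_contra hcon
      exact hB _ ⟨hj, not_le.mp hcon⟩ ⟨_, rfl⟩
    exact IsRegularOn.mono (h j) hia hbj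
  · rintro ⟨B, hB, h⟩
    classical
    let B' : Finset ℝ := insert 0 (insert 1 (hB.toFinset.filter fun t => t ∈ Set.Icc (0 : ℝ) 1))
    have h0 : (0 : ℝ) ∈ B' := by simp [B']
    have h1 : (1 : ℝ) ∈ B' := by simp [B']
    have hB' : ∀ t ∈ B', 0 ≤ t ∧ t ≤ 1 := by
      intro t ht
      simp only [B', Finset.mem_insert, Finset.mem_filter] at ht
      rcases ht with rfl | rfl | ht
      · norm_num
      · norm_num
      · exact ht.2
    obtain ⟨n, hn⟩ : ∃ n, B'.card = n + 1 :=
      ⟨B'.card - 1, by have := Finset.card_pos.mpr ⟨0, h0⟩; omega⟩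
    let τ := B'.orderEmbOfFin hn
    have hτr : ∀ t ∈ B', ∃ i, τ i = t := fun t ht => by
      have := Finset.range_orderEmbOfFin B' hn
      rw [← Finset.mem_coe, ← this] at ht
      exact ht
    have hτm : ∀ i, τ i ∈ B' := fun i => Finset.orderEmbOfFin_mem B' hn i
    refine ⟨n, τ, τ.monotone, ?_, ?_, fun i => ?_⟩
    · obtain ⟨i, hi⟩ := hτr 0 h0
      refine le_antisymm ?_ (hB' _ (hτm 0)).1
      rw [← hi]; exact τ.monotone (Fin.zero_le i)
    · obtain ⟨i, hi⟩ := hτr 1 h1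
      refine le_antisymm (hB' _ (hτm _)).2 ?_
      rw [← hi]; exact τ.monotone (Fin.le_last i)
    · refine h _ _ (hB' _ (hτm _)).1 (τ.strictMono Fin.castSucc_lt_succ) (hB' _ (hτm _)).2 ?_
      intro t ht htB
      have htB' : t ∈ B' := by
        simp only [B', Finset.mem_insert, Finset.mem_filter, Set.Finite.mem_toFinset]
        exact Or.inr (Or.inr ⟨htB, (hB' _ (hτm i.castSucc)).1.trans ht.1.le,
          ht.2.le.trans (hB' _ (hτm i.succ)).2⟩)
      obtain ⟨j, rfl⟩ := hτr t htB'
      have h2 := τ.lt_iff_lt.mp ht.1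
      have h3 := τ.lt_iff_lt.mp ht.2
      simp only [Fin.lt_def, Fin.val_castSucc, Fin.val_succ] at h2 h3
      omega

/-- The concatenation of piecewise `C¹` paths is piecewise `C¹`. -/
theorem IsPiecewiseC1.trans {x y z : Space K} {γ : Path x y} {γ' : Path y z}
    (h : IsPiecewiseC1 γ) (h' : IsPiecewiseC1 γ') : IsPiecewiseC1 (γ.trans γ') := by
  rw [isPiecewiseC1_iff] at h h' ⊢
  obtain ⟨B, hB, hγ⟩ := h
  obtain ⟨B', hB', hγ'⟩ := h'
  refine ⟨insert (1 / 2) ((fun t => t / 2) '' B ∪ (fun t => (t + 1) / 2) '' B'),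
    ((hB.image _).union (hB'.image _)).insert _, fun a b ha hab hb h => ?_⟩
  have hhalf : ¬ (a < 1 / 2 ∧ 1 / 2 < b) := fun hh => h (1 / 2) hh (Set.mem_insert _ _)
  rcases le_or_gt (1 / 2) a with h1 | h1
  · refine IsRegularOn.comp_affine (c := curve γ') (α := 2) (β := -1) two_pos
      (hγ' _ _ (by linarith) (by linarith) (by linarith) fun t ht htB => ?_) fun t ht => ?_
    · refine h ((t + 1) / 2) ⟨by linarith [ht.1], by linarith [ht.2]⟩ (Or.inr (Or.inr ⟨t, htB, rfl⟩))
    · simp only [curve]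
      rw [Path.extend_trans_of_half_le _ _ (h1.trans ht.1)]; rfl
  · have h2 : b ≤ 1 / 2 := by
      by_contra hcon; exact hhalf ⟨h1, not_le.mp hcon⟩
    refine IsRegularOn.comp_affine (c := curve γ) (α := 2) (β := 0) two_pos
      (hγ _ _ (by linarith) (by linarith) (by linarith) fun t ht htB => ?_) fun t ht => ?_
    · refine h (t / 2) ⟨by linarith [ht.1], by linarith [ht.2]⟩ (Or.inr (Or.inl ⟨t, htB, rfl⟩))
    · simp only [curve]
      rw [Path.extend_trans_of_le_half _ _ (ht.2.trans h2), add_zero]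

/-- The speed of a curve. -/
def speed (g : PiecewiseRiemannianMetric K) (c : ℝ → (V → ℝ)) (t : ℝ) : ℝ≥0∞ :=
  ENNReal.ofReal (Real.sqrt (g.form (carrier (c t)) (c t) (deriv c t) (deriv c t)))

theorem pathLength_eq_lintegral_speed (g : PiecewiseRiemannianMetric K) {x y : Space K}
    (γ : Path x y) : pathLength g γ = ∫⁻ t in Set.Icc (0 : ℝ) 1, speed g (curve γ) t := rfl

/-- The length of an arc is invariant under affine changes of the parameter. -/
theorem lintegral_speed_comp_affine (g : PiecewiseRiemannianMetric K) {c c' : ℝ → (V → ℝ)}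
    {a b α β : ℝ} (hα : 0 < α) (hc : ∀ t ∈ Set.Ioo a b, c' t = c (α * t + β)) :
    ∫⁻ t in Set.Ioo a b, speed g c' t =
      ∫⁻ t in Set.Ioo (α * a + β) (α * b + β), speed g c t := by
  have himg : (fun t => α * t + β) '' Set.Ioo a b = Set.Ioo (α * a + β) (α * b + β) := by
    ext t
    constructor
    · rintro ⟨u, hu, rfl⟩
      exact ⟨by nlinarith [hu.1], by nlinarith [hu.2]⟩
    · intro ht
      refine ⟨(t - β) / α, ⟨?_, ?_⟩, by field_simp; ring⟩
      · rw [lt_div_iff₀ hα]; linarith [ht.1]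
      · rw [div_lt_iff₀ hα]; linarith [ht.2]
  rw [← himg, lintegral_image_eq_lintegral_abs_deriv_mul (f' := fun _ => α) measurableSet_Ioo
    (fun x _ => by simpa using (((hasDerivAt_id x).const_mul α).add_const β).hasDerivWithinAt)
    (fun x _ y _ hxy => by
      have : α * x + β = α * y + β := hxy
      exact mul_left_cancel₀ hα.ne' (add_right_cancel this))]
  refine setLIntegral_congr_fun measurableSet_Ioo fun t ht => ?_
  have hd : deriv c' t = α • deriv c (α * t + β) := by
    have he : c' =ᶠ[𝓝 t] fun u => c (α * u + β) := by
      filter_upwards [isOpen_Ioo.mem_nhds ht] with u hu using hc u hu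
    rw [he.deriv_eq]
    have h1 := deriv_comp_mul_left α (fun u => c (u + β)) t
    rw [deriv_comp_add_const] at h1
    exact h1
  change ENNReal.ofReal _ = ENNReal.ofReal |α| * ENNReal.ofReal _
  rw [← ENNReal.ofReal_mul (abs_nonneg α), hc t ht, hd, map_smul, map_smul, LinearMap.smul_apply,
    smul_eq_mul, smul_eq_mul, ← mul_assoc, Real.sqrt_mul (mul_self_nonneg α), Real.sqrt_mul_self_eq_abs]

theorem pathLength_trans_le (g : PiecewiseRiemannianMetric K) {x y z : Space K} (γ : Path x y)
    (γ' : Path y z) : pathLength g (γ.trans γ') ≤ pathLength g γ + pathLength g γ' := by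
  simp only [pathLength_eq_lintegral_speed]
  have h1 : Set.Icc (0 : ℝ) 1 = Set.Icc 0 (1 / 2) ∪ Set.Icc (1 / 2) 1 :=
    (Set.Icc_union_Icc_eq_Icc (by norm_num) (by norm_num)).symm
  have h2 := lintegral_speed_comp_affine g (c := curve γ) (c' := curve (γ.trans γ')) (a := 0)
    (b := 1 / 2) (α := 2) (β := 0) two_pos fun t ht => by
      simp only [curve]
      rw [Path.extend_trans_of_le_half _ _ ht.2.le, add_zero]
  have h3 := lintegral_speed_comp_affine g (c := curve γ') (c' := curve (γ.trans γ')) (a := 1 / 2)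
    (b := 1) (α := 2) (β := -1) two_pos fun t ht => by
      simp only [curve]
      rw [Path.extend_trans_of_half_le _ _ ht.1.le]; rfl
  norm_num at h2 h3
  calc ∫⁻ t in Set.Icc (0 : ℝ) 1, speed g (curve (γ.trans γ')) t
      ≤ (∫⁻ t in Set.Icc (0 : ℝ) (1 / 2), speed g (curve (γ.trans γ')) t) +
        ∫⁻ t in Set.Icc (1 / 2 : ℝ) 1, speed g (curve (γ.trans γ')) t := by
        conv_lhs => rw [h1]
        exact lintegral_union_le _ _ _
    _ = _ := by
        simp only [restrict_Ioo_eq_restrict_Icc] at h2 h3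
        rw [h2, h3]

/-- The triangle inequality for the lifted distance. -/
theorem liftedDist_trans_le (g : PiecewiseRiemannianMetric K) {x y z : Space K}
    (c : Path.Homotopic.Quotient x y) (c' : Path.Homotopic.Quotient y z) :
    liftedDist g x ⟨z, c.trans c'⟩ ≤ liftedDist g x ⟨y, c⟩ + liftedDist g y ⟨z, c'⟩ := by
  simp only [liftedDist, ENNReal.iInf_add, ENNReal.add_iInf]
  refine le_iInf fun γ' => le_iInf fun hγ' => le_iInf fun hc' => le_iInf fun γ => le_iInf fun hγ =>
    le_iInf fun hc => ?_
  refine (iInf_le _ (γ.trans γ')).trans ((iInf_le _ (hγ.trans hγ')).trans ((iInf_le _ ?_).trans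
    (pathLength_trans_le g γ γ')))
  rw [Path.Homotopic.Quotient.mk_trans, hc, hc']

theorem liftedDist_mk_le (g : PiecewiseRiemannianMetric K) {x y : Space K} {γ : Path x y}
    (hγ : IsPiecewiseC1 γ) :
    liftedDist g x ⟨y, Path.Homotopic.Quotient.mk γ⟩ ≤ pathLength g γ :=
  (iInf_le _ γ).trans ((iInf_le _ hγ).trans (iInf_le _ rfl))

theorem exists_path_of_liftedDist_lt (g : PiecewiseRiemannianMetric K) {x y : Space K}
    {c : Path.Homotopic.Quotient x y} {r : ℝ≥0∞} (h : liftedDist g x ⟨y, c⟩ < r) :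
    ∃ γ : Path x y, IsPiecewiseC1 γ ∧ Path.Homotopic.Quotient.mk γ = c ∧ pathLength g γ < r := by
  simp only [liftedDist, iInf_lt_iff] at h
  obtain ⟨γ, hγ, hc, hl⟩ := h
  exact ⟨γ, hγ, hc, hl⟩

end PiecewiseC1

/-! ### Bounds for piecewise Riemannian metrics -/

section Bounds

variable {V : Type*} [Fintype V] {K : AbstractSimplicialComplex V}

theorem sub_mem_tangentSpace {s : Finset V} {x y : V → ℝ} (hx : x ∈ closedSimplex s)
    (hy : y ∈ closedSimplex s) : y - x ∈ tangentSpace s :=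
  ⟨fun v hv => by simp [hx.2 v hv, hy.2 v hv], by simp [hx.1.2, hy.1.2]⟩

theorem smul_mem_tangentSpace {s : Finset V} {w : V → ℝ} (hw : w ∈ tangentSpace s) (r : ℝ) :
    r • w ∈ tangentSpace s :=
  ⟨fun v hv => by simp [hw.1 v hv], by simp [← Finset.mul_sum, hw.2]⟩

open Classical in
theorem edgeVector_mem_tangentSpace {s : Finset V} {b v : V} (hb : b ∈ s) (hv : v ∈ s) :
    edgeVector b v ∈ tangentSpace s := by
  refine ⟨fun w hw => ?_, by simp [edgeVector]⟩
  have h1 : w ≠ v := fun h => hw (h ▸ hv)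
  have h2 : w ≠ b := fun h => hw (h ▸ hb)
  simp [edgeVector, h1, h2]

theorem sum_chartIndex {s : Finset V} {b : V} (hb : b ∈ s) {M : Type*} [AddCommGroup M] (f : V → M)
    (hf : ∀ v, v ∉ s → f v = 0) : ∑ v : ChartIndex s b, f v.1 = ∑ v, f v - f b := by
  classical
  have h1 : ∑ v : ChartIndex s b, f v.1 = ∑ v ∈ s.erase b, f v := by
    refine Finset.sum_bij (fun v _ => v.1) (fun v _ => ?_) (fun v _ w _ h => Subtype.ext h)
      (fun v hv => ?_) (fun _ _ => rfl)
    · exact Finset.mem_erase.mpr ⟨v.2.2, v.2.1⟩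
    · rw [Finset.mem_erase] at hv
      exact ⟨⟨v, hv.2, hv.1⟩, Finset.mem_univ _, rfl⟩
  rw [h1, eq_sub_iff_add_eq, Finset.sum_erase_add _ _ hb]
  exact Finset.sum_subset (Finset.subset_univ s) fun v _ hv => hf v hv

open Classical in
/-- A tangent vector in terms of the edge vectors at a vertex. -/
theorem eq_sum_edgeVector {s : Finset V} {b : V} (hb : b ∈ s) {w : V → ℝ}
    (hw : w ∈ tangentSpace s) : w = ∑ v : ChartIndex s b, w v.1 • edgeVector b v.1 := by
  have h := sum_chartIndex hb (fun v => w v • edgeVector b v) fun v hv => by simp [hw.1 v hv]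
  rw [h]
  have h1 : edgeVector b b = (0 : V → ℝ) := by simp [edgeVector]
  rw [h1, smul_zero, sub_zero]
  simp only [edgeVector, smul_sub, Finset.sum_sub_distrib, ← Finset.sum_smul, hw.2, zero_smul,
    sub_zero]
  funext u
  simp [Finset.sum_apply, Pi.single_apply]

variable (g : PiecewiseRiemannianMetric K)

open Classical in
theorem form_self_eq_sum {s : Finset V} {b : V} (hb : b ∈ s)
    (x : V → ℝ) {w : V → ℝ} (hw : w ∈ tangentSpace s) :
    g.form s x w w = ∑ u : ChartIndex s b, ∑ v : ChartIndex s b,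
      w u.1 * (w v.1 * g.form s x (edgeVector b u.1) (edgeVector b v.1)) := by
  conv_lhs => rw [eq_sum_edgeVector hb hw]
  simp only [map_sum, LinearMap.sum_apply, map_smul, LinearMap.smul_apply, smul_eq_mul,
    Finset.mul_sum]
  rw [Finset.sum_comm]
  exact Finset.sum_congr rfl fun u _ => Finset.sum_congr rfl fun v _ => by ring

/-- The metric is bounded above by a multiple of the squared norm. -/
theorem exists_form_le : ∃ M : ℝ, 0 ≤ M ∧ ∀ s ∈ K.faces, ∀ x ∈ closedSimplex s,
    ∀ w ∈ tangentSpace s, g.form s x w w ≤ M * ‖w‖ ^ 2 := by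
  classical
  have key : ∀ s : Finset V, ∃ M : ℝ, 0 ≤ M ∧ (s ∈ K.faces → ∀ x ∈ closedSimplex s,
      ∀ w ∈ tangentSpace s, g.form s x w w ≤ M * ‖w‖ ^ 2) := by
    intro s
    by_cases hs : s ∈ K.faces
    swap
    · exact ⟨0, le_rfl, fun h => absurd h hs⟩
    obtain ⟨b, hb⟩ := face_nonempty hs
    have hC : ∀ u v : ChartIndex s b, ∃ C : ℝ, ∀ x ∈ closedSimplex s,
        |g.form s x (edgeVector b u.1) (edgeVector b v.1)| ≤ C := by
      intro u v
      obtain ⟨C, hC⟩ := (isCompact_closedSimplex s).exists_bound_of_continuousOn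
        (g.smooth s hs _ (edgeVector_mem_tangentSpace hb u.2.1) _
          (edgeVector_mem_tangentSpace hb v.2.1)).continuousOn
      exact ⟨C, fun x hx => hC x hx⟩
    choose C hC using hC
    refine ⟨∑ u, ∑ v, |C u v|, Finset.sum_nonneg fun u _ => Finset.sum_nonneg fun v _ => abs_nonneg (C u v), fun _ x hx w hw => ?_⟩
    rw [form_self_eq_sum g hb x hw, Finset.sum_mul]
    refine Finset.sum_le_sum fun u _ => ?_
    rw [Finset.sum_mul]
    refine Finset.sum_le_sum fun v _ => ?_
    refine (le_abs_self _).trans ?_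
    rw [abs_mul, abs_mul]
    have h1 : |w u.1| ≤ ‖w‖ := norm_le_pi_norm w u.1
    have h2 : |w v.1| ≤ ‖w‖ := norm_le_pi_norm w v.1
    have h3 := (hC u v x hx).trans (le_abs_self _)
    have h4 : |w u.1| * |w v.1| ≤ ‖w‖ * ‖w‖ := by gcongr
    calc _ ≤ |w u.1| * (|w v.1| * |C u v|) := by gcongr
      _ = |w u.1| * |w v.1| * |C u v| := by ring
      _ ≤ ‖w‖ * ‖w‖ * |C u v| := by gcongr
      _ = _ := by ring
  choose M hM0 hM using key
  refine ⟨∑ s, M s, Finset.sum_nonneg fun s _ => hM0 s, fun s hs x hx w hw => ?_⟩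
  refine (hM s hs x hx w hw).trans (mul_le_mul_of_nonneg_right ?_ (by positivity))
  exact Finset.single_le_sum (f := M) (fun s _ => hM0 s) (Finset.mem_univ s)

theorem curve_segPath {s : Finset V} (hs : s ∈ K.faces) {x y : Space K}
    (hx : (x : V → ℝ) ∈ closedSimplex s) (hy : (y : V → ℝ) ∈ closedSimplex s) {t : ℝ}
    (ht : t ∈ Set.Icc (0 : ℝ) 1) :
    curve (segPath hs x y hx hy) t = (x : V → ℝ) + t • ((y : V → ℝ) - x) := by
  simp only [curve]
  rw [Path.extend_apply _ ht, coe_segPath]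
  simp [AffineMap.lineMap_apply, add_comm]

theorem deriv_curve_segPath {s : Finset V} (hs : s ∈ K.faces) {x y : Space K}
    (hx : (x : V → ℝ) ∈ closedSimplex s) (hy : (y : V → ℝ) ∈ closedSimplex s) {t : ℝ}
    (ht : t ∈ Set.Ioo (0 : ℝ) 1) :
    deriv (curve (segPath hs x y hx hy)) t = (y : V → ℝ) - x := by
  have : curve (segPath hs x y hx hy) =ᶠ[𝓝 t] fun u => (x : V → ℝ) + u • ((y : V → ℝ) - x) := by
    filter_upwards [isOpen_Ioo.mem_nhds ht] with u hu
    exact curve_segPath hs hx hy (Set.Ioo_subset_Icc_self hu)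
  rw [this.deriv_eq]
  have h := ((hasDerivAt_id t).smul_const ((y : V → ℝ) - x)).const_add (x : V → ℝ)
  simpa using h.deriv

theorem isPiecewiseC1_segPath {s : Finset V} (hs : s ∈ K.faces) {x y : Space K}
    (hx : (x : V → ℝ) ∈ closedSimplex s) (hy : (y : V → ℝ) ∈ closedSimplex s) :
    IsPiecewiseC1 (segPath hs x y hx hy) := by
  rw [isPiecewiseC1_iff]
  refine ⟨∅, Set.finite_empty, fun a b ha _ hb _ => ?_⟩
  have hsub : Set.Icc a b ⊆ Set.Icc (0 : ℝ) 1 := Set.Icc_subset_Icc ha hb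
  refine ⟨⟨s, hs, fun t ht => ?_⟩, ?_⟩
  · simp only [curve]
    rw [Path.extend_apply _ (hsub ht), coe_segPath]
    exact lineMap_mem_closedSimplex hx hy (hsub ht)
  · exact ContDiffOn.congr (by fun_prop) fun t ht => curve_segPath hs hx hy (hsub ht)

theorem norm_sub_le_one {x y : V → ℝ} (hx : x ∈ stdSimplex ℝ V) (hy : y ∈ stdSimplex ℝ V) :
    ‖y - x‖ ≤ 1 := by
  refine (pi_norm_le_iff_of_nonneg zero_le_one).mpr fun v => ?_
  have h1 : ∀ z ∈ stdSimplex ℝ V, 0 ≤ z v ∧ z v ≤ 1 := fun z hz =>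
    ⟨hz.1 v, hz.2 ▸ Finset.single_le_sum (fun u _ => hz.1 u) (Finset.mem_univ v)⟩
  rw [Pi.sub_apply, Real.norm_eq_abs, abs_le]
  constructor <;> linarith [(h1 x hx).1, (h1 x hx).2, (h1 y hy).1, (h1 y hy).2]

/-- The direction of a segment is tangent to the carriers of its interior points. -/
theorem sub_mem_tangentSpace_carrier {s : Finset V} {x y : V → ℝ} (hx : x ∈ closedSimplex s)
    (hy : y ∈ closedSimplex s) {t : ℝ} (ht : t ∈ Set.Ioo (0 : ℝ) 1) :
    y - x ∈ tangentSpace (carrier (x + t • (y - x))) := by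
  refine ⟨fun v hv => ?_, (sub_mem_tangentSpace hx hy).2⟩
  have h0 : (x + t • (y - x)) v = 0 := by by_contra h; exact hv (mem_carrier.mpr h)
  -- A vanishing convex combination of non-negative numbers with positive weights has only vanishing
  -- terms.
  have h0' : (1 - t) * x v + t * y v = 0 := by
    rw [← h0]; simp; ring
  have h5 := mul_nonneg (sub_pos.mpr ht.2).le (hx.1.1 v)
  have h6 := mul_nonneg ht.1.le (hy.1.1 v)
  have h9 := (mul_eq_zero.mp (by linarith : (1 - t) * x v = 0)).resolve_left (sub_pos.mpr ht.2).ne'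
  have h10 := (mul_eq_zero.mp (by linarith : t * y v = 0)).resolve_left ht.1.ne'
  simp [h9, h10]

/-- The segments in closed simplices have uniformly bounded lengths. -/
theorem exists_pathLength_segPath_le : ∃ D : ℝ, 0 ≤ D ∧ ∀ (s : Finset V) (hs : s ∈ K.faces)
    (x y : Space K) (hx : (x : V → ℝ) ∈ closedSimplex s) (hy : (y : V → ℝ) ∈ closedSimplex s),
    pathLength g (segPath hs x y hx hy) ≤ ENNReal.ofReal D := by
  obtain ⟨M, hM0, hM⟩ := exists_form_le g
  refine ⟨Real.sqrt M, Real.sqrt_nonneg _, fun s hs x y hx hy => ?_⟩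
  -- The end points are discarded, as `deriv` there also sees the constant extension of the path.
  rw [pathLength_eq_lintegral_speed, ← restrict_Ioo_eq_restrict_Icc]
  calc ∫⁻ t in Set.Ioo (0 : ℝ) 1, speed g (curve (segPath hs x y hx hy)) t
      ≤ ∫⁻ _ in Set.Ioo (0 : ℝ) 1, ENNReal.ofReal (Real.sqrt M) := by
        refine setLIntegral_mono' measurableSet_Ioo fun t ht => ?_
        refine ENNReal.ofReal_le_ofReal (Real.sqrt_le_sqrt ?_)
        rw [deriv_curve_segPath hs hx hy ht, curve_segPath hs hx hy (Set.Ioo_subset_Icc_self ht)]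
        set z : V → ℝ := (x : V → ℝ) + t • ((y : V → ℝ) - x) with hz
        have hzs : z ∈ closedSimplex s := by
          have := (segPath hs x y hx hy ⟨t, Set.Ioo_subset_Icc_self ht⟩).2
          have h1 := lineMap_mem_closedSimplex hx hy (Set.Ioo_subset_Icc_self ht)
          rwa [AffineMap.lineMap_apply, vsub_eq_sub, vadd_eq_add, add_comm] at h1
        have htan : (y : V → ℝ) - x ∈ tangentSpace (carrier z) :=
          sub_mem_tangentSpace_carrier hx hy ht
        have hzr := mem_realization_iff.mp (closedSimplex_subset_realization hs hzs)
        refine (hM _ hzr.2 z (mem_closedSimplex_carrier hzr.1) _ htan).trans ?_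
        have h1 := norm_sub_le_one hx.1 hy.1
        have h2 := norm_nonneg ((y : V → ℝ) - x)
        calc M * ‖(y : V → ℝ) - x‖ ^ 2 ≤ M * 1 ^ 2 := by gcongr
          _ = M := by ring
    _ = ENNReal.ofReal (Real.sqrt M) := by simp

/-- In a connected complex, any two points are joined by paths of bounded length. -/
theorem exists_liftedDist_le [PathConnectedSpace (Space K)] : ∃ D : ℝ, 0 ≤ D ∧ ∀ x y : Space K,
    ∃ c : Path.Homotopic.Quotient x y, liftedDist g x ⟨y, c⟩ ≤ ENNReal.ofReal D := by
  classical
  obtain ⟨D₀, hD₀, hseg⟩ := exists_pathLength_segPath_le g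
  have hseg' : ∀ (s : Finset V) (_ : s ∈ K.faces) (x y : Space K)
      (_ : (x : V → ℝ) ∈ closedSimplex s) (_ : (y : V → ℝ) ∈ closedSimplex s),
      ∃ c : Path.Homotopic.Quotient x y, liftedDist g x ⟨y, c⟩ ≤ ENNReal.ofReal D₀ :=
    fun s hs x y hx hy => ⟨_, (liftedDist_mk_le g (isPiecewiseC1_segPath hs hx hy)).trans
      (hseg s hs x y hx hy)⟩
  have hmem : ∀ (x : Space K) (w : V), w ∈ carrier (x : V → ℝ) →
      (vertexPoint K w : V → ℝ) ∈ closedSimplex (carrier (x : V → ℝ)) ∧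
      (x : V → ℝ) ∈ closedSimplex (carrier (x : V → ℝ)) ∧ carrier (x : V → ℝ) ∈ K.faces :=
    fun x w hw => ⟨single_mem_closedSimplex hw,
      mem_closedSimplex_carrier (mem_realization_iff.mp x.2).1, (mem_realization_iff.mp x.2).2⟩
  -- Finiteness for each pair of points comes from path-connectedness: inside the star of a vertex,
  -- two points are joined by segments through that vertex.
  have hfin : ∀ x y : Space K, ∃ c : Path.Homotopic.Quotient x y, liftedDist g x ⟨y, c⟩ < ⊤ := by
    intro x y
    refine class_induction (U := fun w : V => {z : Space K | w ∈ carrier (z : V → ℝ)}) ?_ ?_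
      (P := fun x y _ => ∃ c : Path.Homotopic.Quotient x y, liftedDist g x ⟨y, c⟩ < ⊤) ?_ ?_
      (Path.Homotopic.Quotient.mk (PathConnectedSpace.somePath x y))
    · intro w
      have : {z : Space K | w ∈ carrier (z : V → ℝ)} = {z : Space K | (z : V → ℝ) w ≠ 0} := by
        ext z; exact mem_carrier
      rw [this]
      exact isOpen_ne_fun ((continuous_apply w).comp continuous_subtype_val) continuous_const
    · intro z
      exact carrier_nonempty (mem_realization_iff.mp z.2).1
    · rintro x y z _ _ ⟨c, hc⟩ ⟨c', hc'⟩
      exact ⟨c.trans c', (liftedDist_trans_le g c c').trans_lt (ENNReal.add_lt_top.mpr ⟨hc, hc'⟩)⟩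
    · intro w x y p hp
      have hx : w ∈ carrier (x : V → ℝ) := by have := hp 0; rwa [p.source] at this
      have hy : w ∈ carrier (y : V → ℝ) := by have := hp 1; rwa [p.target] at this
      obtain ⟨hx1, hx2, hx3⟩ := hmem x w hx
      obtain ⟨hy1, hy2, hy3⟩ := hmem y w hy
      obtain ⟨c, hc⟩ := hseg' _ hx3 x _ hx2 hx1
      obtain ⟨c', hc'⟩ := hseg' _ hy3 _ y hy1 hy2
      exact ⟨c.trans c', (liftedDist_trans_le g c c').trans_lt (ENNReal.add_lt_top.mpr
        ⟨hc.trans_lt ENNReal.ofReal_lt_top, hc'.trans_lt ENNReal.ofReal_lt_top⟩)⟩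
  choose c hc using fun v w : V => hfin (vertexPoint K v) (vertexPoint K w)
  -- A uniform bound is needed only for the finitely many pairs of vertices. Other points reach a
  -- vertex of their carrier by a segment of length at most `D₀`.
  let D₁ : ℝ := ∑ v, ∑ w, (liftedDist g (vertexPoint K v) ⟨vertexPoint K w, c v w⟩).toReal
  have hD₁ : ∀ v w, liftedDist g (vertexPoint K v) ⟨vertexPoint K w, c v w⟩ ≤ ENNReal.ofReal D₁ := by
    intro v w
    rw [← ENNReal.ofReal_toReal (hc v w).ne]
    refine ENNReal.ofReal_le_ofReal ?_
    refine le_trans ?_ (Finset.single_le_sum (fun v _ => Finset.sum_nonneg fun w _ =>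
      ENNReal.toReal_nonneg) (Finset.mem_univ v))
    exact Finset.single_le_sum (f := fun w =>
      (liftedDist g (vertexPoint K v) ⟨vertexPoint K w, c v w⟩).toReal)
      (fun w _ => ENNReal.toReal_nonneg) (Finset.mem_univ w)
  have hD₁0 : 0 ≤ D₁ := Finset.sum_nonneg fun v _ => Finset.sum_nonneg fun w _ =>
    ENNReal.toReal_nonneg
  refine ⟨D₀ + (D₁ + D₀), by positivity, fun x y => ?_⟩
  obtain ⟨v, hv⟩ := carrier_nonempty (mem_realization_iff.mp x.2).1
  obtain ⟨w, hw⟩ := carrier_nonempty (mem_realization_iff.mp y.2).1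
  obtain ⟨hx1, hx2, hx3⟩ := hmem x v hv
  obtain ⟨hy1, hy2, hy3⟩ := hmem y w hw
  obtain ⟨c₁, hc₁⟩ := hseg' _ hx3 x _ hx2 hx1
  obtain ⟨c₂, hc₂⟩ := hseg' _ hy3 _ y hy1 hy2
  refine ⟨c₁.trans ((c v w).trans c₂), (liftedDist_trans_le g _ _).trans ?_⟩
  rw [ENNReal.ofReal_add hD₀ (by positivity), ENNReal.ofReal_add hD₁0 hD₀]
  exact add_le_add hc₁ ((liftedDist_trans_le g _ _).trans (add_le_add (hD₁ v w) hc₂))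

/-- The number of points of a ball of the universal cover in a fiber. -/
def fiberCount (x₀ y : Space K) (t : ℝ) : ℝ≥0∞ :=
  ((Set.encard {c : Path.Homotopic.Quotient x₀ y |
    (⟨y, c⟩ : UniversalCover x₀) ∈ liftedBall g x₀ t} : ℕ∞) : ℝ≥0∞)

theorem liftedVolume_liftedBall (x₀ : Space K) (t : ℝ) :
    liftedVolume g x₀ (liftedBall g x₀ t) = ∫⁻ y, fiberCount g x₀ y t ∂(volumeMeasure g) := rfl

/-- Appending `c₀` injects the fiber over `y` into the fiber over `y'` and lengthens paths by at
most `D`. For `t ≤ 0` the ball is empty. -/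
theorem fiberCount_le {D : ℝ} (hD : 0 ≤ D) (x₀ : Space K) {y y' : Space K} (t : ℝ)
    {c₀ : Path.Homotopic.Quotient y y'} (hc₀ : liftedDist g y ⟨y', c₀⟩ ≤ ENNReal.ofReal D) :
    fiberCount g x₀ y t ≤ fiberCount g x₀ y' (t + D) := by
  refine ENat.toENNReal_le.mpr ?_
  refine Set.encard_le_encard_of_injOn (f := fun c => c.trans c₀) (fun c hc => ?_)
    (fun c _ c' _ h => trans_right_cancel h)
  have hc' : liftedDist g x₀ ⟨y, c⟩ < ENNReal.ofReal t := hc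
  have ht : 0 < t := by
    by_contra h
    rw [ENNReal.ofReal_of_nonpos (not_lt.mp h)] at hc'
    exact absurd hc' (not_lt.mpr zero_le)
  change liftedDist g x₀ ⟨y', c.trans c₀⟩ < ENNReal.ofReal (t + D)
  rw [ENNReal.ofReal_add ht.le hD]
  exact (liftedDist_trans_le g c c₀).trans_lt
    (ENNReal.add_lt_add_of_lt_of_le (hc₀.trans_lt ENNReal.ofReal_lt_top).ne hc' hc₀)

/-- In a connected complex, the number of points of a ball in a fiber is controlled by the volume
of a slightly larger ball. -/
theorem exists_fiberCount_mul_totalVolume_le [PathConnectedSpace (Space K)] : ∃ D : ℝ, 0 ≤ D ∧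
    ∀ (x₀ y : Space K) (t : ℝ), fiberCount g x₀ y t * totalVolume g ≤
      liftedVolume g x₀ (liftedBall g x₀ (t + D)) := by
  obtain ⟨D, hD, h⟩ := exists_liftedDist_le g
  refine ⟨D, hD, fun x₀ y t => ?_⟩
  rw [liftedVolume_liftedBall, totalVolume, ← lintegral_const]
  refine lintegral_mono fun y' => ?_
  obtain ⟨c, hc⟩ := h y y'
  exact fiberCount_le g hD x₀ t hc

end Bounds

/-! ### Piecewise affine maps along segments -/

section Pieces

variable {V W : Type*} [Fintype V] [Fintype W] {K : AbstractSimplicialComplex V}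
  {L : AbstractSimplicialComplex W}

theorem PLMap.exists_pieces (F : PLMap K L) : ∃ S : Set (AffineFn V), S.Finite ∧ 0 ∈ S ∧
    ∀ w y, ∃ A ∈ S, F.toFun y w = A.eval y := by
  choose S hS h using fun w => (F.piecewiseAffine w).2
  refine ⟨insert 0 (⋃ w, S w), (Set.finite_iUnion hS).insert 0, Set.mem_insert _ _, fun w y => ?_⟩
  obtain ⟨A, hA, hy⟩ := h w y
  exact ⟨A, Or.inr (Set.mem_iUnion.mpr ⟨w, hA⟩), hy⟩

/-- A finite set of affine functions, containing zero, among which all coordinates of `F` are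
selected. -/
def PLMap.pieces (F : PLMap K L) : Set (AffineFn V) := F.exists_pieces.choose

theorem PLMap.finite_pieces (F : PLMap K L) : F.pieces.Finite := F.exists_pieces.choose_spec.1

theorem PLMap.zero_mem_pieces (F : PLMap K L) : 0 ∈ F.pieces := F.exists_pieces.choose_spec.2.1

theorem PLMap.exists_mem_pieces (F : PLMap K L) (w : W) (y : V → ℝ) :
    ∃ A ∈ F.pieces, F.toFun y w = A.eval y := F.exists_pieces.choose_spec.2.2 w y

theorem AffineFn.eval_add_smul {U : Type*} (A : AffineFn U) (p v : U → ℝ) (t : ℝ) :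
    A.eval (p + t • v) = A.eval p + t * A.1 v := by
  simp only [AffineFn.eval_def, map_add, map_smul, smul_eq_mul]; ring

/-- Along a line, the coordinates of a piecewise affine map are affine outside finitely many
parameters. -/
theorem PLMap.exists_breaks (F : PLMap K L) (p v : V → ℝ) : ∃ B : Set ℝ, B.Finite ∧
    ∀ a b, a < b → (∀ t ∈ Set.Ioo a b, t ∉ B) → (∀ t ∈ Set.Icc a b, p + t • v ∈ realization K) →
      ∃ A : W → AffineFn V, (∀ w, A w ∈ F.pieces) ∧
        (∀ t ∈ Set.Icc a b, ∀ w, F.toFun (p + t • v) w = (A w).eval (p + t • v)) ∧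
        ∃ T ∈ L.faces, (∀ t ∈ Set.Ioo a b, carrier (F.toFun (p + t • v)) = T) ∧
          (∀ t ∈ Set.Icc a b, F.toFun (p + t • v) ∈ closedSimplex T) ∧
          (fun w => (A w).1 v) ∈ tangentSpace T := by
  -- `Z` collects the crossing parameters of two pieces which differ somewhere on the line. Two
  -- distinct affine functions of one variable agree at most once.
  let Z : AffineFn V × AffineFn V → Set ℝ := fun P =>
    {t : ℝ | P.1.eval (p + t • v) = P.2.eval (p + t • v) ∧
      ∃ t' : ℝ, P.1.eval (p + t' • v) ≠ P.2.eval (p + t' • v)}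
  have hZ : ∀ P, (Z P).Finite := by
    intro P
    refine Set.Subsingleton.finite ?_
    rintro t ⟨ht, t', ht'⟩ u ⟨hu, -⟩
    simp only [AffineFn.eval_add_smul] at ht hu ht'
    by_contra hne
    have h1 : (t - u) * (P.1.1 v - P.2.1 v) = 0 := by linarith
    have h2 := (mul_eq_zero.mp h1).resolve_left (sub_ne_zero.mpr hne)
    have h3 : P.1.1 v = P.2.1 v := by linarith
    apply ht'
    rw [h3] at ht ⊢
    linarith
  have hcont : ∀ w, Continuous fun t : ℝ => F.toFun (p + t • v) w := fun w =>
    (F.piecewiseAffine w).1.comp (by fun_prop)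
  have hcontA : ∀ A : AffineFn V, Continuous fun t : ℝ => A.eval (p + t • v) := fun A =>
    A.continuous.comp (by fun_prop)
  refine ⟨⋃ P ∈ F.pieces ×ˢ F.pieces, Z P,
    (F.finite_pieces.prod F.finite_pieces).biUnion fun P _ => hZ P, fun a b hab hB hr => ?_⟩
  have hdich : ∀ A ∈ F.pieces, ∀ A' ∈ F.pieces, ∀ t ∈ Set.Ioo a b,
      A.eval (p + t • v) = A'.eval (p + t • v) →
      ∀ t' : ℝ, A.eval (p + t' • v) = A'.eval (p + t' • v) := by
    intro A hA A' hA' t ht h t'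
    by_contra hne
    exact hB t ht (Set.mem_biUnion (x := (A, A')) ⟨hA, hA'⟩ ⟨h, t', hne⟩)
  have hsel : ∀ w, ∃ A ∈ F.pieces, ∀ t ∈ Set.Icc a b, F.toFun (p + t • v) w = A.eval (p + t • v) := by
    intro w
    obtain ⟨m, hm⟩ : (Set.Ioo a b).Nonempty := Set.nonempty_Ioo.mpr hab
    obtain ⟨A, hA, hAm⟩ := F.exists_mem_pieces w (p + m • v)
    refine ⟨A, hA, ?_⟩
    have hclosed : IsClosed {t : ℝ | F.toFun (p + t • v) w = A.eval (p + t • v)} :=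
      isClosed_eq (hcont w) (hcontA A)
    -- The parameters at which the piece `A` is selected are both open and closed in the interval.
    -- They are open because a competing piece either agrees with `A` on the whole line or differs
    -- from `F` nearby.
    have hIoo : Set.Ioo a b ⊆ {t : ℝ | F.toFun (p + t • v) w = A.eval (p + t • v)} ∩ Set.Ioo a b := by
      refine isPreconnected_Ioo.subset_of_closure_inter_subset ?_ ⟨m, hm, hAm, hm⟩ ?_
      · rw [isOpen_iff_mem_nhds]
        rintro t ⟨ht, htI⟩
        have h1 : ∀ A' ∈ F.pieces, ∀ᶠ u in 𝓝 t, F.toFun (p + u • v) w = A'.eval (p + u • v) →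
            F.toFun (p + u • v) w = A.eval (p + u • v) := by
          intro A' hA'
          by_cases h : A.eval (p + t • v) = A'.eval (p + t • v)
          · exact Eventually.of_forall fun u hu => hu.trans (hdich A hA A' hA' t htI h u).symm
          · have hne : F.toFun (p + t • v) w ≠ A'.eval (p + t • v) := by
              rw [Set.mem_ofPred_eq] at ht; rwa [ht]
            filter_upwards [((hcont w).continuousAt.ne_iff_eventually_ne
              (hcontA A').continuousAt).mp hne] with u hu hu'
            exact absurd hu' hu
        have h2 := (Set.Finite.eventually_all F.finite_pieces).mpr h1
        filter_upwards [h2, isOpen_Ioo.mem_nhds htI] with u hu huI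
        obtain ⟨A', hA', hu'⟩ := F.exists_mem_pieces w (p + u • v)
        exact ⟨hu A' hA' hu', huI⟩
      · rintro t ⟨ht, htI⟩
        exact ⟨hclosed.closure_subset_iff.mpr Set.inter_subset_left ht, htI⟩
    have h := hclosed.closure_subset_iff.mpr (hIoo.trans Set.inter_subset_left)
    rw [closure_Ioo hab.ne] at h
    exact h
  choose A hA hAF using hsel
  refine ⟨A, hA, fun t ht w => hAF w t ht, ?_⟩
  obtain ⟨m, hm⟩ : (Set.Ioo a b).Nonempty := Set.nonempty_Ioo.mpr hab
  have hFm := mem_realization_iff.mp (F.mem _ (hr m (Set.Ioo_subset_Icc_self hm)))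
  have hcar : ∀ t ∈ Set.Ioo a b,
      carrier (F.toFun (p + t • v)) = carrier (F.toFun (p + m • v)) := by
    intro t ht
    ext w
    rw [mem_carrier, mem_carrier, hAF w t (Set.Ioo_subset_Icc_self ht),
      hAF w m (Set.Ioo_subset_Icc_self hm), not_iff_not]
    -- The zero function is among the pieces, so vanishing of a coordinate cannot change between
    -- breaks either. This makes the carrier of the image constant.
    have h0 : ∀ u : ℝ, AffineFn.eval (0 : AffineFn V) (p + u • v) = 0 := fun u => by
      simp [AffineFn.eval_def]
    constructor
    · intro h
      exact (hdich (A w) (hA w) 0 F.zero_mem_pieces t ht (h.trans (h0 t).symm) m).trans (h0 m)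
    · intro h
      exact (hdich (A w) (hA w) 0 F.zero_mem_pieces m hm (h.trans (h0 m).symm) t).trans (h0 t)
  have hIoo : ∀ t ∈ Set.Ioo a b, F.toFun (p + t • v) ∈ closedSimplex (carrier (F.toFun (p + m • v))) := by
    intro t ht
    rw [← hcar t ht]
    exact mem_closedSimplex_carrier
      (mem_realization_iff.mp (F.mem _ (hr t (Set.Ioo_subset_Icc_self ht)))).1
  refine ⟨_, hFm.2, hcar, ?_, ?_⟩
  · have hcl : IsClosed {t : ℝ | F.toFun (p + t • v) ∈ closedSimplex (carrier (F.toFun (p + m • v)))} :=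
      (isClosed_closedSimplex _).preimage (F.continuous.comp (by fun_prop))
    have h := closure_minimal (s := Set.Ioo a b) hIoo hcl
    rw [closure_Ioo hab.ne] at h
    exact h
  · obtain ⟨m', hm'⟩ : (Set.Ioo m b).Nonempty := Set.nonempty_Ioo.mpr hm.2
    have hm'I : m' ∈ Set.Ioo a b := ⟨hm.1.trans hm'.1, hm'.2⟩
    have hpos : m' - m ≠ 0 := (sub_pos.mpr hm'.1).ne'
    have h1 := smul_mem_tangentSpace (sub_mem_tangentSpace (hIoo m hm) (hIoo m' hm'I)) (m' - m)⁻¹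
    convert h1 using 1
    funext w
    simp only [Pi.smul_apply, Pi.sub_apply, smul_eq_mul]
    rw [hAF w m (Set.Ioo_subset_Icc_self hm), hAF w m' (Set.Ioo_subset_Icc_self hm'I),
      AffineFn.eval_add_smul, AffineFn.eval_add_smul]
    field_simp
    ring

/-- The condition that the derivative of `F` does not increase lengths, formulated in terms of
all possible affine selections. -/
def IsNonexpanding (F : PLMap K L) (h : PiecewiseRiemannianMetric K)
    (g : PiecewiseRiemannianMetric L) : Prop :=
  ∀ y ∈ realization K, ∀ v ∈ tangentSpace (carrier y), ∀ A : W → AffineFn V,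
    (∀ w, A w ∈ F.pieces) → (∀ w, F.toFun y w = (A w).eval y) →
    (fun w => (A w).1 v) ∈ tangentSpace (carrier (F.toFun y)) →
    g.form (carrier (F.toFun y)) (F.toFun y) (fun w => (A w).1 v) (fun w => (A w).1 v) ≤
      h.form (carrier y) y v v

theorem curve_map (F : PLMap K L) {x y : Space K} (γ : Path x y) {t : ℝ} :
    curve (γ.map F.toContinuousMap.continuous) t = F.toFun (curve γ t) := rfl

/-- Between the finitely many breaks the image of a segment is affine, and `IsNonexpanding` compares
the two speeds there. For a general `C¹` path this fails, as it may cross walls of `F` infinitely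
often; hence the detour through segments. -/
theorem isPiecewiseC1_map_segPath (F : PLMap K L) {h : PiecewiseRiemannianMetric K}
    {g : PiecewiseRiemannianMetric L} (hF : IsNonexpanding F h g) {s : Finset V}
    (hs : s ∈ K.faces) {x y : Space K} (hx : (x : V → ℝ) ∈ closedSimplex s)
    (hy : (y : V → ℝ) ∈ closedSimplex s) :
    IsPiecewiseC1 ((segPath hs x y hx hy).map F.toContinuousMap.continuous) ∧
      pathLength g ((segPath hs x y hx hy).map F.toContinuousMap.continuous) ≤
        pathLength h (segPath hs x y hx hy) := by
  set v : V → ℝ := (y : V → ℝ) - x with hv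
  obtain ⟨B, hB, hbr⟩ := F.exists_breaks x v
  have hcurve : ∀ t ∈ Set.Icc (0 : ℝ) 1,
      curve ((segPath hs x y hx hy).map F.toContinuousMap.continuous) t =
        F.toFun ((x : V → ℝ) + t • v) := fun t ht => by
    rw [curve_map, curve_segPath hs hx hy ht]
  have hr : ∀ t ∈ Set.Icc (0 : ℝ) 1, (x : V → ℝ) + t • v ∈ realization K := fun t ht => by
    rw [← curve_segPath hs hx hy ht]
    exact Subtype.coe_prop _
  constructor
  · rw [isPiecewiseC1_iff]
    refine ⟨B, hB, fun a b ha hab hb hab' => ?_⟩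
    have hsub : Set.Icc a b ⊆ Set.Icc (0 : ℝ) 1 := Set.Icc_subset_Icc ha hb
    obtain ⟨A, -, hAF, T, hT, -, hTc, -⟩ := hbr a b hab hab' fun t ht => hr t (hsub ht)
    refine ⟨⟨T, hT, fun t ht => ?_⟩, ?_⟩
    · rw [hcurve t (hsub ht)]; exact hTc t ht
    · refine ContDiffOn.congr (f := fun t w => (A w).eval x + t * (A w).1 v) ?_ fun t ht => ?_
      · exact contDiffOn_pi.mpr fun w => by fun_prop
      · rw [hcurve t (hsub ht)]
        funext w
        rw [hAF t ht w, AffineFn.eval_add_smul]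
  · simp only [pathLength_eq_lintegral_speed, ← restrict_Ioo_eq_restrict_Icc]
    refine lintegral_mono_ae ?_
    rw [ae_restrict_iff' measurableSet_Ioo]
    filter_upwards [hB.countable.ae_notMem volume] with t htB ht
    obtain ⟨ε, hε, hball⟩ := Metric.mem_nhds_iff.mp
      (Filter.inter_mem (hB.isClosed.isOpen_compl.mem_nhds htB) (isOpen_Ioo.mem_nhds ht))
    rw [Real.ball_eq_Ioo] at hball
    have hsub : Set.Icc (t - ε / 2) (t + ε / 2) ⊆ Set.Ioo (t - ε) (t + ε) := fun u hu =>
      ⟨by linarith [hu.1], by linarith [hu.2]⟩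
    have hI : Set.Icc (t - ε / 2) (t + ε / 2) ⊆ Set.Icc 0 1 := fun u hu =>
      Set.Ioo_subset_Icc_self (hball (hsub hu)).2
    obtain ⟨A, hA, hAF, T, hT, hTcar, -, hd⟩ := hbr (t - ε / 2) (t + ε / 2) (by linarith)
      (fun u hu => (hball (hsub (Set.Ioo_subset_Icc_self hu))).1) fun u hu => hr u (hI hu)
    have htI : t ∈ Set.Ioo (t - ε / 2) (t + ε / 2) := ⟨by linarith, by linarith⟩
    refine ENNReal.ofReal_le_ofReal (Real.sqrt_le_sqrt ?_)
    have hder : deriv (curve ((segPath hs x y hx hy).map F.toContinuousMap.continuous)) t =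
        fun w => (A w).1 v := by
      have he : curve ((segPath hs x y hx hy).map F.toContinuousMap.continuous) =ᶠ[𝓝 t]
          fun u w => (A w).eval x + u * (A w).1 v := by
        filter_upwards [isOpen_Ioo.mem_nhds htI] with u hu
        have huI := Set.Ioo_subset_Icc_self hu
        rw [hcurve u (hI huI)]
        funext w
        rw [hAF u huI w, AffineFn.eval_add_smul]
      rw [he.deriv_eq]
      refine HasDerivAt.deriv (hasDerivAt_pi.mpr fun w => ?_)
      simpa using ((hasDerivAt_id t).mul_const ((A w).1 v)).const_add ((A w).eval x)
    have htI' := Set.Ioo_subset_Icc_self htI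
    rw [hder, hcurve t (hI htI'), deriv_curve_segPath hs hx hy ht, curve_segPath hs hx hy (hI htI')]
    refine hF _ (hr t (hI htI')) v (sub_mem_tangentSpace_carrier hx hy ht) A hA
      (fun w => hAF t htI' w) ?_
    rw [hTcar t htI]
    exact hd

end Pieces

/-! ### Comparison of paths with segments -/

section Segments

variable {V : Type*} [Fintype V] {K : AbstractSimplicialComplex V}

theorem add_mem_tangentSpace {s : Finset V} {v w : V → ℝ} (hv : v ∈ tangentSpace s)
    (hw : w ∈ tangentSpace s) : v + w ∈ tangentSpace s :=
  ⟨fun u hu => by simp [hv.1 u hu, hw.1 u hu], by simp [Finset.sum_add_distrib, hv.2, hw.2]⟩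

/-- A metric is uniformly positive if it is bounded below by a multiple of the squared norm. -/
def IsUniformlyPositive (h : PiecewiseRiemannianMetric K) : Prop :=
  ∃ c : ℝ, 0 < c ∧ ∀ s ∈ K.faces, ∀ x ∈ closedSimplex s, ∀ v ∈ tangentSpace s,
    c * ‖v‖ ^ 2 ≤ h.form s x v v

theorem form_self_nonneg (g : PiecewiseRiemannianMetric K) {s : Finset V} (hs : s ∈ K.faces)
    {x : V → ℝ} (hx : x ∈ closedSimplex s) {v : V → ℝ} (hv : v ∈ tangentSpace s) :
    0 ≤ g.form s x v v := by
  rcases eq_or_ne v 0 with rfl | h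
  · simp
  · exact (g.pos s hs x hx v hv h).le

/-- The Cauchy–Schwarz inequality on the tangent space, obtained from the discriminant of the
non-negative quadratic polynomial `r ↦ g(v + r w, v + r w)`. -/
theorem form_le_sqrt_mul_sqrt (g : PiecewiseRiemannianMetric K) {s : Finset V} (hs : s ∈ K.faces)
    {x : V → ℝ} (hx : x ∈ closedSimplex s) {v w : V → ℝ} (hv : v ∈ tangentSpace s)
    (hw : w ∈ tangentSpace s) :
    |g.form s x v w| ≤ Real.sqrt (g.form s x v v) * Real.sqrt (g.form s x w w) := by
  rw [← Real.sqrt_mul (form_self_nonneg g hs hx hv)]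
  refine Real.abs_le_sqrt ?_
  have h : ∀ r : ℝ, 0 ≤ g.form s x w w * (r * r) + (2 * g.form s x v w) * r + g.form s x v v := by
    intro r
    have h1 := form_self_nonneg g hs hx (add_mem_tangentSpace hv (smul_mem_tangentSpace hw r))
    have h2 := g.symm s hs x hx v hv w hw
    simp only [map_add, map_smul, LinearMap.add_apply, LinearMap.smul_apply, smul_eq_mul] at h1
    rw [← h2] at h1
    linarith
  have := discrim_le_zero h
  rw [discrim] at this
  nlinarith

/-- Nearby inner products of a uniformly positive metric are comparable. -/
theorem IsUniformlyPositive.eventually_le {h : PiecewiseRiemannianMetric K}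
    (hpos : IsUniformlyPositive h) {s : Finset V} (hs : s ∈ K.faces) {x₀ : V → ℝ}
    (hx₀ : x₀ ∈ closedSimplex s) : ∀ᶠ x in 𝓝[closedSimplex s] x₀, ∀ w ∈ tangentSpace s,
      h.form s x w w ≤ 2 * h.form s x₀ w w ∧ h.form s x₀ w w ≤ 2 * h.form s x w w := by
  classical
  obtain ⟨c, hc, hpos⟩ := hpos
  obtain ⟨b, hb⟩ := face_nonempty hs
  set N : ℝ := (Fintype.card (ChartIndex s b) : ℝ) with hN
  have hN0 : 0 ≤ N := Nat.cast_nonneg _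
  -- An error of `η` in each of the `N * N` Gram entries changes the form by at most `c / 2 * ‖w‖ ^
  -- 2`, which is at most half of its value at `x₀`. The summand `1` keeps the denominator positive.
  set η : ℝ := c / (2 * (N * N + 1)) with hη
  have hη0 : 0 < η := by positivity
  have hev : ∀ u v : ChartIndex s b, ∀ᶠ x in 𝓝[closedSimplex s] x₀,
      |h.form s x (edgeVector b u.1) (edgeVector b v.1) -
        h.form s x₀ (edgeVector b u.1) (edgeVector b v.1)| < η := by
    intro u v
    have := (h.smooth s hs _ (edgeVector_mem_tangentSpace hb u.2.1) _
      (edgeVector_mem_tangentSpace hb v.2.1)).continuousOn x₀ hx₀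
    exact Metric.tendsto_nhds.mp this η hη0
  filter_upwards [eventually_all.mpr fun u => eventually_all.mpr fun v => hev u v] with x hx w hw
  have h1 : |h.form s x w w - h.form s x₀ w w| ≤ c / 2 * ‖w‖ ^ 2 := by
    rw [form_self_eq_sum h hb x hw, form_self_eq_sum h hb x₀ hw, ← Finset.sum_sub_distrib]
    refine (Finset.abs_sum_le_sum_abs _ _).trans ?_
    calc _ ≤ ∑ _u : ChartIndex s b, N * (‖w‖ ^ 2 * η) := by
          refine Finset.sum_le_sum fun u _ => ?_
          rw [← Finset.sum_sub_distrib]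
          refine (Finset.abs_sum_le_sum_abs _ _).trans ?_
          calc _ ≤ ∑ _v : ChartIndex s b, ‖w‖ ^ 2 * η := by
                refine Finset.sum_le_sum fun v _ => ?_
                rw [← mul_sub, ← mul_sub, abs_mul, abs_mul, ← mul_assoc, sq]
                have e1 : |w u.1| ≤ ‖w‖ := norm_le_pi_norm w u.1
                have e2 : |w v.1| ≤ ‖w‖ := norm_le_pi_norm w v.1
                gcongr
                exact (hx u v).le
            _ = N * (‖w‖ ^ 2 * η) := by simp [hN]
      _ = (N * N * η) * ‖w‖ ^ 2 := by simp [hN]; ring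
      _ ≤ c / 2 * ‖w‖ ^ 2 := by
          gcongr
          rw [hη, mul_div_assoc', div_le_div_iff₀ (by positivity) two_pos]
          nlinarith
  have h2 := hpos s hs x₀ hx₀ w hw
  rw [abs_le] at h1
  constructor <;> nlinarith [h1.1, h1.2]

theorem deriv_mem_tangentSpace {s : Finset V} {c : ℝ → (V → ℝ)} {a b t : ℝ}
    (hc : ∀ t ∈ Set.Icc a b, c t ∈ closedSimplex s) (hd : DifferentiableAt ℝ c t)
    (ht : t ∈ Set.Ioo a b) : deriv c t ∈ tangentSpace s := by
  have hv : ∀ v, HasDerivAt (fun u => c u v) (deriv c t v) t := hasDerivAt_pi.mp hd.hasDerivAt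
  have hnear : ∀ᶠ u in 𝓝 t, c u ∈ closedSimplex s := by
    filter_upwards [isOpen_Ioo.mem_nhds ht] with u hu using hc u (Set.Ioo_subset_Icc_self hu)
  constructor
  · intro v hvs
    have he : (fun u => c u v) =ᶠ[𝓝 t] fun _ => 0 := hnear.mono fun u hu => hu.2 v hvs
    exact (hv v).unique ((hasDerivAt_const t (0 : ℝ)).congr_of_eventuallyEq he)
  · have h1 : HasDerivAt (fun u => ∑ v, c u v) (∑ v, deriv c t v) t :=
      HasDerivAt.fun_sum fun v _ => hv v
    have he : (fun u => ∑ v, c u v) =ᶠ[𝓝 t] fun _ => 1 := hnear.mono fun u hu => hu.1.2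
    exact h1.unique ((hasDerivAt_const t (1 : ℝ)).congr_of_eventuallyEq he)

/-- Segments are shortest for a constant inner product. -/
theorem sqrt_form_sub_le_lintegral (g : PiecewiseRiemannianMetric K) {s : Finset V}
    (hs : s ∈ K.faces) {x₀ : V → ℝ} (hx₀ : x₀ ∈ closedSimplex s) {c : ℝ → (V → ℝ)} {a b : ℝ}
    (hab : a ≤ b) (hc : ∀ t ∈ Set.Icc a b, c t ∈ closedSimplex s)
    (hd : ContDiffOn ℝ 1 c (Set.Icc a b)) :
    ENNReal.ofReal (Real.sqrt (g.form s x₀ (c b - c a) (c b - c a))) ≤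
      ∫⁻ t in Set.Ioo a b,
        ENNReal.ofReal (Real.sqrt (g.form s x₀ (deriv c t) (deriv c t))) := by
  set Δ : V → ℝ := c b - c a with hΔ
  have hΔt : Δ ∈ tangentSpace s :=
    sub_mem_tangentSpace (hc a ⟨le_rfl, hab⟩) (hc b ⟨hab, le_rfl⟩)
  set N : ℝ := Real.sqrt (g.form s x₀ Δ Δ) with hN
  rcases (Real.sqrt_nonneg (g.form s x₀ Δ Δ)).eq_or_lt with h0 | h0
  · rw [hN, ← h0]; simp
  -- Pairing the curve with its total displacement `Δ` gives a scalar function which increases by `N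
  -- * N`, while its derivative is at most `N` times the speed. Cancelling `N` gives the claim.
  let φ : (V → ℝ) →ₗ[ℝ] ℝ := (g.form s x₀).flip Δ
  have hφc : Continuous φ := φ.continuous_of_finiteDimensional
  let φ' : (V → ℝ) →L[ℝ] ℝ := ⟨φ, hφc⟩
  have hdφ : ContDiffOn ℝ 1 (fun t => φ' (c t)) (Set.Icc a b) := φ'.contDiff.comp_contDiffOn hd
  have h1 := enorm_sub_le_lintegral_deriv_of_contDiffOn_Icc hdφ hab
  have hsub : φ' (c b) - φ' (c a) = N * N := by
    rw [← map_sub]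
    change g.form s x₀ Δ Δ = _
    rw [hN, Real.mul_self_sqrt (form_self_nonneg g hs hx₀ hΔt)]
  rw [hsub, Real.enorm_eq_ofReal (by positivity), ENNReal.ofReal_mul h0.le,
    ← restrict_Ioo_eq_restrict_Icc] at h1
  have h2 : ∫⁻ t in Set.Ioo a b, ‖deriv (fun t => φ' (c t)) t‖ₑ ≤
      ∫⁻ t in Set.Ioo a b, ENNReal.ofReal N *
        ENNReal.ofReal (Real.sqrt (g.form s x₀ (deriv c t) (deriv c t))) := by
    refine setLIntegral_mono' measurableSet_Ioo fun t ht => ?_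
    have hdt : DifferentiableAt ℝ c t :=
      (hd.differentiableOn one_ne_zero t (Set.Ioo_subset_Icc_self ht)).differentiableAt
        (Icc_mem_nhds ht.1 ht.2)
    have hder : deriv (fun t => φ' (c t)) t = φ' (deriv c t) :=
      (φ'.hasFDerivAt.comp_hasDerivAt t hdt.hasDerivAt).deriv
    rw [hder, ← ENNReal.ofReal_mul h0.le, mul_comm, Real.enorm_eq_ofReal_abs]
    exact ENNReal.ofReal_le_ofReal (form_le_sqrt_mul_sqrt g hs hx₀
      (deriv_mem_tangentSpace hc hdt ht) hΔt)
  rw [lintegral_const_mul' _ _ ENNReal.ofReal_ne_top] at h2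
  exact (ENNReal.mul_le_mul_iff_right (ENNReal.ofReal_pos.mpr h0).ne' ENNReal.ofReal_ne_top).mp
    (h1.trans h2)

/-- Near a given point, segments are at most twice as long as regular arcs with the same end
points. -/
theorem IsUniformlyPositive.eventually_pathLength_segPath_le {h : PiecewiseRiemannianMetric K}
    (hpos : IsUniformlyPositive h) (hind : ∀ s s' x, h.form s x = h.form s' x) {s : Finset V}
    (hs : s ∈ K.faces) {x₀ : V → ℝ} (hx₀ : x₀ ∈ closedSimplex s) :
    ∃ r : ℝ, 0 < r ∧ ∀ (c : ℝ → (V → ℝ)) (a b : ℝ) (x y : Space K) (_ : a ≤ b)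
      (hx : (x : V → ℝ) ∈ closedSimplex s) (hy : (y : V → ℝ) ∈ closedSimplex s),
      c a = x → c b = y → (∀ t ∈ Set.Icc a b, c t ∈ closedSimplex s) →
      (∀ t ∈ Set.Icc a b, c t ∈ Metric.ball x₀ r) → ContDiffOn ℝ 1 c (Set.Icc a b) →
      pathLength h (segPath hs x y hx hy) ≤ 2 * ∫⁻ t in Set.Ioo a b, speed h c t := by
  obtain ⟨r, hr, hball⟩ := Metric.mem_nhdsWithin_iff.mp (hpos.eventually_le hs hx₀)
  refine ⟨r, hr, fun c a b x y hab hx hy hca hcb hcs hcr hd => ?_⟩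
  have hsq : ∀ u v : ℝ, u ≤ 2 * v → ENNReal.ofReal (Real.sqrt u) ≤
      ENNReal.ofReal (Real.sqrt 2) * ENNReal.ofReal (Real.sqrt v) := fun u v huv => by
    rw [← ENNReal.ofReal_mul (Real.sqrt_nonneg _), ← Real.sqrt_mul two_pos.le]
    exact ENNReal.ofReal_le_ofReal (Real.sqrt_le_sqrt huv)
  have hxr : (x : V → ℝ) ∈ Metric.ball x₀ r := hca ▸ hcr a ⟨le_rfl, hab⟩
  have hyr : (y : V → ℝ) ∈ Metric.ball x₀ r := hcb ▸ hcr b ⟨hab, le_rfl⟩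
  -- Freezing the inner product at `x₀` costs a factor `√2` for the segment and another one for the
  -- arc. The hypothesis `hind` allows the carrier to change along either of them.
  calc pathLength h (segPath hs x y hx hy)
      ≤ ENNReal.ofReal (Real.sqrt 2) * ENNReal.ofReal (Real.sqrt
          (h.form s x₀ ((y : V → ℝ) - x) ((y : V → ℝ) - x))) := by
        rw [pathLength_eq_lintegral_speed, ← restrict_Ioo_eq_restrict_Icc]
        calc _ ≤ ∫⁻ _ in Set.Ioo (0 : ℝ) 1, ENNReal.ofReal (Real.sqrt 2) * ENNReal.ofReal (Real.sqrt
                (h.form s x₀ ((y : V → ℝ) - x) ((y : V → ℝ) - x))) := by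
              refine setLIntegral_mono' measurableSet_Ioo fun t ht => ?_
              have ht' := Set.Ioo_subset_Icc_self ht
              rw [speed, deriv_curve_segPath hs hx hy ht, hind _ s]
              refine hsq _ _ (hball ⟨?_, ?_⟩ _ (sub_mem_tangentSpace hx hy)).1
              · rw [curve_segPath hs hx hy ht']
                exact (convex_ball x₀ r).add_smul_sub_mem hxr hyr ht'
              · rw [curve_segPath hs hx hy ht']
                exact (convex_closedSimplex s).add_smul_sub_mem hx hy ht'
          _ = _ := by simp
    _ ≤ ENNReal.ofReal (Real.sqrt 2) * ∫⁻ t in Set.Ioo a b,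
          ENNReal.ofReal (Real.sqrt (h.form s x₀ (deriv c t) (deriv c t))) := by
        have := sqrt_form_sub_le_lintegral h hs hx₀ hab hcs hd
        rw [hca, hcb] at this
        gcongr
    _ ≤ ENNReal.ofReal (Real.sqrt 2) * ∫⁻ t in Set.Ioo a b,
          ENNReal.ofReal (Real.sqrt 2) * speed h c t := by
        refine mul_le_mul_right (setLIntegral_mono' measurableSet_Ioo fun t ht => ?_) _
        have ht' := Set.Ioo_subset_Icc_self ht
        have hdt : DifferentiableAt ℝ c t :=
          (hd.differentiableOn one_ne_zero t ht').differentiableAt (Icc_mem_nhds ht.1 ht.2)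
        rw [speed, hind (carrier (c t)) s]
        exact hsq _ _ (hball ⟨hcr t ht', hcs t ht'⟩ _ (deriv_mem_tangentSpace hcs hdt ht)).2
    _ = 2 * ∫⁻ t in Set.Ioo a b, speed h c t := by
        rw [lintegral_const_mul' _ _ ENNReal.ofReal_ne_top, ← mul_assoc,
          ← ENNReal.ofReal_mul (Real.sqrt_nonneg _), Real.mul_self_sqrt two_pos.le]
        norm_num

end Segments

/-! ### Effect of nonexpanding maps on lifted distances and fiber counts. -/

section LengthComparison

open Path.Homotopic (Quotient)
open Path.Homotopic.Quotient

/-- Additive induction along a path. -/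
theorem interval_induction {P : unitInterval → unitInterval → Prop}
    (htrans : ∀ a b c, a ≤ b → b ≤ c → P a b → P b c → P a c)
    (hlocal : ∀ t, ∃ U ∈ 𝓝 t, ∀ a ∈ U, ∀ b ∈ U, a ≤ b → P a b) : P 0 1 := by
  choose U hU hP using hlocal
  obtain ⟨t, ht0, htm, ⟨n, hn⟩, htU⟩ := exists_monotone_Icc_subset_open_cover_unitInterval
    (c := fun i => interior (U i)) (fun i => isOpen_interior)
    (fun s _ => Set.mem_iUnion.mpr ⟨s, mem_interior_iff_mem_nhds.mpr (hU s)⟩)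
  have hstep : ∀ m, P (t m) (t (m + 1)) := fun m => by
    obtain ⟨i, hi⟩ := htU m
    have hle : t m ≤ t (m + 1) := htm (Nat.le_succ m)
    exact hP i _ (interior_subset (hi ⟨le_rfl, hle⟩)) _ (interior_subset (hi ⟨hle, le_rfl⟩)) hle
  have hsub : ∀ m, P (t 0) (t (m + 1)) := by
    intro m
    induction m with
    | zero => exact hstep 0
    | succ m ih => exact htrans _ _ _ (htm (Nat.zero_le _)) (htm (Nat.le_succ _)) ih (hstep _)
  have := hsub n
  rwa [ht0, hn _ (Nat.le_succ n)] at this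

variable {V W : Type*} [Fintype V] [Fintype W] {K : AbstractSimplicialComplex V}
  {L : AbstractSimplicialComplex W} {F : PLMap K L} {h : PiecewiseRiemannianMetric K}
  {g : PiecewiseRiemannianMetric L}

/-- A nonexpanding piecewise affine map increases lifted distances at most by a factor of two. -/
theorem IsNonexpanding.liftedDist_map_le (hF : IsNonexpanding F h g) (hpos : IsUniformlyPositive h)
    (hind : ∀ s s' x, h.form s x = h.form s' x) {x y : Space K} {γ : Path x y}
    (hγ : IsPiecewiseC1 γ) :
    liftedDist g (F.toContinuousMap x) ⟨F.toContinuousMap y, (mk γ).map F.toContinuousMap⟩ ≤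
      2 * pathLength h γ := by
  obtain ⟨B, hB, hreg⟩ := (isPiecewiseC1_iff γ).mp hγ
  have hcv : ∀ t : unitInterval, curve γ t = γ t := fun t => by
    simp only [curve]; rw [Path.extend_apply _ t.2]
  have hcc : Continuous (curve γ) := continuous_subtype_val.comp γ.continuous_extend
  -- `P` is additive under subdivision, so it needs to be checked only on short arcs. There the arc
  -- is replaced by the homotopic segment, whose image under `F` is piecewise `C¹`.
  let P : unitInterval → unitInterval → Prop := fun a b =>
    liftedDist g (F.toContinuousMap (γ a))
      ⟨F.toContinuousMap (γ b), (mk (γ.subpath a b)).map F.toContinuousMap⟩ ≤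
        2 * ∫⁻ t in Set.Ioo (a : ℝ) b, speed h (curve γ) t
  have htr : ∀ a b c : unitInterval, a ≤ b → b ≤ c → P a b → P b c → P a c := by
      intro a b c hab hbc h1 h2
      have e1 : (mk (γ.subpath a c)).map F.toContinuousMap =
          ((mk (γ.subpath a b)).map F.toContinuousMap).trans
            ((mk (γ.subpath b c)).map F.toContinuousMap) := by
        rw [← map_trans_class, ← mk_trans,
          Path.Homotopic.Quotient.eq.mpr ⟨Path.Homotopy.subpathTransSubpath γ _ _ _⟩]
      change liftedDist _ _ _ ≤ _
      rw [e1]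
      refine (liftedDist_trans_le g _ _).trans ((add_le_add h1 h2).trans ?_)
      rw [← mul_add]
      gcongr
      rw [restrict_Ioo_eq_restrict_Ioc (a := (a : ℝ)) (b := (b : ℝ)),
        restrict_Ioo_eq_restrict_Ioc (a := (b : ℝ)) (b := (c : ℝ)),
        restrict_Ioo_eq_restrict_Ioc (a := (a : ℝ)) (b := (c : ℝ)),
        ← Set.Ioc_union_Ioc_eq_Ioc (show (a : ℝ) ≤ b from hab) (show (b : ℝ) ≤ c from hbc),
        lintegral_union measurableSet_Ioc (Set.Ioc_disjoint_Ioc_of_le le_rfl)]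
  have hmain : P 0 1 := by
      refine interval_induction htr fun t₀ => ?_
      have hr : ∀ s : Finset V, ∃ r : ℝ, 0 < r ∧ ∀ (hs : s ∈ K.faces), curve γ t₀ ∈ closedSimplex s →
          ∀ (c : ℝ → (V → ℝ)) (a b : ℝ) (x y : Space K) (_ : a ≤ b)
          (hx : (x : V → ℝ) ∈ closedSimplex s) (hy : (y : V → ℝ) ∈ closedSimplex s),
          c a = x → c b = y → (∀ t ∈ Set.Icc a b, c t ∈ closedSimplex s) →
          (∀ t ∈ Set.Icc a b, c t ∈ Metric.ball (curve γ t₀) r) → ContDiffOn ℝ 1 c (Set.Icc a b) →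
          pathLength h (segPath hs x y hx hy) ≤ 2 * ∫⁻ t in Set.Ioo a b, speed h c t := by
        intro s
        by_cases hs : s ∈ K.faces ∧ curve γ t₀ ∈ closedSimplex s
        · obtain ⟨r, hr, h1⟩ := hpos.eventually_pathLength_segPath_le hind hs.1 hs.2
          exact ⟨r, hr, fun _ _ => h1⟩
        · exact ⟨1, one_pos, fun h1 h2 => absurd ⟨h1, h2⟩ hs⟩
      choose r hr0 hr using hr
      -- Near `t₀` the only possible break of the path is `t₀` itself, and the segment comparison is
      -- available for every simplex containing the point at `t₀`.
      have hev : ∀ᶠ t in 𝓝 (t₀ : ℝ), (∀ s, curve γ t ∈ Metric.ball (curve γ t₀) (r s)) ∧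
          t ∉ B \ {(t₀ : ℝ)} := by
        refine Filter.Eventually.and (eventually_all.mpr fun s =>
          hcc.continuousAt.eventually (Metric.ball_mem_nhds _ (hr0 s))) ?_
        exact (hB.subset Set.sdiff_subset).isClosed.isOpen_compl.mem_nhds fun h => h.2 rfl
      obtain ⟨ε, hε, hball⟩ := Metric.eventually_nhds_iff_ball.mp hev
      rw [Real.ball_eq_Ioo] at hball
      have harc : ∀ a b : unitInterval, a ≤ b → (a : ℝ) ∈ Set.Ioo (t₀ - ε) (t₀ + ε) →
          (b : ℝ) ∈ Set.Ioo (t₀ - ε) (t₀ + ε) →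
          (∃ s ∈ K.faces, curve γ t₀ ∈ closedSimplex s ∧
            (∀ t ∈ Set.Icc (a : ℝ) b, curve γ t ∈ closedSimplex s) ∧
            ContDiffOn ℝ 1 (curve γ) (Set.Icc (a : ℝ) b)) → P a b := by
        rintro a b hab ha hb ⟨s, hs, ht₀s, hcs, hd⟩
        have haI : (γ a : V → ℝ) ∈ closedSimplex s := hcv a ▸ hcs a ⟨le_rfl, hab⟩
        have hbI : (γ b : V → ℝ) ∈ closedSimplex s := hcv b ▸ hcs b ⟨hab, le_rfl⟩
        have h1 := hr s hs ht₀s (curve γ) a b (γ a) (γ b) hab haI hbI (hcv a) (hcv b) hcs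
          (fun t ht => (hball t ⟨ha.1.trans_le ht.1, ht.2.trans_lt hb.2⟩).1 s) hd
        have h2 : mk (γ.subpath a b) = mk (segPath hs (γ a) (γ b) haI hbI) := by
          refine Path.Homotopic.Quotient.eq.mpr (homotopic_of_mem_closedSimplex hs _ _ ?_ ?_)
          · intro u
            have hu : γ.subpath a b u ∈ Set.range (γ.subpath a b) := ⟨u, rfl⟩
            rw [Path.range_subpath_of_le _ _ _ hab] at hu
            obtain ⟨v, hv, hvu⟩ := hu
            rw [← hvu, ← hcv]
            exact hcs v hv
          · intro u
            exact lineMap_mem_closedSimplex haI hbI u.2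
        have h3 := isPiecewiseC1_map_segPath F hF hs haI hbI
        change liftedDist _ _ _ ≤ _
        rw [h2]
        exact (liftedDist_mk_le g h3.1).trans (h3.2.trans h1)
      -- The two sides of `t₀` are treated separately, because `t₀` may be a break; an arc around
      -- `t₀` is then split there. A degenerate arc at `t₀` needs its own argument.
      have hright : ∀ a b : unitInterval, t₀ ≤ a → a ≤ b → (b : ℝ) ∈ Set.Ioo (t₀ - ε) (t₀ + ε) →
          P a b := by
        intro a b hta hab hb
        have hta' : (t₀ : ℝ) ≤ a := hta
        have hab' : (a : ℝ) ≤ b := hab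
        refine harc a b hab ⟨by linarith, hab'.trans_lt hb.2⟩ hb ?_
        rcases (hta.trans hab).eq_or_lt with h0 | h0
        · have ha0 : a = t₀ := le_antisymm (hab.trans h0.ge) hta
          have hx := mem_realization_iff.mp (γ t₀).2
          refine ⟨_, hx.2, by rw [hcv]; exact mem_closedSimplex_carrier hx.1, fun t ht => ?_, ?_⟩
          · rw [ha0, ← h0, Set.Icc_self, Set.mem_singleton_iff] at ht
            rw [ht, hcv]; exact mem_closedSimplex_carrier hx.1
          · rw [ha0, ← h0, Set.Icc_self]
            exact (contDiffOn_const (c := curve γ t₀)).congr fun t ht => by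
              rw [Set.mem_singleton_iff.mp ht]
        · have h1 := hreg t₀ b t₀.2.1 h0 b.2.2 fun t ht htB =>
            (hball t ⟨by linarith [ht.1], ht.2.trans hb.2⟩).2 ⟨htB, ht.1.ne'⟩
          obtain ⟨⟨s, hs, hcs⟩, hd⟩ := h1
          have hsub : Set.Icc (a : ℝ) b ⊆ Set.Icc (t₀ : ℝ) b := Set.Icc_subset_Icc_left hta'
          exact ⟨s, hs, hcs t₀ ⟨le_rfl, h0.le⟩, fun t ht => hcs t (hsub ht), hd.mono hsub⟩
      have hleft : ∀ a b : unitInterval, a ≤ b → b ≤ t₀ → (a : ℝ) ∈ Set.Ioo (t₀ - ε) (t₀ + ε) →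
          P a b := by
        intro a b hab hbt ha
        have hbt' : (b : ℝ) ≤ t₀ := hbt
        have hab' : (a : ℝ) ≤ b := hab
        refine harc a b hab ha ⟨ha.1.trans_le hab', by linarith⟩ ?_
        rcases (hab.trans hbt).eq_or_lt with h0 | h0
        · have hb0 : b = t₀ := le_antisymm hbt (h0 ▸ hab)
          have hx := mem_realization_iff.mp (γ t₀).2
          refine ⟨_, hx.2, by rw [hcv]; exact mem_closedSimplex_carrier hx.1, fun t ht => ?_, ?_⟩
          · rw [hb0, h0, Set.Icc_self, Set.mem_singleton_iff] at ht
            rw [ht, hcv]; exact mem_closedSimplex_carrier hx.1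
          · rw [hb0, h0, Set.Icc_self]
            exact (contDiffOn_const (c := curve γ t₀)).congr fun t ht => by
              rw [Set.mem_singleton_iff.mp ht]
        · have h1 := hreg a t₀ a.2.1 h0 t₀.2.2 fun t ht htB =>
            (hball t ⟨ha.1.trans ht.1, by linarith [ht.2]⟩).2 ⟨htB, ht.2.ne⟩
          obtain ⟨⟨s, hs, hcs⟩, hd⟩ := h1
          have hsub : Set.Icc (a : ℝ) b ⊆ Set.Icc (a : ℝ) t₀ := Set.Icc_subset_Icc_right hbt'
          exact ⟨s, hs, hcs t₀ ⟨h0.le, le_rfl⟩, fun t ht => hcs t (hsub ht), hd.mono hsub⟩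
      have ht₀ : (t₀ : ℝ) ∈ Set.Ioo ((t₀ : ℝ) - ε) (t₀ + ε) := ⟨by linarith, by linarith⟩
      refine ⟨{a | (a : ℝ) ∈ Set.Ioo ((t₀ : ℝ) - ε) (t₀ + ε)},
        (isOpen_Ioo.preimage continuous_subtype_val).mem_nhds ht₀, fun a ha b hb hab => ?_⟩
      rcases le_total t₀ a with h1 | h1
      · exact hright a b h1 hab hb
      · rcases le_total b t₀ with h2 | h2
        · exact hleft a b hab h2 ha
        · exact htr a t₀ b h1 h2 (hleft a t₀ h1 le_rfl ha) (hright t₀ b le_rfl h2 hb)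
  have hfin : ∀ (x' y' : Space K) (hx : x' = x) (hy : y' = y) (C : ℝ≥0∞),
      liftedDist g (F.toContinuousMap x')
        ⟨F.toContinuousMap y', ((mk γ).cast hx hy).map F.toContinuousMap⟩ ≤ C →
      liftedDist g (F.toContinuousMap x) ⟨F.toContinuousMap y, (mk γ).map F.toContinuousMap⟩ ≤ C := by
    rintro x' y' rfl rfl C h
    simpa using h
  rw [pathLength_eq_lintegral_speed, ← restrict_Ioo_eq_restrict_Icc]
  refine hfin _ _ γ.source γ.target _ ?_
  have h1 : P 0 1 := hmain
  change liftedDist _ _ _ ≤ _ at h1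
  rw [Path.subpath_zero_one, mk_cast] at h1
  simpa using h1

/-- A nonexpanding map which is injective on homotopy classes does not decrease the number of
points in fibers of balls, up to rescaling. -/
theorem IsNonexpanding.fiberCount_le (hF : IsNonexpanding F h g) (hpos : IsUniformlyPositive h)
    (hind : ∀ s s' x, h.form s x = h.form s' x)
    (hinj : ∀ y y' : Space K, Function.Injective fun p : Quotient y y' => p.map F.toContinuousMap)
    (x y : Space K) {t : ℝ} :
    fiberCount h x y t ≤ fiberCount g (F.toContinuousMap x) (F.toContinuousMap y) (2 * t) := by
  refine ENat.toENNReal_le.mpr ?_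
  refine Set.encard_le_encard_of_injOn (f := fun c => c.map F.toContinuousMap) (fun c hc => ?_)
    (hinj x y).injOn
  obtain ⟨γ, hγ, rfl, hl⟩ := exists_path_of_liftedDist_lt h hc
  change liftedDist g _ _ < ENNReal.ofReal (2 * t)
  refine (hF.liftedDist_map_le hpos hind hγ).trans_lt ?_
  rw [ENNReal.ofReal_mul two_pos.le, ENNReal.ofReal_ofNat]
  exact ENNReal.mul_lt_mul_right two_ne_zero ENNReal.ofNat_ne_top hl

end LengthComparison

/-! ### Regular points of a piecewise affine map -/

section GoodPoints

variable {V W : Type*} [Fintype V] [Fintype W] {K : AbstractSimplicialComplex V}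
  {L : AbstractSimplicialComplex W}

theorem card_le_dim {s : Finset V} (hs : s ∈ K.faces) : s.card ≤ dim K + 1 := by
  classical
  have : s.card - 1 ≤ dim K :=
    Finset.le_sup (f := fun s : Finset V => s.card - 1) (by simpa using hs)
  omega

/-- The constant term cancels on vectors of coordinate sum zero, so the linear part is determined on
them by the values at the vertices. -/
theorem AffineFn.linear_apply_eq_sum [DecidableEq V] (A : AffineFn V) {v : V → ℝ}
    (hv : ∑ u, v u = 0) : A.1 v = ∑ u, v u * A.eval (Pi.single u 1) := by
  simp only [AffineFn.eval_def, mul_add, Finset.sum_add_distrib, ← Finset.sum_mul, hv, zero_mul,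
    add_zero]
  conv_lhs => rw [pi_eq_sum_univ' v]
  simp [map_sum, map_smul]

/-- Affine functions which agree on a simplex have the same linear part on its tangent space. -/
theorem AffineFn.linear_eq_of_eqOn {A B : AffineFn V} {s : Finset V}
    (h : ∀ z ∈ closedSimplex s, A.eval z = B.eval z) {v : V → ℝ} (hv : v ∈ tangentSpace s) :
    A.1 v = B.1 v := by
  classical
  rw [A.linear_apply_eq_sum hv.2, B.linear_apply_eq_sum hv.2]
  refine Finset.sum_congr rfl fun u _ => ?_
  by_cases hu : u ∈ s
  · rw [h _ (single_mem_closedSimplex hu)]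
  · rw [hv.1 u hu, zero_mul, zero_mul]

namespace PLMap

variable (F : PLMap K L)

/-- The affine functions selected at `y`. -/
def sel (y : V → ℝ) (w : W) : AffineFn V := (F.exists_mem_pieces w y).choose

theorem sel_mem (y : V → ℝ) (w : W) : F.sel y w ∈ F.pieces :=
  (F.exists_mem_pieces w y).choose_spec.1

theorem eval_sel (y : V → ℝ) (w : W) : (F.sel y w).eval y = F.toFun y w :=
  (F.exists_mem_pieces w y).choose_spec.2.symm

/-- The derivative of `F` at `y`, with respect to the affine functions selected at `y`. -/
def lin (y : V → ℝ) : (V → ℝ) →ₗ[ℝ] (W → ℝ) := LinearMap.pi fun w => (F.sel y w).1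

theorem lin_apply (y v : V → ℝ) (w : W) : F.lin y v w = (F.sel y w).1 v := rfl

/-- A point is good if it lies in the interior of a simplex of top dimension, and pieces of `F`
agreeing at the point agree on this simplex. -/
def IsGood (y : V → ℝ) : Prop :=
  y ∈ realization K ∧ (carrier y).card = dim K + 1 ∧
    ∀ A ∈ F.pieces, ∀ B ∈ F.pieces, A.eval y = B.eval y →
      ∀ z ∈ closedSimplex (carrier y), A.eval z = B.eval z

variable {F}

/-- Coordinates that are not zero stay so nearby, hence carriers can only grow, and this one already
has maximal dimension. Pieces that differ at `y` differ nearby, and those that agree at `y` agree on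
the whole simplex. So `F` is affine near `y`, given by the selection at `y`. -/
theorem IsGood.eventually {y : V → ℝ} (hy : F.IsGood y) : ∀ᶠ y' in 𝓝[realization K] y,
    F.IsGood y' ∧ carrier y' = carrier y ∧ (∀ w, F.toFun y' w = (F.sel y w).eval y') ∧
      carrier (F.toFun y') = carrier (F.toFun y) ∧
        ∀ v ∈ tangentSpace (carrier y), F.lin y' v = F.lin y v := by
  obtain ⟨hyK, hcard, hyA⟩ := hy
  have h1 : ∀ᶠ y' in 𝓝 y, ∀ v, y v ≠ 0 → y' v ≠ 0 := eventually_all.mpr fun v => by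
    by_cases hv : y v = 0
    · exact Eventually.of_forall fun y' h => absurd hv h
    · filter_upwards [(continuous_apply v).continuousAt.eventually_ne hv] with y' h _ using h
  have h2 : ∀ᶠ y' in 𝓝 y, ∀ A ∈ F.pieces, ∀ B ∈ F.pieces, A.eval y ≠ B.eval y →
      A.eval y' ≠ B.eval y' := by
    refine (Set.Finite.eventually_all F.finite_pieces).mpr fun A _ =>
      (Set.Finite.eventually_all F.finite_pieces).mpr fun B _ => ?_
    by_cases h : A.eval y = B.eval y
    · exact Eventually.of_forall fun y' h' => absurd h h'
    · filter_upwards [(A.continuous.continuousAt.ne_iff_eventually_ne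
        B.continuous.continuousAt).mp h] with y' h' _ using h'
  have h3 : ∀ᶠ y' in 𝓝 y, ∀ A ∈ F.pieces, ∀ w, F.toFun y w ≠ A.eval y →
      F.toFun y' w ≠ A.eval y' := by
    refine (Set.Finite.eventually_all F.finite_pieces).mpr fun A _ => eventually_all.mpr fun w => ?_
    by_cases h : F.toFun y w = A.eval y
    · exact Eventually.of_forall fun y' h' => absurd h h'
    · filter_upwards [((F.piecewiseAffine w).1.continuousAt.ne_iff_eventually_ne
        A.continuous.continuousAt).mp h] with y' h' _ using h'
  filter_upwards [nhdsWithin_le_nhds h1, nhdsWithin_le_nhds h2, nhdsWithin_le_nhds h3,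
    self_mem_nhdsWithin] with y' h1 h2 h3 hy'K
  have hy' := mem_realization_iff.mp hy'K
  have hcar : carrier y' = carrier y := by
    refine (Finset.eq_of_subset_of_card_le (fun v hv => ?_) ?_).symm
    · exact mem_carrier.mpr (h1 v (mem_carrier.mp hv))
    · rw [hcard]; exact card_le_dim hy'.2
  have hy's : y' ∈ closedSimplex (carrier y) := hcar ▸ mem_closedSimplex_carrier hy'.1
  have hagree : ∀ A ∈ F.pieces, ∀ B ∈ F.pieces, A.eval y' = B.eval y' →
      ∀ z ∈ closedSimplex (carrier y), A.eval z = B.eval z := by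
    intro A hA B hB h
    refine hyA A hA B hB ?_
    by_contra hne
    exact h2 A hA B hB hne h
  have hF : ∀ w, F.toFun y' w = (F.sel y w).eval y' := by
    intro w
    obtain ⟨A, hA, hAy⟩ := F.exists_mem_pieces w y'
    have h4 : F.toFun y w = A.eval y := by
      by_contra hne
      exact h3 A hA w hne hAy
    rw [← F.eval_sel] at h4
    rw [hAy, hyA _ (F.sel_mem y w) A hA h4 y' hy's]
  have hzero : ∀ z, AffineFn.eval (0 : AffineFn V) z = 0 := fun z => by simp [AffineFn.eval_def]
  refine ⟨⟨hy'K, hcar ▸ hcard, hcar ▸ hagree⟩, hcar, hF, ?_, fun v hv => ?_⟩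
  · ext w
    rw [mem_carrier, mem_carrier, not_iff_not]
    constructor
    · intro h
      by_contra hne
      exact h3 0 F.zero_mem_pieces w (by rwa [hzero]) (by rw [hzero, h])
    · intro h
      rw [hF w, hyA _ (F.sel_mem y w) 0 F.zero_mem_pieces (by rw [F.eval_sel, h, hzero]) y' hy's,
        hzero]
  · funext w
    refine AffineFn.linear_eq_of_eqOn (hagree _ (F.sel_mem y' w) _ (F.sel_mem y w) ?_) hv
    rw [F.eval_sel, hF]

/-- `sel` is an arbitrary choice among the pieces; at a good point the derivative in tangent
directions does not depend on it. -/
theorem IsGood.lin_eq {y : V → ℝ} (hy : F.IsGood y) {A : W → AffineFn V}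
    (hA : ∀ w, A w ∈ F.pieces) (hAy : ∀ w, F.toFun y w = (A w).eval y) {v : V → ℝ}
    (hv : v ∈ tangentSpace (carrier y)) : F.lin y v = fun w => (A w).1 v := by
  funext w
  refine AffineFn.linear_eq_of_eqOn (hy.2.2 _ (F.sel_mem y w) _ (hA w) ?_) hv
  rw [F.eval_sel, hAy]

/-- Near a good point `F` is affine and the carrier of its image is constant, so the derivative is a
difference quotient of two points of that simplex. -/
theorem IsGood.lin_mem_tangentSpace {y : V → ℝ} (hy : F.IsGood y) {v : V → ℝ}
    (hv : v ∈ tangentSpace (carrier y)) : F.lin y v ∈ tangentSpace (carrier (F.toFun y)) := by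
  have hyK := mem_realization_iff.mp hy.1
  have hcont : Continuous fun t : ℝ => y + t • v := by fun_prop
  have hcont0 : Tendsto (fun t : ℝ => y + t • v) (𝓝 0) (𝓝 y) := by
    have := hcont.tendsto 0
    rwa [zero_smul, add_zero] at this
  have h1 : ∀ᶠ t : ℝ in 𝓝 0, y + t • v ∈ realization K := by
    have : ∀ᶠ t : ℝ in 𝓝 0, ∀ u ∈ carrier y, 0 < (y + t • v) u := by
      refine (Finset.eventually_all (carrier y)).mpr fun u hu => ?_
      have hpos : 0 < y u := lt_of_le_of_ne (hyK.1.1 u) (mem_carrier.mp hu).symm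
      exact ((continuous_apply u).tendsto y).comp hcont0 |>.eventually (lt_mem_nhds hpos)
    filter_upwards [this] with t ht
    have hz : ∀ u, u ∉ carrier y → (y + t • v) u = 0 := fun u hu => by
      have h0 : y u = 0 := by by_contra h; exact hu (mem_carrier.mpr h)
      simp [h0, hv.1 u hu]
    refine closedSimplex_subset_realization hyK.2 ⟨⟨fun u => ?_, ?_⟩, hz⟩
    · by_cases hu : u ∈ carrier y
      · exact (ht u hu).le
      · exact (hz u hu).ge
    · simp [Finset.sum_add_distrib, ← Finset.mul_sum, hyK.1.2, hv.2]
  have h2 : Tendsto (fun t : ℝ => y + t • v) (𝓝 0) (𝓝[realization K] y) :=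
    tendsto_nhdsWithin_iff.mpr ⟨hcont0, h1⟩
  obtain ⟨ε, hε, hball⟩ := Metric.eventually_nhds_iff_ball.mp (h2.eventually hy.eventually)
  have hmem : ε / 2 ∈ Metric.ball (0 : ℝ) ε := by
    rw [Metric.mem_ball, dist_zero_right, Real.norm_eq_abs, abs_of_pos (by positivity)]; linarith
  obtain ⟨hg, -, hF, hcar, -⟩ := hball _ hmem
  have h3 : F.toFun (y + (ε / 2) • v) ∈ closedSimplex (carrier (F.toFun y)) := by
    rw [← hcar]
    exact mem_closedSimplex_carrier (mem_realization_iff.mp (F.mem _ hg.1)).1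
  have h4 := smul_mem_tangentSpace (sub_mem_tangentSpace (mem_closedSimplex_carrier
    (mem_realization_iff.mp (F.mem _ hy.1)).1) h3) (ε / 2)⁻¹
  convert h4 using 1
  funext w
  have hne : ε / 2 ≠ 0 := by positivity
  rw [Pi.smul_apply, Pi.sub_apply, hF w, ← F.eval_sel y w, AffineFn.eval_add_smul, lin_apply,
    add_sub_cancel_left, smul_eq_mul, inv_mul_cancel_left₀ hne]

variable (F)

/-- Closedness provides a smooth function which vanishes exactly at these points, from which the
cutoffs are made. -/
theorem isClosed_notGood : IsClosed {y | y ∈ realization K ∧ ¬ F.IsGood y} := by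
  rw [← isOpen_compl_iff, isOpen_iff_mem_nhds]
  intro y hy
  by_cases hyK : y ∈ realization K
  · have hg : F.IsGood y := by by_contra h; exact hy ⟨hyK, h⟩
    filter_upwards [mem_nhdsWithin_iff_eventually.mp hg.eventually] with y' h h'
    exact h'.2 (h h'.1).1
  · filter_upwards [(isCompact_realization K).isClosed.isOpen_compl.mem_nhds hyK] with y' h h'
    exact h h'.1

end PLMap

end GoodPoints

/-! ### Almost pulled back metrics -/

section PullbackMetric

variable {V W : Type*} [Fintype V] [Fintype W] {K : AbstractSimplicialComplex V}
  {L : AbstractSimplicialComplex W}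

/-- The standard inner product. -/
def stdForm (V : Type*) [Fintype V] : (V → ℝ) →ₗ[ℝ] (V → ℝ) →ₗ[ℝ] ℝ := dotProductBilin ℝ ℝ

theorem stdForm_apply (v w : V → ℝ) : stdForm V v w = ∑ u, v u * w u := rfl

theorem stdForm_comm (v w : V → ℝ) : stdForm V v w = stdForm V w v := by
  simp only [stdForm_apply, mul_comm]

theorem sq_norm_le_stdForm (v : V → ℝ) : ‖v‖ ^ 2 ≤ stdForm V v v := by
  have h0 : 0 ≤ stdForm V v v := Finset.sum_nonneg fun u _ => mul_self_nonneg _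
  rw [← Real.sqrt_le_sqrt_iff h0, Real.sqrt_sq (norm_nonneg v)]
  refine (pi_norm_le_iff_of_nonneg (Real.sqrt_nonneg _)).mpr fun u => ?_
  rw [Real.norm_eq_abs]
  refine Real.abs_le_sqrt ?_
  rw [sq]
  exact Finset.single_le_sum (f := fun u => v u * v u) (fun u _ => mul_self_nonneg _)
    (Finset.mem_univ u)

theorem stdForm_self_nonneg (v : V → ℝ) : 0 ≤ stdForm V v v :=
  (sq_nonneg _).trans (sq_norm_le_stdForm v)

theorem stdForm_self_pos {v : V → ℝ} (hv : v ≠ 0) : 0 < stdForm V v v :=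
  lt_of_lt_of_le (by have := norm_pos_iff.mpr hv; positivity) (sq_norm_le_stdForm v)

namespace PLMap

variable (F : PLMap K L) (g : PiecewiseRiemannianMetric L)

/-- All derivatives of `F` are bounded. -/
theorem exists_form_le : ∃ Λ : ℝ, 0 ≤ Λ ∧ ∀ A : W → AffineFn V, (∀ w, A w ∈ F.pieces) →
    ∀ T ∈ L.faces, ∀ z ∈ closedSimplex T, ∀ v : V → ℝ, (fun w => (A w).1 v) ∈ tangentSpace T →
      g.form T z (fun w => (A w).1 v) (fun w => (A w).1 v) ≤ Λ * stdForm V v v := by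
  obtain ⟨M, hM0, hM⟩ := MinVolEntropy.exists_form_le g
  have h1 : ∃ C : ℝ, 0 ≤ C ∧ ∀ A ∈ F.pieces, ∀ v : V → ℝ, |A.1 v| ≤ C * ‖v‖ := by
    refine ⟨∑ A ∈ F.finite_pieces.toFinset, ‖LinearMap.toContinuousLinearMap A.1‖,
      Finset.sum_nonneg fun _ _ => norm_nonneg _, fun A hA v => ?_⟩
    refine ((LinearMap.toContinuousLinearMap A.1).le_opNorm v).trans ?_
    gcongr
    exact Finset.single_le_sum (f := fun A : AffineFn V => ‖LinearMap.toContinuousLinearMap A.1‖)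
      (fun _ _ => norm_nonneg _) (F.finite_pieces.mem_toFinset.mpr hA)
  obtain ⟨C, hC0, hC⟩ := h1
  refine ⟨M * C ^ 2, by positivity, fun A hA T hT z hz v hv => (hM T hT z hz _ hv).trans ?_⟩
  rw [mul_assoc]
  gcongr
  calc ‖fun w => (A w).1 v‖ ^ 2 ≤ (C * ‖v‖) ^ 2 := by
        gcongr
        exact (pi_norm_le_iff_of_nonneg (by positivity)).mpr fun w => hC _ (hA w) v
    _ = C ^ 2 * ‖v‖ ^ 2 := by ring
    _ ≤ C ^ 2 * stdForm V v v := by gcongr; exact sq_norm_le_stdForm v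

/-- The pull-back of the metric `g` by the derivative of `F`. -/
def pullback (y : V → ℝ) : (V → ℝ) →ₗ[ℝ] (V → ℝ) →ₗ[ℝ] ℝ :=
  (g.form (carrier (F.toFun y)) (F.toFun y)).compl₁₂ (F.lin y) (F.lin y)

theorem pullback_apply (y v w : V → ℝ) : F.pullback g y v w =
    g.form (carrier (F.toFun y)) (F.toFun y) (F.lin y v) (F.lin y w) := rfl

/-- A cutoff function is smooth, has values in `[0, 1]`, and is equal to one near the points of
`K` which are not good. -/
structure IsCutoff (χ : (V → ℝ) → ℝ) : Prop where
  smooth : ContDiff ℝ ∞ χ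
  nonneg : ∀ y, 0 ≤ χ y
  le_one : ∀ y, χ y ≤ 1
  eventually_eq : ∀ y ∈ realization K, ¬ F.IsGood y → ∀ᶠ y' in 𝓝 y, χ y' = 1

theorem exists_cutoff : ∃ χ : ℕ → (V → ℝ) → ℝ, (∀ k, F.IsCutoff (χ k)) ∧
    ∀ y, F.IsGood y → ∀ᶠ k in atTop, χ k y = 0 := by
  obtain ⟨d, hd, hds, hdr⟩ := F.isClosed_notGood.isOpen_compl.exists_contDiff_support_eq (n := ⊤)
  have hd0 : ∀ y, 0 ≤ d y := fun y => (hdr ⟨y, rfl⟩).1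
  -- The cutoff is `1` where `k * d y ≤ 1` and `0` where `k * d y ≥ 2`. As `k` grows it therefore
  -- vanishes eventually at each good point.
  refine ⟨fun k y => 1 - Real.smoothTransition (k * d y - 1), fun k => ⟨?_, ?_, ?_, ?_⟩, ?_⟩
  · exact contDiff_const.sub (Real.smoothTransition.contDiff.comp
      ((contDiff_const.mul hds).sub contDiff_const))
  · exact fun y => sub_nonneg.mpr (Real.smoothTransition.le_one _)
  · exact fun y => sub_le_self _ (Real.smoothTransition.nonneg _)
  · intro y hyK hy
    have h0 : d y = 0 := by
      by_contra h
      have : y ∈ Function.support d := h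
      rw [hd] at this
      exact this ⟨hyK, hy⟩
    have hc : ContinuousAt (fun y => (k : ℝ) * d y - 1) y :=
      ((hds.continuous.const_mul _).sub continuous_const).continuousAt
    have h1 : (fun y => (k : ℝ) * d y - 1) y < 0 := by simp [h0]
    filter_upwards [hc.eventually_lt_const h1] with y' h
    rw [Real.smoothTransition.zero_of_nonpos h.le, sub_zero]
  · intro y hy
    have hpos : 0 < d y := lt_of_le_of_ne (hd0 y) (by
      have : y ∈ Function.support d := by rw [hd]; exact fun h => h.2 hy
      exact this.symm)
    filter_upwards [eventually_ge_atTop ⌈2 / d y⌉₊] with k hk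
    have h1 : 2 / d y ≤ k := (Nat.le_ceil _).trans (by exact_mod_cast hk)
    rw [div_le_iff₀ hpos] at h1
    rw [Real.smoothTransition.one_of_one_le (by linarith), sub_self]

variable {F}

/-- The pull-back metric, modified near the points which are not good. -/
def blendForm (F : PLMap K L) (g : PiecewiseRiemannianMetric L) (χ : (V → ℝ) → ℝ) (Λ ε : ℝ)
    (y : V → ℝ) : (V → ℝ) →ₗ[ℝ] (V → ℝ) →ₗ[ℝ] ℝ :=
  -- For `Λ` as in `exists_form_le`, the multiple `Λ • stdForm V` dominates the pull-back, hence so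
  -- does the blend. The `ε` term makes the form definite where the derivative of `F` degenerates.
  (1 - χ y) • F.pullback g y + (χ y * Λ + ε) • stdForm V

theorem blendForm_apply (χ : (V → ℝ) → ℝ) (Λ ε : ℝ) (y v w : V → ℝ) :
    F.blendForm g χ Λ ε y v w =
      (1 - χ y) * F.pullback g y v w + (χ y * Λ + ε) * stdForm V v w := rfl

theorem IsCutoff.eq_one {χ : (V → ℝ) → ℝ} (hχ : F.IsCutoff χ) {y : V → ℝ} (hy : y ∈ realization K)
    (hb : ¬ F.IsGood y) : χ y = 1 := (hχ.eventually_eq y hy hb).self_of_nhds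

theorem IsGood.eq_carrier {s : Finset V} (hs : s ∈ K.faces) {y : V → ℝ} (hy : F.IsGood y)
    (hys : y ∈ closedSimplex s) : s = carrier y :=
  (Finset.eq_of_subset_of_card_le (carrier_subset hys) (hy.2.1 ▸ card_le_dim hs)).symm

theorem IsGood.image_mem {y : V → ℝ} (hy : F.IsGood y) :
    carrier (F.toFun y) ∈ L.faces ∧ F.toFun y ∈ closedSimplex (carrier (F.toFun y)) := by
  have h := mem_realization_iff.mp (F.mem _ hy.1)
  exact ⟨h.2, mem_closedSimplex_carrier h.1⟩

/-- At points that are not good the selected derivative need not be tangent to a simplex of `L`, so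
nothing is known about the sign of the pull-back. There `χ = 1` removes it. -/
theorem le_blendForm {χ : (V → ℝ) → ℝ} (hχ : F.IsCutoff χ) {Λ ε : ℝ} (hΛ : 0 ≤ Λ) {s : Finset V}
    (hs : s ∈ K.faces) {y : V → ℝ} (hy : y ∈ closedSimplex s) {v : V → ℝ}
    (hv : v ∈ tangentSpace s) : ε * stdForm V v v ≤ F.blendForm g χ Λ ε y v v := by
  rw [blendForm_apply]
  have h1 := stdForm_self_nonneg v
  have h2 := mul_nonneg (mul_nonneg (hχ.nonneg y) hΛ) h1
  by_cases hg : F.IsGood y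
  · have hsy := hg.eq_carrier hs hy
    rw [hsy] at hv
    have h3 : 0 ≤ F.pullback g y v v :=
      form_self_nonneg g hg.image_mem.1 hg.image_mem.2 (hg.lin_mem_tangentSpace hv)
    have h4 := mul_nonneg (sub_nonneg.mpr (hχ.le_one y)) h3
    nlinarith
  · rw [hχ.eq_one (closedSimplex_subset_realization hs hy) hg] at h2 ⊢
    nlinarith

/-- The pull-back metric, modified near the points which are not good. -/
def blendMetric (F : PLMap K L) (g : PiecewiseRiemannianMetric L) {χ : (V → ℝ) → ℝ}
    (hχ : F.IsCutoff χ) {Λ ε : ℝ} (hΛ : 0 ≤ Λ) (hε : 0 < ε) : PiecewiseRiemannianMetric K where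
  form _ y := F.blendForm g χ Λ ε y
  symm := by
    intro s hs x hx v hv w hw
    rw [blendForm_apply, blendForm_apply, stdForm_comm v w]
    congr 1
    by_cases hg : F.IsGood x
    · have hsy := hg.eq_carrier hs hx
      rw [hsy] at hv hw
      rw [pullback_apply, pullback_apply, g.symm _ hg.image_mem.1 _ hg.image_mem.2 _
        (hg.lin_mem_tangentSpace hv) _ (hg.lin_mem_tangentSpace hw)]
    · rw [hχ.eq_one (closedSimplex_subset_realization hs hx) hg, sub_self, zero_mul, zero_mul]
  pos := by
    intro s hs x hx v hv hv0
    exact lt_of_lt_of_le (mul_pos hε (stdForm_self_pos hv0)) (le_blendForm g hχ hΛ hs hx hv)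
  smooth := by
    intro s hs v hv w hw x hx
    simp only [blendForm_apply]
    have hχx : ContDiffWithinAt ℝ ∞ χ (closedSimplex s) x := hχ.smooth.contDiffWithinAt
    have hc : ContDiffWithinAt ℝ ∞ (fun _ : V → ℝ => stdForm V v w) (closedSimplex s) x :=
      contDiffWithinAt_const
    have hstd : ContDiffWithinAt ℝ ∞ (fun y => (χ y * Λ + ε) * stdForm V v w) (closedSimplex s) x :=
      ((hχx.mul contDiffWithinAt_const).add contDiffWithinAt_const).mul hc
    refine ContDiffWithinAt.add ?_ hstd
    -- Near a good point the pull-back is `g` composed with a fixed affine map and evaluated on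
    -- fixed vectors. Near any other point its coefficient vanishes identically.
    by_cases hg : F.IsGood x
    · have hsy := hg.eq_carrier hs hx
      subst hsy
      have hmono := nhdsWithin_mono x (closedSimplex_subset_realization hs)
      let Φ : (V → ℝ) → (W → ℝ) := fun y u => (F.sel x u).eval y
      have hΦ : ContDiff ℝ ∞ Φ := by
        refine contDiff_pi.mpr fun u => ?_
        exact ((LinearMap.toContinuousLinearMap (F.sel x u).1).contDiff).add contDiff_const
      have hΦx : Φ x = F.toFun x := funext fun u => F.eval_sel x u
      have hform := g.smooth _ hg.image_mem.1 _ (hg.lin_mem_tangentSpace hv) _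
        (hg.lin_mem_tangentSpace hw) (Φ x) (hΦx ▸ hg.image_mem.2)
      have hpre : ∀ᶠ y in 𝓝[closedSimplex (carrier x)] x,
          Φ y ∈ closedSimplex (carrier (F.toFun x)) ∧ F.pullback g y v w =
            g.form (carrier (F.toFun x)) (Φ y) (F.lin x v) (F.lin x w) := by
        filter_upwards [hmono hg.eventually] with y hy
        obtain ⟨hyg, hyc, hyF, hycF, hyl⟩ := hy
        have hΦy : Φ y = F.toFun y := funext fun u => (hyF u).symm
        refine ⟨by rw [hΦy, ← hycF]; exact hyg.image_mem.2, ?_⟩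
        rw [pullback_apply, hycF, hyl v hv, hyl w hw, hΦy]
      have hcomp : ContDiffWithinAt ℝ ∞
          (fun y => g.form (carrier (F.toFun x)) (Φ y) (F.lin x v) (F.lin x w))
          (closedSimplex (carrier x)) x :=
        hform.comp_of_preimage_mem_nhdsWithin x hΦ.contDiffWithinAt (hpre.mono fun y hy => hy.1)
      refine (contDiffWithinAt_const.sub hχx).mul (hcomp.congr_of_eventuallyEq ?_ ?_)
      · exact hpre.mono fun y hy => hy.2
      · exact (hpre.self_of_nhdsWithin hx).2
    · have h1 : (fun y => (1 - χ y) * F.pullback g y v w) =ᶠ[𝓝 x] fun _ => 0 := by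
        filter_upwards [hχ.eventually_eq x (closedSimplex_subset_realization hs hx) hg] with y hy
        rw [hy, sub_self, zero_mul]
      exact (contDiffAt_const.congr_of_eventuallyEq h1).contDiffWithinAt
  compat := fun _ _ _ _ _ _ _ _ _ _ _ => rfl

theorem isUniformlyPositive_blendMetric {χ : (V → ℝ) → ℝ} (hχ : F.IsCutoff χ) {Λ ε : ℝ}
    (hΛ : 0 ≤ Λ) (hε : 0 < ε) : IsUniformlyPositive (F.blendMetric g hχ hΛ hε) := by
  refine ⟨ε, hε, fun s hs x hx v hv => ?_⟩
  refine le_trans ?_ (le_blendForm g hχ hΛ hs hx hv)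
  gcongr
  exact sq_norm_le_stdForm v

/-- At a good point all selections define the same pull-back. Elsewhere the form is `(Λ + ε) •
stdForm V`, which dominates every selection; this is why `Λ` is required to bound all of them. -/
theorem isNonexpanding_blendMetric {χ : (V → ℝ) → ℝ} (hχ : F.IsCutoff χ) {Λ ε : ℝ}
    (hΛ : 0 ≤ Λ) (hε : 0 < ε)
    (hΛF : ∀ A : W → AffineFn V, (∀ w, A w ∈ F.pieces) →
      ∀ T ∈ L.faces, ∀ z ∈ closedSimplex T, ∀ v : V → ℝ, (fun w => (A w).1 v) ∈ tangentSpace T →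
        g.form T z (fun w => (A w).1 v) (fun w => (A w).1 v) ≤ Λ * stdForm V v v) :
    IsNonexpanding F (F.blendMetric g hχ hΛ hε) g := by
  intro y hy v hv A hA hAy hvA
  change _ ≤ F.blendForm g χ Λ ε y v v
  rw [blendForm_apply]
  have hFy := mem_realization_iff.mp (F.mem _ hy)
  have h1 := hΛF A hA _ hFy.2 _ (mem_closedSimplex_carrier hFy.1) v hvA
  have h2 := mul_nonneg hε.le (stdForm_self_nonneg v)
  by_cases hg : F.IsGood y
  · rw [pullback_apply, hg.lin_eq hA hAy hv]
    have h3 := mul_le_mul_of_nonneg_left h1 (hχ.nonneg y)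
    nlinarith
  · rw [hχ.eq_one hy hg]
    nlinarith

end PLMap

end PullbackMetric

/-! ### Volumes in charts -/

section Charts

variable {V : Type*} [Fintype V] {K : AbstractSimplicialComplex V}

theorem chart_apply {s : Finset V} {b : V} (y : ChartIndex s b → ℝ) (v : ChartIndex s b) :
    chart s b y v.1 = y v := by
  classical
  have h1 : ∀ u : ChartIndex s b, (v.1 = u.1) = (v = u) := fun u =>
    propext ⟨fun h => Subtype.ext h, fun h => h ▸ rfl⟩
  simp only [chart, edgeVector, Pi.add_apply, Finset.sum_apply, Pi.smul_apply, Pi.sub_apply,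
    Pi.single_apply, smul_eq_mul, if_neg v.2.2, h1]
  simp

theorem sum_chart {s : Finset V} {b : V} (y : ChartIndex s b → ℝ) : ∑ v, chart s b y v = 1 := by
  classical
  simp only [chart, edgeVector, Pi.add_apply, Finset.sum_apply, Pi.smul_apply, Pi.sub_apply,
    smul_eq_mul, Finset.sum_add_distrib]
  rw [Finset.sum_comm]
  simp [← Finset.mul_sum]

theorem chart_apply_of_notMem {s : Finset V} {b : V} (hb : b ∈ s) (y : ChartIndex s b → ℝ) {u : V}
    (hu : u ∉ s) : chart s b y u = 0 := by
  classical
  have h1 : ∀ v : ChartIndex s b, u ≠ v.1 := fun v h => hu (h ▸ v.2.1)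
  have h2 : u ≠ b := fun h => hu (h ▸ hb)
  simp [chart, edgeVector, h1, h2]

theorem chart_apply_base {s : Finset V} {b : V} (hb : b ∈ s) (y : ChartIndex s b → ℝ) :
    chart s b y b = 1 - ∑ v, y v := by
  have h := sum_chartIndex hb (chart s b y) fun u hu => chart_apply_of_notMem hb y hu
  simp only [chart_apply, sum_chart] at h
  linarith

theorem chart_mem_closedSimplex {s : Finset V} {b : V} (hb : b ∈ s) {y : ChartIndex s b → ℝ}
    (hy : y ∈ chartDomain s b) : chart s b y ∈ closedSimplex s := by
  refine ⟨⟨fun u => ?_, sum_chart y⟩, fun u hu => chart_apply_of_notMem hb y hu⟩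
  by_cases hu : u ∈ s
  · rcases eq_or_ne u b with rfl | hub
    · rw [chart_apply_base hb]; linarith [hy.2]
    · exact (chart_apply y ⟨u, hu, hub⟩).symm ▸ hy.1 _
  · rw [chart_apply_of_notMem hb y hu]

theorem chart_coords {s : Finset V} {b : V} (hb : b ∈ s) {x : V → ℝ} (hx : x ∈ closedSimplex s) :
    chart s b (fun v => x v.1) = x := by
  funext u
  by_cases hu : u ∈ s
  · rcases eq_or_ne u b with rfl | hub
    · rw [chart_apply_base hb, sum_chartIndex hb x hx.2, hx.1.2]; ring
    · exact chart_apply (fun v => x v.1) ⟨u, hu, hub⟩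
  · rw [chart_apply_of_notMem hb _ hu, hx.2 u hu]

theorem coords_mem_chartDomain {s : Finset V} {b : V} (hb : b ∈ s) {x : V → ℝ}
    (hx : x ∈ closedSimplex s) : (fun v : ChartIndex s b => x v.1) ∈ chartDomain s b := by
  refine ⟨fun v => hx.1.1 v.1, ?_⟩
  rw [sum_chartIndex hb x hx.2, hx.1.2]
  linarith [hx.1.1 b]

theorem continuous_chart (s : Finset V) (b : V) : Continuous (chart s b) := by
  unfold chart; fun_prop

theorem isClosed_chartDomain (s : Finset V) (b : V) : IsClosed (chartDomain s b) := by
  have : chartDomain s b = (⋂ v, {y | 0 ≤ y v}) ∩ {y | ∑ v, y v ≤ 1} := by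
    ext y; simp [chartDomain]
  rw [this]
  refine (isClosed_iInter fun v => isClosed_le continuous_const (continuous_apply v)).inter
    (isClosed_le (by fun_prop) continuous_const)

theorem isCompact_chartDomain (s : Finset V) (b : V) : IsCompact (chartDomain s b) := by
  refine (isCompact_Icc (a := (0 : ChartIndex s b → ℝ)) (b := 1)).of_isClosed_subset
    (isClosed_chartDomain s b) fun y hy => ⟨hy.1, fun v => ?_⟩
  exact (Finset.single_le_sum (fun u _ => hy.1 u) (Finset.mem_univ v)).trans hy.2

theorem volume_chartDomain_pos (s : Finset V) (b : V) : 0 < volume (chartDomain s b) := by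
  let U : Set (ChartIndex s b → ℝ) := (⋂ v, {y | 0 < y v}) ∩ {y | ∑ v, y v < 1}
  have hU : IsOpen U := (isOpen_iInter_of_finite fun v => isOpen_lt continuous_const
    (continuous_apply v)).inter (isOpen_lt (by fun_prop) continuous_const)
  have hne : U.Nonempty := by
    refine ⟨fun _ => ((Fintype.card (ChartIndex s b) : ℝ) + 1)⁻¹, ?_, ?_⟩
    · exact Set.mem_iInter.mpr fun v => by
        change (0 : ℝ) < _
        positivity
    · change ∑ _v : ChartIndex s b, _ < (1 : ℝ)
      rw [Finset.sum_const, Finset.card_univ, nsmul_eq_mul, ← div_eq_mul_inv,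
        div_lt_one (by positivity)]
      linarith
  refine (hU.measure_pos volume hne).trans_le (measure_mono ?_)
  rintro y ⟨h1, h2⟩
  exact ⟨fun v => (Set.mem_iInter.mp h1 v).le, h2.le⟩

theorem card_chartIndex {s : Finset V} {b : V} (hb : b ∈ s) :
    Fintype.card (ChartIndex s b) = s.card - 1 := by
  classical
  have h := sum_chartIndex hb (fun v => if v ∈ s then (1 : ℤ) else 0) fun v hv => if_neg hv
  have h1 : ∀ v : ChartIndex s b, (if v.1 ∈ s then (1 : ℤ) else 0) = 1 := fun v => if_pos v.2.1
  simp only [h1, hb, if_true, Finset.sum_ite_mem, Finset.univ_inter, Finset.sum_const,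
    Finset.card_univ, nsmul_eq_mul, mul_one] at h
  have := Finset.card_pos.mpr ⟨b, hb⟩
  omega

open Classical in
theorem sum_smul_edgeVector_apply {s : Finset V} {b : V} (x : ChartIndex s b → ℝ)
    (v : ChartIndex s b) : (∑ u, x u • edgeVector b u.1) v.1 = x v := by
  have h := chart_apply x v
  rwa [chart, Pi.add_apply, Pi.single_eq_of_ne v.2.2, zero_add] at h

variable (g : PiecewiseRiemannianMetric K)

open Classical in
/-- The Gram matrix of a metric in a chart. -/
def gram (s : Finset V) (b : V) (y : ChartIndex s b → ℝ) :
    Matrix (ChartIndex s b) (ChartIndex s b) ℝ :=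
  Matrix.of fun v w => g.form s (chart s b y) (edgeVector b v.1) (edgeVector b w.1)

open Classical in
/-- The density of the Riemannian volume in a chart. -/
def density (s : Finset V) (b : V) (y : ChartIndex s b → ℝ) : ℝ≥0∞ :=
  ENNReal.ofReal (Real.sqrt (gram g s b y).det)

/-- The volume of the simplex `s`, computed in the chart at `b`. -/
def chartVolume (s : Finset V) (b : V) : ℝ≥0∞ := ∫⁻ y in chartDomain s b, density g s b y

theorem continuousOn_gram {s : Finset V} (hs : s ∈ K.faces) {b : V} (hb : b ∈ s) :
    ContinuousOn (gram g s b) (chartDomain s b) := by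
  refine continuousOn_pi.mpr fun v => continuousOn_pi.mpr fun w => ?_
  exact (g.smooth s hs _ (edgeVector_mem_tangentSpace hb v.2.1) _
    (edgeVector_mem_tangentSpace hb w.2.1)).continuousOn.comp (continuous_chart s b).continuousOn
      fun y hy => chart_mem_closedSimplex hb hy

open Classical in
theorem continuousOn_sqrt_det_gram {s : Finset V} (hs : s ∈ K.faces) {b : V} (hb : b ∈ s) :
    ContinuousOn (fun y => Real.sqrt (gram g s b y).det) (chartDomain s b) :=
  (Real.continuous_sqrt.comp (Continuous.matrix_det continuous_id)).comp_continuousOn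
    (continuousOn_gram g hs hb)

theorem continuousOn_density {s : Finset V} (hs : s ∈ K.faces) {b : V} (hb : b ∈ s) :
    ContinuousOn (density g s b) (chartDomain s b) :=
  ENNReal.continuous_ofReal.comp_continuousOn (continuousOn_sqrt_det_gram g hs hb)

open Classical in
theorem posDef_gram {s : Finset V} (hs : s ∈ K.faces) {b : V} (hb : b ∈ s) {y : ChartIndex s b → ℝ}
    (hy : y ∈ chartDomain s b) : (gram g s b y).PosDef := by
  have hc := chart_mem_closedSimplex hb hy
  have he : ∀ v : ChartIndex s b, edgeVector b v.1 ∈ tangentSpace s := fun v =>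
    edgeVector_mem_tangentSpace hb v.2.1
  refine Matrix.PosDef.of_dotProduct_mulVec_pos ?_ fun x hx => ?_
  · ext v w
    simp only [Matrix.conjTranspose_apply, gram, Matrix.of_apply, star_trivial]
    exact g.symm s hs _ hc _ (he w) _ (he v)
  · set z : V → ℝ := ∑ v, x v • edgeVector b v.1 with hz
    have hzt : z ∈ tangentSpace s := by
      refine ⟨fun u hu => ?_, ?_⟩
      · simp only [hz, Finset.sum_apply, Pi.smul_apply]
        exact Finset.sum_eq_zero fun v _ => by rw [(he v).1 u hu, smul_zero]
      · simp only [hz, Finset.sum_apply, Pi.smul_apply, smul_eq_mul]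
        rw [Finset.sum_comm]
        exact Finset.sum_eq_zero fun v _ => by rw [← Finset.mul_sum, (he v).2, mul_zero]
    have hz0 : z ≠ 0 := by
      intro h0
      apply hx
      funext v
      rw [← sum_smul_edgeVector_apply x v, ← hz, h0]; rfl
    have h := g.pos s hs _ hc z hzt hz0
    refine h.trans_eq ?_
    simp only [hz, map_sum, LinearMap.sum_apply, map_smul, LinearMap.smul_apply, smul_eq_mul,
      dotProduct, Matrix.mulVec, gram, Matrix.of_apply, star_trivial, Pi.star_apply, Finset.mul_sum]
    rw [Finset.sum_comm]
    refine Finset.sum_congr rfl fun v _ => Finset.sum_congr rfl fun w _ => by ring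

theorem chartVolume_pos {s : Finset V} (hs : s ∈ K.faces) {b : V} (hb : b ∈ s) :
    0 < chartVolume g s b := by
  classical
  rw [chartVolume, pos_iff_ne_zero, Ne, lintegral_eq_zero_iff'
    ((continuousOn_density g hs hb).aemeasurable (isClosed_chartDomain s b).measurableSet)]
  intro h
  rw [Filter.EventuallyEq, ae_restrict_iff' (isClosed_chartDomain s b).measurableSet] at h
  refine (volume_chartDomain_pos s b).ne' (measure_mono_null ?_ h)
  intro y hy hy'
  have h1 : 0 < density g s b y :=
    ENNReal.ofReal_pos.mpr (Real.sqrt_pos.mpr (posDef_gram g hs hb hy).det_pos)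
  exact h1.ne' (hy' hy)

theorem chartVolume_lt_top {s : Finset V} (hs : s ∈ K.faces) {b : V} (hb : b ∈ s) :
    chartVolume g s b < ⊤ := by
  classical
  exact ((continuousOn_sqrt_det_gram g hs hb).integrableOn_compact
    (isCompact_chartDomain s b)).lintegral_lt_top

variable (K) in
open Classical in
/-- The simplices of top dimension. -/
def topFaces : Finset (Finset V) :=
  Finset.univ.filter fun s : Finset V => s ∈ K.faces ∧ s.card = dim K + 1

open Classical in
/-- The vertex of a simplex used for its chart. -/
def baseVertex [Nonempty V] (s : Finset V) : V :=
  if h : s.Nonempty then h.choose else Classical.arbitrary V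

theorem baseVertex_mem {U : Type*} [Nonempty U] {K : AbstractSimplicialComplex U} {s : Finset U}
    (hs : s ∈ K.faces) : baseVertex s ∈ s := by
  rw [baseVertex, dif_pos (face_nonempty hs)]
  exact (face_nonempty hs).choose_spec

theorem mem_topFaces {s : Finset V} : s ∈ topFaces K ↔ s ∈ K.faces ∧ s.card = dim K + 1 := by
  simp [topFaces]

theorem topFaces_nonempty [Nonempty V] : (topFaces K).Nonempty := by
  classical
  have hne : (Finset.univ.filter (fun s : Finset V => s ∈ K.faces)).Nonempty :=
    ⟨{Classical.arbitrary V}, by simpa using K.singleton_mem _⟩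
  obtain ⟨s, hs, h⟩ := Finset.exists_mem_eq_sup _ hne (fun s : Finset V => s.card - 1)
  have hs' : s ∈ K.faces := by simpa using hs
  refine ⟨s, mem_topFaces.mpr ⟨hs', ?_⟩⟩
  have h1 : dim K = s.card - 1 := h
  have := Finset.card_pos.mpr (face_nonempty hs')
  omega

/-- Charts map their domains into the realization, so no mass is lost in restricting to the subtype.
`baseVertex` is the same choice of vertex as in `volumeMeasure`. -/
theorem totalVolume_eq_sum [Nonempty V] :
    totalVolume g = ∑ s ∈ topFaces K, chartVolume g s (baseVertex s) := by
  classical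
  have hm : MeasurableSet (realization K) := (isCompact_realization K).isClosed.measurableSet
  rw [totalVolume, volumeMeasure, Measure.comap_apply _ Subtype.val_injective
    (fun t ht => hm.subtype_image ht) _ MeasurableSet.univ, Set.image_univ, Subtype.range_val,
    Measure.finsetSum_apply]
  refine Finset.sum_congr rfl fun s hs => ?_
  have hs' := (mem_topFaces.mp hs).1
  have hb := baseVertex_mem hs'
  rw [dif_pos (face_nonempty hs'), simplexMeasure]
  have hbase : (face_nonempty hs').choose = baseVertex s := by
    rw [baseVertex, dif_pos (face_nonempty hs')]
  rw [hbase, Measure.map_apply (continuous_chart _ _).measurable hm,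
    withDensity_apply _ ((continuous_chart _ _).measurable hm), Measure.restrict_restrict
      ((continuous_chart _ _).measurable hm), Set.inter_eq_right.mpr]
  · rfl
  · exact fun y hy => closedSimplex_subset_realization hs' (chart_mem_closedSimplex hb hy)

theorem totalVolume_pos [Nonempty V] : 0 < totalVolume g := by
  obtain ⟨s, hs⟩ := topFaces_nonempty (K := K)
  rw [totalVolume_eq_sum]
  have h := chartVolume_pos g (mem_topFaces.mp hs).1 (baseVertex_mem (mem_topFaces.mp hs).1)
  exact h.trans_le (Finset.single_le_sum (f := fun s => chartVolume g s (baseVertex s))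
    (fun _ _ => zero_le) hs)

theorem totalVolume_lt_top [Nonempty V] : totalVolume g < ⊤ := by
  rw [totalVolume_eq_sum]
  exact ENNReal.sum_lt_top.mpr fun s hs =>
    chartVolume_lt_top g (mem_topFaces.mp hs).1 (baseVertex_mem (mem_topFaces.mp hs).1)

end Charts

/-! ### Affine changes of variables -/

section ChangeOfVariables

open Matrix

variable {ι κ : Type*} [Fintype ι] [Fintype κ] [DecidableEq κ]

/-- `N` has a kernel. This is how the pulled back volume vanishes where the target simplex has
smaller dimension. -/
theorem det_transpose_mul_mul_eq_zero (G : Matrix ι ι ℝ) (N : Matrix ι κ ℝ)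
    (h : Fintype.card ι < Fintype.card κ) : (Nᵀ * G * N).det = 0 := by
  have hker : LinearMap.ker (Matrix.mulVecLin N) ≠ ⊥ :=
    LinearMap.ker_ne_bot_of_finrank_lt (by simpa using h)
  obtain ⟨x, hx, hx0⟩ := Submodule.exists_mem_ne_zero_of_ne_bot hker
  refine Matrix.exists_mulVec_eq_zero_iff.mp ⟨x, hx0, ?_⟩
  have hNx : N *ᵥ x = 0 := by simpa using hx
  rw [← Matrix.mulVec_mulVec, hNx, Matrix.mulVec_zero]

variable [DecidableEq ι]

theorem det_transpose_mul_mul (G : Matrix ι ι ℝ) (N : Matrix ι κ ℝ) (e : κ ≃ ι) :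
    (Nᵀ * G * N).det = (N.submatrix e id).det ^ 2 * G.det := by
  have h : Nᵀ * G * N = (N.submatrix e id)ᵀ * G.submatrix e e * N.submatrix e id := by
    rw [Matrix.transpose_submatrix, Matrix.submatrix_mul_equiv, Matrix.submatrix_mul_equiv,
      Matrix.submatrix_id_id]
  rw [h, Matrix.det_mul, Matrix.det_mul, Matrix.det_transpose, Matrix.det_submatrix_equiv_self]
  ring

/-- The Jacobian of a linear map. -/
def jacobian (N : Matrix ι κ ℝ) : ℝ≥0∞ := ENNReal.ofReal (Real.sqrt (Nᵀ * N).det)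

theorem jacobian_eq (N : Matrix ι κ ℝ) (e : κ ≃ ι) :
    jacobian N = ENNReal.ofReal |(N.submatrix e id).det| := by
  have h := det_transpose_mul_mul 1 N e
  rw [Matrix.mul_one, Matrix.det_one, mul_one] at h
  rw [jacobian, h, Real.sqrt_sq_eq_abs]

theorem ofReal_sqrt_det_transpose_mul_mul (G : Matrix ι ι ℝ) (N : Matrix ι κ ℝ)
    (h : Fintype.card κ = Fintype.card ι) :
    ENNReal.ofReal (Real.sqrt (Nᵀ * G * N).det) =
      jacobian N * ENNReal.ofReal (Real.sqrt G.det) := by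
  have e := Fintype.equivOfCardEq h
  rw [jacobian_eq N e, det_transpose_mul_mul G N e, Real.sqrt_mul (sq_nonneg _),
    Real.sqrt_sq_eq_abs, ENNReal.ofReal_mul (abs_nonneg _)]

/-- An invertible affine change of variables gives equality. For singular `N` the Jacobian is zero,
which leaves only an inequality. -/
theorem lintegral_jacobian_mul_comp_le (N : Matrix ι κ ℝ) (c : ι → ℝ)
    (h : Fintype.card κ = Fintype.card ι) {f : (ι → ℝ) → ℝ≥0∞} (hf : Measurable f) :
    ∫⁻ y, jacobian N * f (c + N *ᵥ y) ≤ ∫⁻ z, f z := by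
  have e := Fintype.equivOfCardEq h
  set M : Matrix κ κ ℝ := N.submatrix e id with hM
  rw [jacobian_eq N e]
  by_cases h0 : M.det = 0
  · simp [← hM, h0]
  let E : (κ → ℝ) ≃ᵐ (ι → ℝ) := MeasurableEquiv.arrowCongr' e (MeasurableEquiv.refl ℝ)
  have hE : MeasurePreserving E volume volume :=
    volume_preserving_arrowCongr' e (MeasurableEquiv.refl ℝ) (MeasurePreserving.id _)
  have hEM : ∀ y, E (M *ᵥ y) = N *ᵥ y := fun y => by
    funext i
    change (M *ᵥ y) (e.symm i) = _
    simp [hM, Matrix.mulVec, dotProduct]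
  have hf' : Measurable fun z : κ → ℝ => f (c + E z) := hf.comp (measurable_const.add E.measurable)
  have h1 : ∫⁻ y, f (c + N *ᵥ y) = ENNReal.ofReal |M.det⁻¹| * ∫⁻ z, f (c + E z) := by
    rw [← smul_eq_mul, ← lintegral_smul_measure, ← Real.map_matrix_volume_pi_eq_smul_volume_pi h0,
      lintegral_map hf' (LinearMap.continuous_of_finiteDimensional _).measurable]
    simp only [Matrix.toLin'_apply, hEM]
  have h2 : ∫⁻ z, f (c + E z) = ∫⁻ z, f z := by
    rw [hE.lintegral_comp (f := fun z => f (c + z)) (hf.comp (measurable_const.add measurable_id))]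
    exact lintegral_add_left_eq_self f c
  rw [lintegral_const_mul' _ _ ENNReal.ofReal_ne_top, h1, h2, ← mul_assoc,
    ← ENNReal.ofReal_mul (abs_nonneg _), ← abs_mul, mul_inv_cancel₀ h0]
  simp

end ChangeOfVariables

/-! ### Almost every point of a top simplex is good. -/

section NullSets

variable {V W : Type*} [Fintype V] [Fintype W] {K : AbstractSimplicialComplex V}
  {L : AbstractSimplicialComplex W}

open Classical in
theorem AffineFn.eval_chart (A : AffineFn V) {s : Finset V} {b : V} (y : ChartIndex s b → ℝ) :
    A.eval (chart s b y) = A.eval (Pi.single b 1) + ∑ v, A.1 (edgeVector b v.1) * y v := by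
  simp only [chart, AffineFn.eval_def, map_add, map_sum, map_smul, smul_eq_mul, mul_comm]
  ring

/-- The zero set of an affine function which does not vanish on a simplex is negligible. -/
theorem AffineFn.volume_zeros_eq_zero (A : AffineFn V) {s : Finset V} {b : V} (hb : b ∈ s)
    {z : V → ℝ} (hz : z ∈ closedSimplex s) (hA : A.eval z ≠ 0) :
    volume {y : ChartIndex s b → ℝ | A.eval (chart s b y) = 0} = 0 := by
  classical
  -- In the chart the zero set is an affine subspace, proper because of the point `z`, hence of
  -- measure zero.
  let S : AffineSubspace ℝ (ChartIndex s b → ℝ) :=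
    { carrier := {y | A.eval (chart s b y) = 0}
      smul_vsub_vadd_mem' := by
        intro c p₁ p₂ p₃ h1 h2 h3
        simp only [Set.mem_ofPred_eq, AffineFn.eval_chart] at h1 h2 h3 ⊢
        have : ∀ v, A.1 (edgeVector b v.1) * (c • (p₁ -ᵥ p₂) +ᵥ p₃) v =
            c * (A.1 (edgeVector b v.1) * p₁ v) - c * (A.1 (edgeVector b v.1) * p₂ v) +
              A.1 (edgeVector b v.1) * p₃ v := fun v => by
          simp only [vadd_eq_add, vsub_eq_sub, Pi.add_apply, Pi.smul_apply, Pi.sub_apply, smul_eq_mul]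
          ring
        simp only [this, Finset.sum_add_distrib, Finset.sum_sub_distrib, ← Finset.mul_sum]
        linear_combination c * h1 - c * h2 + h3 }
  refine Measure.addHaar_affineSubspace volume S fun hS => hA ?_
  have h : (fun v : ChartIndex s b => z v.1) ∈ S := by rw [hS]; trivial
  have h' : A.eval (chart s b fun v => z v.1) = 0 := h
  rwa [chart_coords hb hz] at h'

/-- Almost every point of a simplex of top dimension is good. -/
theorem PLMap.ae_isGood (F : PLMap K L) {s : Finset V} (hs : s ∈ K.faces)
    (hcard : s.card = dim K + 1) {b : V} (hb : b ∈ s) :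
    ∀ᵐ y ∂(volume.restrict (chartDomain s b)), F.IsGood (chart s b y) ∧
      carrier (chart s b y) = s := by
  classical
  rw [ae_restrict_iff' (isClosed_chartDomain s b).measurableSet]
  -- The exceptional points lie on finitely many hyperplanes: those of the facets, and the walls
  -- where two pieces distinct on `s` agree.
  have h1 : ∀ u ∈ s, ∀ᵐ y : ChartIndex s b → ℝ, chart s b y u ≠ 0 := by
    intro u hu
    let A : AffineFn V := (LinearMap.proj u, 0)
    have hA : ∀ z, A.eval z = z u := fun z => by simp [A, AffineFn.eval_def]
    have h := A.volume_zeros_eq_zero hb (single_mem_closedSimplex hu) (by rw [hA]; simp)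
    simp only [hA] at h
    exact measure_eq_zero_iff_ae_notMem.mp h
  have h2 : ∀ A ∈ F.pieces, ∀ B ∈ F.pieces, ∀ᵐ y : ChartIndex s b → ℝ,
      A.eval (chart s b y) = B.eval (chart s b y) → ∀ z ∈ closedSimplex s, A.eval z = B.eval z := by
    intro A _ B _
    by_cases h : ∀ z ∈ closedSimplex s, A.eval z = B.eval z
    · exact ae_of_all _ fun y _ => h
    · push Not at h
      obtain ⟨z, hz, hne⟩ := h
      have hsub : ∀ z, (A - B).eval z = A.eval z - B.eval z := fun z => by
        simp only [AffineFn.eval_def, Prod.fst_sub, Prod.snd_sub, LinearMap.sub_apply]; ring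
      have h := (A - B).volume_zeros_eq_zero hb hz (by rw [hsub]; exact sub_ne_zero.mpr hne)
      filter_upwards [measure_eq_zero_iff_ae_notMem.mp h] with y hy hAB
      exact absurd (by rw [hsub, hAB, sub_self]) hy
  have h1' := (ae_ball_iff s.countable_toSet).mpr h1
  have h2' := (ae_ball_iff F.finite_pieces.countable).mpr fun A hA =>
    (ae_ball_iff F.finite_pieces.countable).mpr (h2 A hA)
  filter_upwards [h1', h2'] with y hy1 hy2 hyD
  have hmem := chart_mem_closedSimplex hb hyD
  have hcar : carrier (chart s b y) = s :=
    (carrier_subset hmem).antisymm fun u hu => mem_carrier.mpr (hy1 u hu)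
  exact ⟨⟨closedSimplex_subset_realization hs hmem, by rw [hcar, hcard], by rw [hcar]; exact hy2⟩,
    hcar⟩

end NullSets

/-! ### The volume of the pull-back metric -/

section PullbackVolume

open Matrix

variable {V W : Type*} [Fintype V] [Fintype W] {K : AbstractSimplicialComplex V}
  {L : AbstractSimplicialComplex W}

namespace PLMap

variable (F : PLMap K L) (g : PiecewiseRiemannianMetric L)

open Classical in
/-- The density of the pulled back volume in a chart. -/
def pullbackDensity (s : Finset V) (b : V) (y : ChartIndex s b → ℝ) : ℝ≥0∞ :=
  ENNReal.ofReal (Real.sqrt (Matrix.of fun v w : ChartIndex s b =>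
    F.pullback g (chart s b y) (edgeVector b v.1) (edgeVector b w.1)).det)

open Classical in
/-- The affine selections of `F`. -/
def selections : Finset (W → AffineFn V) := Fintype.piFinset fun _ => F.finite_pieces.toFinset

open Classical in
/-- The linear part, in charts, of the map with components `A`. -/
def chartMatrix (A : W → AffineFn V) (s : Finset V) (b : V) (T : Finset W) (c : W) :
    Matrix (ChartIndex T c) (ChartIndex s b) ℝ :=
  Matrix.of fun i v => (A i.1).1 (edgeVector b v.1)

open Classical in
theorem add_chartMatrix_mulVec {U : Type*} (A : U → AffineFn V) (s : Finset V) (b : V)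
    (T : Finset U) (c : U)
    (y : ChartIndex s b → ℝ) :
    (fun i : ChartIndex T c => (A i.1).eval (Pi.single b 1)) + chartMatrix A s b T c *ᵥ y =
      fun i => (A i.1).eval (chart s b y) := by
  funext i
  rw [AffineFn.eval_chart]
  rfl

-- The transformation rule of Gram matrices, with the derivative of `F` written in the charts of the
-- two simplices.
variable {F} in
open Classical in
theorem IsGood.pullback_eq {s : Finset V} {b : V} (hb : b ∈ s) {y : ChartIndex s b → ℝ}
    (hg : F.IsGood (chart s b y)) (hcar : carrier (chart s b y) = s) {c : W}
    (hc : c ∈ carrier (F.toFun (chart s b y))) :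
    (Matrix.of fun v w : ChartIndex s b =>
      F.pullback g (chart s b y) (edgeVector b v.1) (edgeVector b w.1)) =
      (chartMatrix (F.sel (chart s b y)) s b (carrier (F.toFun (chart s b y))) c).transpose *
        gram g (carrier (F.toFun (chart s b y))) c
          (fun i => (F.sel (chart s b y) i.1).eval (chart s b y)) *
        chartMatrix (F.sel (chart s b y)) s b (carrier (F.toFun (chart s b y))) c := by
  set x := chart s b y with hx
  have hz : chart (carrier (F.toFun x)) c (fun i => (F.sel x i.1).eval x) = F.toFun x := by
    simp only [F.eval_sel]
    exact chart_coords hc hg.image_mem.2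
  have hlin : ∀ v : ChartIndex s b, F.lin x (edgeVector b v.1) =
      ∑ i : ChartIndex (carrier (F.toFun x)) c,
        (F.sel x i.1).1 (edgeVector b v.1) • edgeVector c i.1 := fun v =>
    eq_sum_edgeVector hc (hg.lin_mem_tangentSpace
      (hcar.symm ▸ edgeVector_mem_tangentSpace hb v.2.1))
  ext v w
  rw [Matrix.of_apply, pullback_apply, hlin v, hlin w]
  simp only [map_sum, LinearMap.sum_apply, map_smul, LinearMap.smul_apply, smul_eq_mul,
    Matrix.mul_apply, Matrix.transpose_apply, chartMatrix, gram, Matrix.of_apply, hz,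
    Finset.sum_mul, Finset.mul_sum]
  exact Finset.sum_congr rfl fun i _ => Finset.sum_congr rfl fun j _ => by ring

/-- An upper bound which does not involve the cutoff. It provides the dominating function for the
convergence of volumes. -/
theorem blendForm_le {χ : (V → ℝ) → ℝ} (hχ : F.IsCutoff χ) {Λ ε : ℝ}
    (hΛF : ∀ A : W → AffineFn V, (∀ w, A w ∈ F.pieces) →
      ∀ T ∈ L.faces, ∀ z ∈ closedSimplex T, ∀ v : V → ℝ, (fun w => (A w).1 v) ∈ tangentSpace T →
        g.form T z (fun w => (A w).1 v) (fun w => (A w).1 v) ≤ Λ * stdForm V v v)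
    {s : Finset V} (hs : s ∈ K.faces) {y : V → ℝ} (hy : y ∈ closedSimplex s) {v : V → ℝ}
    (hv : v ∈ tangentSpace s) : F.blendForm g χ Λ ε y v v ≤ (Λ + ε) * stdForm V v v := by
  rw [blendForm_apply]
  by_cases hg : F.IsGood y
  · have hsy := hg.eq_carrier hs hy
    rw [hsy] at hv
    have h1 : F.pullback g y v v ≤ Λ * stdForm V v v :=
      hΛF (F.sel y) (F.sel_mem y) _ hg.image_mem.1 _ hg.image_mem.2 v (hg.lin_mem_tangentSpace hv)
    have h2 := mul_le_mul_of_nonneg_left h1 (sub_nonneg.mpr (hχ.le_one y))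
    linarith
  · rw [hχ.eq_one (closedSimplex_subset_realization hs hy) hg]
    linarith

variable [Nonempty W]

open Classical in
/-- At a good point, the density of the pulled back volume is bounded by the sum of the
contributions of all affine selections. -/
theorem pullbackDensity_le (hdim : dim L ≤ dim K) {s : Finset V} (hcard : s.card = dim K + 1)
    {b : V} (hb : b ∈ s) {y : ChartIndex s b → ℝ}
    (hg : F.IsGood (chart s b y)) (hcar : carrier (chart s b y) = s) :
    F.pullbackDensity g s b y ≤ ∑ A ∈ F.selections,
      ∑ T ∈ Finset.univ.filter (fun T : Finset W => T ∈ L.faces ∧ T.card = dim K + 1),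
        jacobian (chartMatrix A s b T (baseVertex T)) *
          (chartDomain T (baseVertex T)).indicator (density g T (baseVertex T))
            ((fun i => (A i.1).eval (Pi.single b 1)) +
              chartMatrix A s b T (baseVertex T) *ᵥ y) := by
  set x := chart s b y with hx
  have hT := hg.image_mem.1
  set T := carrier (F.toFun x) with hTdef
  have hc := baseVertex_mem hT
  have hTc : T.card ≤ dim K + 1 := (card_le_dim hT).trans (by omega)
  have hpos := Finset.card_pos.mpr (face_nonempty hT)
  rw [pullbackDensity, IsGood.pullback_eq g hb hg hcar hc]
  -- If the carrier of the image has smaller dimension the determinant vanishes. Otherwise the term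
  -- of the actual selection and carrier in the double sum is the density itself.
  rcases hTc.lt_or_eq with h | h
  · rw [det_transpose_mul_mul_eq_zero, Real.sqrt_zero, ENNReal.ofReal_zero]
    · exact zero_le
    · rw [card_chartIndex hc, card_chartIndex hb]; omega
  · rw [ofReal_sqrt_det_transpose_mul_mul]
    swap
    · rw [card_chartIndex hc, card_chartIndex hb]; omega
    have hsel : F.sel x ∈ F.selections :=
      Fintype.mem_piFinset.mpr fun w => F.finite_pieces.mem_toFinset.mpr (F.sel_mem x w)
    refine le_trans ?_ (Finset.single_le_sum (fun _ _ => zero_le) hsel)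
    refine le_trans ?_ (Finset.single_le_sum (fun _ _ => zero_le)
      (Finset.mem_filter.mpr ⟨Finset.mem_univ T, hT, h⟩))
    rw [add_chartMatrix_mulVec, Set.indicator_of_mem]
    · rfl
    · simp only [F.eval_sel, ← hx]
      exact coords_mem_chartDomain hc hg.image_mem.2

-- Summing over all affine selections avoids describing the domains on which `F` is affine. By
-- change of variables each selection contributes at most the volume of the target, and there are no
-- target simplices of dimension `dim K` when `dim L < dim K`.
open Classical in
theorem lintegral_pullbackDensity_le (hdim : dim L ≤ dim K) {s : Finset V} (hs : s ∈ K.faces)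
    (hcard : s.card = dim K + 1) {b : V} (hb : b ∈ s) :
    ∫⁻ y in chartDomain s b, F.pullbackDensity g s b y ≤ F.selections.card *
      ∑ T ∈ Finset.univ.filter (fun T : Finset W => T ∈ L.faces ∧ T.card = dim K + 1),
        chartVolume g T (baseVertex T) := by
  have hmeas : ∀ T ∈ Finset.univ.filter (fun T : Finset W => T ∈ L.faces ∧ T.card = dim K + 1),
      Measurable ((chartDomain T (baseVertex T)).indicator (density g T (baseVertex T))) := by
    intro T hT
    have hT' := (Finset.mem_filter.mp hT).2.1
    rw [← Set.piecewise_eq_indicator]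
    exact ContinuousOn.measurable_piecewise (continuousOn_density g hT' (baseVertex_mem hT'))
      continuousOn_const (isClosed_chartDomain _ _).measurableSet
  have hmeas' : ∀ A ∈ F.selections,
      ∀ T ∈ Finset.univ.filter (fun T : Finset W => T ∈ L.faces ∧ T.card = dim K + 1),
      Measurable fun y => jacobian (chartMatrix A s b T (baseVertex T)) *
        (chartDomain T (baseVertex T)).indicator (density g T (baseVertex T))
          ((fun i => (A i.1).eval (Pi.single b 1)) +
            chartMatrix A s b T (baseVertex T) *ᵥ y) := by
    intro A _ T hT
    refine ((hmeas T hT).comp ?_).const_mul _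
    exact (continuous_const.add (Continuous.matrix_mulVec continuous_const continuous_id)).measurable
  have h1 : ∫⁻ y in chartDomain s b, F.pullbackDensity g s b y ≤
      ∫⁻ y in chartDomain s b, ∑ A ∈ F.selections,
      ∑ T ∈ Finset.univ.filter (fun T : Finset W => T ∈ L.faces ∧ T.card = dim K + 1),
        jacobian (chartMatrix A s b T (baseVertex T)) *
          (chartDomain T (baseVertex T)).indicator (density g T (baseVertex T))
            ((fun i => (A i.1).eval (Pi.single b 1)) +
              chartMatrix A s b T (baseVertex T) *ᵥ y) := by
    refine lintegral_mono_ae ?_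
    filter_upwards [F.ae_isGood hs hcard hb] with y hy
    exact F.pullbackDensity_le g hdim hcard hb hy.1 hy.2
  refine h1.trans ((setLIntegral_le_lintegral _ _).trans ?_)
  rw [lintegral_finsetSum _ fun A hA => Finset.measurable_fun_sum _ (hmeas' A hA), ← nsmul_eq_mul]
  refine Finset.sum_le_card_nsmul _ _ _ fun A hA => ?_
  rw [lintegral_finsetSum _ (hmeas' A hA)]
  refine Finset.sum_le_sum fun T hT => ?_
  have hT' := (Finset.mem_filter.mp hT).2
  refine (lintegral_jacobian_mul_comp_le _ _ ?_ (hmeas T hT)).trans_eq ?_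
  · rw [card_chartIndex hb, card_chartIndex (baseVertex_mem hT'.1), hcard, hT'.2]
  · rw [lintegral_indicator (isClosed_chartDomain _ _).measurableSet]; rfl

end PLMap

end PullbackVolume

/-! ### Metrics of controlled volume on the source. -/

section SmallVolume

variable {V W : Type*} [Fintype V] [Fintype W] {K : AbstractSimplicialComplex V}
  {L : AbstractSimplicialComplex W}

open Classical in
/-- The volumes of the modified pull-back metrics converge to the volume of the pull-back metric. -/
theorem PLMap.tendsto_chartVolume (F : PLMap K L) (g : PiecewiseRiemannianMetric L) {Λ : ℝ}
    (hΛ : 0 ≤ Λ)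
    (hΛF : ∀ A : W → AffineFn V, (∀ w, A w ∈ F.pieces) →
      ∀ T ∈ L.faces, ∀ z ∈ closedSimplex T, ∀ v : V → ℝ, (fun w => (A w).1 v) ∈ tangentSpace T →
        g.form T z (fun w => (A w).1 v) (fun w => (A w).1 v) ≤ Λ * stdForm V v v)
    {χ : ℕ → (V → ℝ) → ℝ} (hχ : ∀ k, F.IsCutoff (χ k))
    (hχ0 : ∀ y, F.IsGood y → ∀ᶠ k in atTop, χ k y = 0) {ε : ℕ → ℝ} (hε : ∀ k, 0 < ε k)
    (hε1 : ∀ k, ε k ≤ 1) (hε0 : Tendsto ε atTop (𝓝 0)) {s : Finset V} (hs : s ∈ K.faces)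
    (hcard : s.card = dim K + 1) {b : V} (hb : b ∈ s) :
    Tendsto (fun k => chartVolume (F.blendMetric g (hχ k) hΛ (hε k)) s b) atTop
      (𝓝 (∫⁻ y in chartDomain s b, F.pullbackDensity g s b y)) := by
  have hmD := (isClosed_chartDomain s b).measurableSet
  set M : ℝ := (Λ + 1) * ∑ v : ChartIndex s b, stdForm V (edgeVector b v.1) (edgeVector b v.1)
    with hM
  have he : ∀ v : ChartIndex s b, edgeVector b v.1 ∈ tangentSpace s := fun v =>
    edgeVector_mem_tangentSpace hb v.2.1
  have hdiag : ∀ k, ∀ y ∈ chartDomain s b, ∀ v : ChartIndex s b,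
      (F.blendMetric g (hχ k) hΛ (hε k)).form s (chart s b y) (edgeVector b v.1)
        (edgeVector b v.1) ≤ M := by
    intro k y hy v
    refine (F.blendForm_le g (hχ k) hΛF hs (chart_mem_closedSimplex hb hy) (he v)).trans ?_
    rw [hM]
    gcongr
    · exact stdForm_self_nonneg _
    · exact hε1 k
    · exact Finset.single_le_sum (f := fun v : ChartIndex s b =>
        stdForm V (edgeVector b v.1) (edgeVector b v.1)) (fun v _ => stdForm_self_nonneg _)
        (Finset.mem_univ v)
  have hentry : ∀ k, ∀ y ∈ chartDomain s b, ∀ v w : ChartIndex s b,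
      |gram (F.blendMetric g (hχ k) hΛ (hε k)) s b y v w| ≤ M := by
    intro k y hy v w
    have hM0 : 0 ≤ M := (form_self_nonneg _ hs (chart_mem_closedSimplex hb hy) (he v)).trans
      (hdiag k y hy v)
    calc _ ≤ _ := form_le_sqrt_mul_sqrt _ hs (chart_mem_closedSimplex hb hy) (he v) (he w)
      _ ≤ Real.sqrt M * Real.sqrt M := by
          gcongr
          · exact hdiag k y hy v
          · exact hdiag k y hy w
      _ = M := Real.mul_self_sqrt hM0
  -- The entries of all Gram matrices are at most `M` in absolute value, by Cauchy–Schwarz and the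
  -- bound on the diagonal. So the determinants are at most `n! * M ^ n`.
  refine tendsto_lintegral_of_dominated_convergence' (fun _ => ENNReal.ofReal (Real.sqrt
    ((Fintype.card (ChartIndex s b)).factorial • M ^ Fintype.card (ChartIndex s b))))
    (fun k => (continuousOn_density _ hs hb).aemeasurable hmD) (fun k => ?_) ?_ ?_
  · rw [Filter.EventuallyLE, ae_restrict_iff' hmD]
    refine ae_of_all _ fun y hy => ENNReal.ofReal_le_ofReal (Real.sqrt_le_sqrt ?_)
    exact (le_abs_self _).trans (Matrix.det_le (abv := AbsoluteValue.abs) (hentry k y hy))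
  · rw [lintegral_const, Measure.restrict_apply MeasurableSet.univ, Set.univ_inter]
    exact (ENNReal.mul_lt_top ENNReal.ofReal_lt_top (isCompact_chartDomain s b).measure_lt_top).ne
  · filter_upwards [F.ae_isGood hs hcard hb] with y hy
    have hlim : Tendsto (fun k => gram (F.blendMetric g (hχ k) hΛ (hε k)) s b y) atTop
        (𝓝 (Matrix.of fun v w : ChartIndex s b =>
          F.pullback g (chart s b y) (edgeVector b v.1) (edgeVector b w.1))) := by
      refine tendsto_pi_nhds.mpr fun v => tendsto_pi_nhds.mpr fun w => ?_
      have h1 : Tendsto (fun k => F.pullback g (chart s b y) (edgeVector b v.1) (edgeVector b w.1) +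
          ε k * stdForm V (edgeVector b v.1) (edgeVector b w.1)) atTop
          (𝓝 (F.pullback g (chart s b y) (edgeVector b v.1) (edgeVector b w.1) +
          0 * stdForm V (edgeVector b v.1) (edgeVector b w.1))) :=
        tendsto_const_nhds.add (hε0.mul_const _)
      rw [zero_mul, add_zero] at h1
      refine h1.congr' ?_
      filter_upwards [hχ0 _ hy.1] with k hk
      change _ = F.blendForm g (χ k) Λ (ε k) _ _ _
      rw [blendForm_apply, hk]
      ring
    exact (ENNReal.continuous_ofReal.tendsto _).comp ((Real.continuous_sqrt.tendsto _).comp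
      ((Continuous.matrix_det continuous_id).tendsto _ |>.comp hlim))

/-- There are metrics for which a piecewise affine map is nonexpanding, with volume controlled by
the volume of the target. -/
theorem PLMap.exists_metric [Nonempty V] [Nonempty W] (F : PLMap K L) (hdim : dim L ≤ dim K) :
    ∃ C : ℕ, ∀ (g : PiecewiseRiemannianMetric L) (δ : ℝ≥0∞), 0 < δ →
      ∃ h : PiecewiseRiemannianMetric K, IsNonexpanding F h g ∧ IsUniformlyPositive h ∧
        (∀ s s' x, h.form s x = h.form s' x) ∧
        totalVolume h ≤ C * (if dim L = dim K then totalVolume g else 0) + δ := by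
  classical
  -- The constant counts top simplices and affine selections. It depends on `F` alone and can thus
  -- be fixed before `g` is chosen.
  refine ⟨(topFaces K).card * F.selections.card, fun g δ hδ => ?_⟩
  obtain ⟨Λ, hΛ, hΛF⟩ := F.exists_form_le g
  obtain ⟨χ, hχ, hχ0⟩ := F.exists_cutoff
  let ε : ℕ → ℝ := fun k => 1 / ((k : ℝ) + 1)
  have hε : ∀ k, 0 < ε k := fun k => by positivity
  have hε1 : ∀ k, ε k ≤ 1 := fun k => by
    rw [div_le_one (by positivity)]
    have : (0 : ℝ) ≤ k := Nat.cast_nonneg k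
    linarith
  let h : ℕ → PiecewiseRiemannianMetric K := fun k => F.blendMetric g (hχ k) hΛ (hε k)
  have hlim : Tendsto (fun k => totalVolume (h k)) atTop (𝓝 (∑ s ∈ topFaces K,
      ∫⁻ y in chartDomain s (baseVertex s), F.pullbackDensity g s (baseVertex s) y)) := by
    simp only [totalVolume_eq_sum]
    refine tendsto_finsetSum _ fun s hs => ?_
    have hs' := mem_topFaces.mp hs
    exact F.tendsto_chartVolume g hΛ hΛF hχ hχ0 hε hε1 tendsto_one_div_add_atTop_nhds_zero_nat
      hs'.1 hs'.2 (baseVertex_mem hs'.1)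
  set X : ℝ≥0∞ := ((topFaces K).card * F.selections.card : ℕ) *
    (if dim L = dim K then totalVolume g else 0) with hX
  have hXtop : X ≠ ⊤ := by
    refine (ENNReal.mul_lt_top (ENNReal.natCast_lt_top _) ?_).ne
    split_ifs
    · exact totalVolume_lt_top g
    · exact ENNReal.zero_lt_top
  have hle : ∑ s ∈ topFaces K,
      ∫⁻ y in chartDomain s (baseVertex s), F.pullbackDensity g s (baseVertex s) y ≤ X := by
    have hT : ∑ T ∈ Finset.univ.filter (fun T : Finset W => T ∈ L.faces ∧ T.card = dim K + 1),
        chartVolume g T (baseVertex T) ≤ if dim L = dim K then totalVolume g else 0 := by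
      split_ifs with hd
      · rw [totalVolume_eq_sum]
        refine Finset.sum_le_sum_of_subset fun T hT => ?_
        rw [Finset.mem_filter] at hT
        exact mem_topFaces.mpr ⟨hT.2.1, by rw [hT.2.2, hd]⟩
      · rw [Finset.sum_eq_zero]
        intro T hT
        rw [Finset.mem_filter] at hT
        have := card_le_dim hT.2.1
        omega
    rw [hX, Nat.cast_mul, mul_assoc, ← nsmul_eq_mul (topFaces K).card]
    refine Finset.sum_le_card_nsmul _ _ _ fun s hs => ?_
    have hs' := mem_topFaces.mp hs
    refine (F.lintegral_pullbackDensity_le g hdim hs'.1 hs'.2 (baseVertex_mem hs'.1)).trans ?_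
    gcongr
  obtain ⟨k, hk⟩ := (hlim.eventually_lt_const
    (hle.trans_lt (ENNReal.lt_add_right hXtop hδ.ne'))).exists
  exact ⟨h k, isNonexpanding_blendMetric g (hχ k) hΛ (hε k) hΛF,
    isUniformlyPositive_blendMetric g (hχ k) hΛ (hε k), fun _ _ _ => rfl, hk.le⟩

end SmallVolume

/-! ### Comparison of volume entropies -/

section Entropy

variable {V W : Type*} [Fintype V] [Fintype W] {K : AbstractSimplicialComplex V}
  {L : AbstractSimplicialComplex W}

/-- A ball of radius larger than `D` meets every fiber, so its volume is at least the total volume,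
whose logarithm divided by `t` tends to zero. -/
theorem entropyAt_nonneg [Nonempty V] [PathConnectedSpace (Space K)]
    (g : PiecewiseRiemannianMetric K) (x₀ : Space K) : 0 ≤ entropyAt g x₀ := by
  obtain ⟨D, hD, h⟩ := exists_liftedDist_le g
  have hv0 := (totalVolume_pos g).ne'
  have hvt := (totalVolume_lt_top g).ne
  have hlog := ENNReal.log_pos_real hv0 hvt
  set ℓ : ℝ := Real.log (totalVolume g).toReal
  have hlim : Tendsto (fun t : ℝ => ((ℓ / t : ℝ) : EReal)) atTop (𝓝 ((0 : ℝ) : EReal)) :=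
    (continuous_coe_real_ereal.tendsto _).comp (tendsto_const_nhds.div_atTop tendsto_id)
  rw [← EReal.coe_zero, ← hlim.limsup_eq]
  refine limsup_le_limsup ?_
  filter_upwards [eventually_gt_atTop D] with t ht
  rw [EReal.coe_div, ← hlog]
  refine EReal.div_le_div_right_of_nonneg (by exact_mod_cast (hD.trans_lt ht).le)
    (ENNReal.log_monotone ?_)
  rw [liftedVolume_liftedBall, totalVolume, ← lintegral_one, ← setLIntegral_univ]
  simp only [Measure.restrict_univ]
  refine lintegral_mono fun y => ?_
  obtain ⟨c, hc⟩ := h x₀ y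
  rw [← ENat.toENNReal_one]
  refine ENat.toENNReal_le.mpr (Set.one_le_encard_iff_nonempty.mpr ⟨c, ?_⟩)
  exact hc.trans_lt ((ENNReal.ofReal_lt_ofReal_iff (hD.trans_lt ht)).mpr ht)

theorem normalizedEntropy_nonneg [Nonempty V] [PathConnectedSpace (Space K)]
    (g : PiecewiseRiemannianMetric K) : 0 ≤ normalizedEntropy g := by
  obtain ⟨x₀⟩ : Nonempty (Space K) := PathConnectedSpace.nonempty
  exact mul_nonneg ((entropyAt_nonneg g x₀).trans (le_iSup (entropyAt g) x₀))
    (EReal.coe_ennreal_nonneg _)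

/-- A nonexpanding map which is injective on homotopy classes bounds the entropy. -/
theorem IsNonexpanding.entropyAt_le [Nonempty V] [Nonempty W] [PathConnectedSpace (Space L)]
    {F : PLMap K L} {h : PiecewiseRiemannianMetric K} {g : PiecewiseRiemannianMetric L}
    (hF : IsNonexpanding F h g) (hpos : IsUniformlyPositive h)
    (hind : ∀ s s' x, h.form s x = h.form s' x)
    (hinj : ∀ y y' : Space K,
      Function.Injective fun p : Path.Homotopic.Quotient y y' => p.map F.toContinuousMap)
    (x : Space K) {r : ℝ} (hr : entropyAt g (F.toContinuousMap x) < r) :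
    entropyAt h x ≤ ((2 * r : ℝ) : EReal) := by
  obtain ⟨D, hD, hfib⟩ := exists_fiberCount_mul_totalVolume_le g
  set v : ℝ → ℝ≥0∞ := fun t => liftedVolume g (F.toContinuousMap x)
    (liftedBall g (F.toContinuousMap x) t) with hv
  set c : ℝ≥0∞ := totalVolume h / totalVolume g with hc
  have hc0 : c ≠ 0 := (ENNReal.div_pos (totalVolume_pos h).ne' (totalVolume_lt_top g).ne).ne'
  have hct : c ≠ ⊤ := ENNReal.div_ne_top (totalVolume_lt_top h).ne (totalVolume_pos g).ne'
  have hlog := ENNReal.log_pos_real hc0 hct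
  set ℓ : ℝ := Real.log c.toReal
  -- Each fiber of the `h`-ball is counted in a fiber of a `g`-ball of radius `2 * t`, which is
  -- bounded by volume over total volume. Integration over `K` gives the factor `c`; only counts
  -- pass from `L` to `K`, so the dimensions play no role.
  have hvol : ∀ t, liftedVolume h x (liftedBall h x t) ≤ c * v (2 * t + D) := by
    intro t
    rw [liftedVolume_liftedBall]
    calc ∫⁻ y, fiberCount h x y t ∂(volumeMeasure h)
        ≤ ∫⁻ _, v (2 * t + D) / totalVolume g ∂(volumeMeasure h) := by
          refine lintegral_mono fun y => (hF.fiberCount_le hpos hind hinj x y).trans ?_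
          rw [ENNReal.le_div_iff_mul_le (Or.inl (totalVolume_pos g).ne')
            (Or.inl (totalVolume_lt_top g).ne)]
          exact hfib _ _ _
      _ = c * v (2 * t + D) := by
          rw [lintegral_const, hc, ← totalVolume, ENNReal.div_eq_inv_mul, ENNReal.div_eq_inv_mul]
          ring
  have hev : ∀ᶠ t : ℝ in atTop, ENNReal.log (v (2 * t + D)) / ((2 * t + D : ℝ) : EReal) < r := by
    have h1 : Tendsto (fun t : ℝ => 2 * t + D) atTop atTop :=
      tendsto_atTop_add_const_right _ _ (tendsto_id.const_mul_atTop two_pos)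
    exact h1.eventually (eventually_lt_of_limsup_lt hr)
  have hlim : Tendsto (fun t : ℝ => ((2 * r + (ℓ + r * D) / t : ℝ) : EReal)) atTop
      (𝓝 ((2 * r : ℝ) : EReal)) := by
    refine (continuous_coe_real_ereal.tendsto _).comp ?_
    have h1 : Tendsto (fun t : ℝ => 2 * r + (ℓ + r * D) / t) atTop (𝓝 (2 * r + 0)) :=
      tendsto_const_nhds.add (tendsto_const_nhds.div_atTop tendsto_id)
    rwa [add_zero] at h1
  rw [← hlim.limsup_eq]
  refine limsup_le_limsup ?_
  filter_upwards [hev, eventually_gt_atTop 0] with t ht ht0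
  have h2 : 0 < 2 * t + D := by positivity
  have h3 : ENNReal.log (v (2 * t + D)) ≤ ((r * (2 * t + D) : ℝ) : EReal) := by
    have := (EReal.div_le_iff_le_mul (by exact_mod_cast h2) (EReal.coe_ne_top _)).mp ht.le
    rw [← EReal.coe_mul] at this
    rwa [mul_comm r]
  have h4 : ENNReal.log (liftedVolume h x (liftedBall h x t)) ≤
      ((ℓ + r * (2 * t + D) : ℝ) : EReal) := by
    refine (ENNReal.log_monotone (hvol t)).trans ?_
    rw [ENNReal.log_mul_add, hlog, EReal.coe_add]
    exact add_le_add le_rfl h3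
  refine (EReal.div_le_div_right_of_nonneg (by exact_mod_cast ht0.le) h4).trans ?_
  rw [← EReal.coe_div]
  refine EReal.coe_le_coe_iff.mpr (le_of_eq ?_)
  field_simp
  ring

end Entropy

/-! ### Vanishing of the minimal volume entropy. -/

section Vanishing

variable {V W : Type*} [Fintype V] [Fintype W] {K : AbstractSimplicialComplex V}
  {L : AbstractSimplicialComplex W}

theorem nonempty_of_pathConnectedSpace [PathConnectedSpace (Space K)] : Nonempty V := by
  obtain ⟨x⟩ : Nonempty (Space K) := PathConnectedSpace.nonempty
  obtain ⟨v, -⟩ := carrier_nonempty (mem_realization_iff.mp x.2).1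
  exact ⟨v⟩

/-- A bound for the normalized entropy in terms of bounds for entropy and volume. -/
theorem normalizedEntropy_le {h : PiecewiseRiemannianMetric K} {a q : ℝ} (ha : 0 ≤ a) (hq : 0 ≤ q)
    (he : entropy h ≤ (a : EReal))
    (hv : totalVolume h ^ (1 / (dim K : ℝ)) ≤ ENNReal.ofReal q) :
    normalizedEntropy h ≤ ((a * q : ℝ) : EReal) := by
  rw [normalizedEntropy, EReal.coe_mul]
  refine mul_le_mul he ?_ (EReal.coe_ennreal_nonneg _) (by exact_mod_cast ha)
  refine (EReal.coe_ennreal_le_coe_ennreal_iff.mpr hv).trans ?_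
  rw [EReal.coe_ennreal_ofReal, max_eq_left hq]

/-- If the volume entropy of `L` vanishes then so does the volume entropy of any complex of
at least the same dimension which maps to `L`, injectively on homotopy classes. -/
theorem minimalVolumeEntropy_eq_zero_of_plMap [PathConnectedSpace (Space K)]
    [PathConnectedSpace (Space L)] (F : PLMap K L) (hdim : dim L ≤ dim K)
    (hinj : ∀ y y' : Space K,
      Function.Injective fun p : Path.Homotopic.Quotient y y' => p.map F.toContinuousMap)
    (hL : minimalVolumeEntropy L = 0) : minimalVolumeEntropy K = 0 := by
  have : Nonempty V := nonempty_of_pathConnectedSpace (K := K)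
  have : Nonempty W := nonempty_of_pathConnectedSpace (K := L)
  refine le_antisymm ?_ (le_iInf fun h => normalizedEntropy_nonneg h)
  refine EReal.le_of_forall_lt_iff_le.mp fun z hz => ?_
  have hz0 : 0 < z := by exact_mod_cast hz
  obtain ⟨C, hC⟩ := F.exists_metric hdim
  set B : ℝ := ((C : ℝ) + 1) ^ (1 / (dim K : ℝ)) with hB
  have hB0 : 0 < B := by positivity
  -- With this choice and `r = α / p`, the bound `2 * r * (B * p)` obtained for equal dimensions is
  -- exactly `z`.
  set α : ℝ := z / (2 * B) with hα
  have hα0 : 0 < α := by positivity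
  obtain ⟨g, hg⟩ : ∃ g : PiecewiseRiemannianMetric L, normalizedEntropy g < (α : EReal) := by
    rw [← iInf_lt_iff]
    change minimalVolumeEntropy L < _
    rw [hL]; exact_mod_cast hα0
  have hv0 := totalVolume_pos g
  have hvt := totalVolume_lt_top g
  set p : ℝ := (totalVolume g ^ (1 / (dim L : ℝ))).toReal with hp
  have hpt : totalVolume g ^ (1 / (dim L : ℝ)) ≠ ⊤ :=
    ENNReal.rpow_ne_top_of_nonneg (by positivity) hvt.ne
  have hp0 : 0 < p := ENNReal.toReal_pos (ENNReal.rpow_pos hv0 hvt.ne).ne' hpt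
  have hpe : ((totalVolume g ^ (1 / (dim L : ℝ)) : ℝ≥0∞) : EReal) = (p : EReal) := by
    rw [hp, EReal.coe_ennreal_toReal hpt]
  set r : ℝ := α / p with hr
  have hr0 : 0 < r := by positivity
  have hent : entropy g < (r : EReal) := by
    rw [normalizedEntropy, hpe] at hg
    by_contra hcon
    have h1 : (r : EReal) * p ≤ entropy g * p :=
      mul_le_mul_of_nonneg_right (not_lt.mp hcon) (by exact_mod_cast hp0.le)
    rw [← EReal.coe_mul, hr, div_mul_cancel₀ _ hp0.ne'] at h1
    exact absurd hg (not_lt.mpr h1)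
  have hbound : ∀ h : PiecewiseRiemannianMetric K, IsNonexpanding F h g → IsUniformlyPositive h →
      (∀ s s' x, h.form s x = h.form s' x) → entropy h ≤ ((2 * r : ℝ) : EReal) :=
    fun h hF hpos hind => iSup_le fun x => hF.entropyAt_le hpos hind hinj x
      ((le_iSup (entropyAt g) _).trans_lt hent)
  rcases hdim.eq_or_lt with hd | hd
  -- Taking the volume of `g` itself as the error gives `vol(h) ≤ (C + 1) vol(g)`. In dimension `0`
  -- the exponent `1 / 0` is `0`, and the computation still holds.
  · obtain ⟨h, hF, hpos, hind, hvol⟩ := hC g (totalVolume g) hv0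
    refine (iInf_le _ h).trans ((normalizedEntropy_le (a := 2 * r) (q := B * p) (by positivity)
      (by positivity) (hbound h hF hpos hind) ?_).trans (le_of_eq ?_))
    · rw [if_pos hd] at hvol
      have h1 : totalVolume h ≤ ENNReal.ofReal ((C : ℝ) + 1) * totalVolume g := by
        refine hvol.trans (le_of_eq ?_)
        rw [ENNReal.ofReal_add (Nat.cast_nonneg C) zero_le_one, ENNReal.ofReal_natCast,
          ENNReal.ofReal_one, add_mul, one_mul]
      calc totalVolume h ^ (1 / (dim K : ℝ))
          ≤ (ENNReal.ofReal ((C : ℝ) + 1) * totalVolume g) ^ (1 / (dim K : ℝ)) := by gcongr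
        _ = ENNReal.ofReal (B * p) := by
            rw [ENNReal.mul_rpow_of_nonneg _ _ (by positivity), ENNReal.ofReal_mul hB0.le, hB,
              ENNReal.ofReal_rpow_of_pos (by positivity), hp, ENNReal.ofReal_toReal hpt, hd]
    · congr 1
      rw [hr, hα]; field_simp
  · have hn : (0 : ℝ) < dim K := by exact_mod_cast (Nat.zero_le _).trans_lt hd
    -- The entropy bound `2 * r` depends on `g` alone, so the volume can be made small afterwards:
    -- volume at most `q ^ dim K` gives the product `2 * r * q = z`.
    set q : ℝ := z / (2 * r) with hq
    have hq0 : 0 < q := by positivity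
    obtain ⟨h, hF, hpos, hind, hvol⟩ := hC g (ENNReal.ofReal (q ^ (dim K : ℝ)))
      (ENNReal.ofReal_pos.mpr (by positivity))
    refine (iInf_le _ h).trans ((normalizedEntropy_le (a := 2 * r) (q := q) (by positivity)
      hq0.le (hbound h hF hpos hind) ?_).trans (le_of_eq ?_))
    · rw [if_neg hd.ne, mul_zero, zero_add] at hvol
      calc totalVolume h ^ (1 / (dim K : ℝ))
          ≤ ENNReal.ofReal (q ^ (dim K : ℝ)) ^ (1 / (dim K : ℝ)) := by gcongr
        _ = ENNReal.ofReal q := by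
            rw [ENNReal.ofReal_rpow_of_pos (by positivity), ← Real.rpow_mul hq0.le,
              mul_one_div_cancel hn.ne', Real.rpow_one]
    · congr 1
      rw [hq]; field_simp

end Vanishing

end MinVolEntropy

end

theorem proposition3p5 {G : Type*} [Group G] (hG : MinVolEntropy.IsOfFiniteType G) :
    (∃ (V : Type) (_ : Fintype V) (K : AbstractSimplicialComplex V),
        MinVolEntropy.IsGComplex G K ∧
        MinVolEntropy.dim K = MinVolEntropy.geometricDimension G ∧
        MinVolEntropy.minimalVolumeEntropy K = 0) ↔
      ∀ (V : Type) [Fintype V] (K : AbstractSimplicialComplex V),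
        MinVolEntropy.IsGComplex G K → MinVolEntropy.minimalVolumeEntropy K = 0 := by
  constructor
  · rintro ⟨W, _, L, ⟨⟨hLc, hLπ⟩, x₀, ⟨eL⟩⟩, hdim, hL⟩ V _ K hK
    have hle : MinVolEntropy.dim L ≤ MinVolEntropy.dim K :=
      hdim.trans_le (Nat.sInf_le ⟨V, _, K, hK, rfl⟩)
    obtain ⟨⟨hKc, -⟩, y₀, ⟨eK⟩⟩ := hK
    obtain ⟨F, hF⟩ := MinVolEntropy.exists_plMap_injective hLπ (eK.trans eL.symm)
    exact MinVolEntropy.minimalVolumeEntropy_eq_zero_of_plMap F hle hF hL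
  · intro h
    obtain ⟨V, hV, K, hK⟩ := hG
    obtain ⟨W, hW, L, hL, hdim⟩ := Nat.sInf_mem (s := {d | ∃ (V : Type) (_ : Fintype V)
      (K : AbstractSimplicialComplex V), MinVolEntropy.IsGComplex G K ∧ MinVolEntropy.dim K = d})
      ⟨_, V, hV, K, hK, rfl⟩
    exact ⟨W, hW, L, hL, hdim, h W L hL⟩
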